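/- Let $p\colon X\to S$ be a holomorphic submersion of (Hausdorff, finite-dimensional) complex manifolds which is also a Serre fibration, and let $\gamma\colon[0,1]\to S$ be a continuous path. For a complex manifold $M$ let $\mathrm{FlatConn}(M)$ be the category of holomorphic vector bundles of finite rank on $M$ with a flat holomorphic connection (morphisms: holomorphic bundle maps over $\mathrm{id}_M$ commuting with the connections), let $\Pi_1(M)$ be the fundamental groupoid of $M$, whose space of arrows carries the complex structure for which the end point map to $M\times M$ is a local biholomorphism, and let $\mathrm{Rep}(\Pi_1(M))$ be the category of its representations, i.e. of holomorphic vector bundles on $M$ on which $\Pi_1(M)$ acts linearly and holomorphically. The Riemann–Hilbert functor $\mathrm{RH}_M\colon \mathrm{FlatConn}(M)\to\mathrm{Rep}(\Pi_1(M))$ keeps the bundle and lets homotopy classes of paths act by parallel transport. Write $X_s=p^{-1}(s)$. For a contractible open neighbourhood $\mathbb D\subset S\times\mathbb C$ of the graph $\{(\gamma(t),t): t\in[0,1]\}$, let $\pi\colon\Gamma^*X=X\times_S\mathbb D\to\mathbb D$ be the pulled back family, let $e$ be the path $t\mapsto(\gamma(t),t)$ in $\mathbb D$, and let $Q_\gamma=\pi_*^{-1}([e])\subset\Pi_1(\Gamma^*X)$,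 where $\pi_*\colon\Pi_1(\Gamma^*X)\to\Pi_1(\mathbb D)$. Let $\mu_0\colon Q_\gamma\to X_{\gamma(0)}$ and $\mu_1\colon Q_\gamma\to X_{\gamma(1)}$ be the starting point and the end point; $\Pi_1(X_{\gamma(0)})$ acts on $Q_\gamma$ from the left and $\Pi_1(X_{\gamma(1)})$ from the right, by concatenation in $\Pi_1(\Gamma^*X)$. A functor $\Phi\colon\mathrm{Rep}(\Pi_1(X_{\gamma(0)}))\to\mathrm{Rep}(\Pi_1(X_{\gamma(1)}))$ is induced by $Q_\gamma$ if, naturally in $V$, $\Phi(V)$ is the quotient of $\mu_0^*V$ by the action of $\Pi_1(X_{\gamma(0)})$ with the residual action of $\Pi_1(X_{\gamma(1)})$; that is, there is a holomorphic bundle isomorphism $\mu_0^*V\cong\mu_1^*\Phi(V)$ over $Q_\gamma$, natural in $V$, which is invariant under $\Pi_1(X_{\gamma(0)})$ and equivariant under $\Pi_1(X_{\gamma(1)})$. Then such a $\mathbb D$ exists, and there is an equivalence of categories $$\mathbb P_\gamma\colon \mathrm{FlatConn}(X_{\gamma(0)})\to\mathrm{FlatConn}(X_{\gamma(1)})$$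 which, for every choice of $\mathbb D$, is induced by $Q_\gamma$: the functors $\mathrm{RH}_{X_{\gamma(0)}}$ and $\mathrm{RH}_{X_{\gamma(1)}}$ are equivalences, there is an equivalence $\Phi\colon\mathrm{Rep}(\Pi_1(X_{\gamma(0)}))\to\mathrm{Rep}(\Pi_1(X_{\gamma(1)}))$ induced by $Q_\gamma$, and $\mathbb P_\gamma\cong\mathrm{RH}_{X_{\gamma(1)}}^{-1}\circ\Phi\circ\mathrm{RH}_{X_{\gamma(0)}}$. It is canonical: every functor obtained in this way, from any choice of $\mathbb D$, is naturally isomorphic to $\mathbb P_\gamma$. -/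

import Mathlib

open CategoryTheory Manifold
open scoped ContDiff Topology

universe u v w

noncomputable section

namespace Isomonodromy

/-! ## Serre fibrations -/

/-- Serre fibrations: continuous maps with the homotopy lifting property for all cubes. -/
def IsSerreFibration {X S : Type*} [TopologicalSpace X] [TopologicalSpace S] (p : X → S) : Prop :=
  Continuous p ∧
    ∀ (n : ℕ) (H : C((Fin n → unitInterval) × unitInterval, S)) (f : C(Fin n → unitInterval, X)),
      (∀ x, p (f x) = H (x, 0)) →
        ∃ K : C((Fin n → unitInterval) × unitInterval, X),
          (∀ x, K (x, 0) = f x) ∧ ∀ z, p (K z) = H z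

/-! ## Fibres of a holomorphic submersion, as complex manifolds -/

section Fibre

variable {E : Type u} {B : Type*} [NormedAddCommGroup E] [NormedSpace ℂ E]
  [NormedAddCommGroup B] [NormedSpace ℂ B]
  {X S : Type*} [TopologicalSpace X] [ChartedSpace E X]
  [TopologicalSpace S] [ChartedSpace B S] {p : X → S}

/-- The fibre `X_s = p⁻¹(s)` of the holomorphic submersion `p`. -/
@[ext] structure Fibre (_hp : IsSubmersion 𝓘(ℂ, E) 𝓘(ℂ, B) ω p) (s : S) where
  /-- The underlying point of the total space. -/
  val : X
  property : p val = s

variable (hp : IsSubmersion 𝓘(ℂ, E) 𝓘(ℂ, B) ω p) (s : S)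

instance : TopologicalSpace (Fibre hp s) := TopologicalSpace.induced Fibre.val inferInstance

theorem Fibre.isInducing_val : Topology.IsInducing (Fibre.val : Fibre hp s → X) := ⟨rfl⟩

theorem Fibre.continuous_val : Continuous (Fibre.val : Fibre hp s → X) := continuous_induced_dom

open Classical in
/-- Inverse of the chart `Fibre.chart` of the fibre at `x`. -/
def Fibre.chartInv (x : Fibre hp s) (v : hp.complement) : Fibre hp s :=
  let h := hp.isSubmersionOfComplement_complement x.val
  if hv : p (h.domChart.symm (h.equiv.symm (h.codChart s, v))) = s then
    ⟨h.domChart.symm (h.equiv.symm (h.codChart s, v)), hv⟩ else x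

theorem Fibre.equiv_eq (x y : Fibre hp s)
    (hy : y.val ∈ (hp.isSubmersionOfComplement_complement x.val).domChart.source) :
    let h := hp.isSubmersionOfComplement_complement x.val
    h.equiv.symm (h.codChart s, (h.equiv (h.domChart y.val)).2) = h.domChart y.val := by
  intro h
  have h0 := h.writtenInCharts
    (show h.domChart y.val ∈ (h.domChart.extend 𝓘(ℂ, E)).target by
      simpa using h.domChart.map_source hy)
  have h1 : h.codChart s = (h.equiv (h.domChart y.val)).1 := by
    simpa [h.domChart.left_inv hy, y.property] using h0
  rw [h1, Prod.mk.eta, ContinuousLinearEquiv.symm_apply_apply]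

theorem Fibre.chartInv_val (x : Fibre hp s) (v : hp.complement) :
    let h := hp.isSubmersionOfComplement_complement x.val
    h.equiv.symm (h.codChart s, v) ∈ h.domChart.target →
      (Fibre.chartInv hp s x v).val = h.domChart.symm (h.equiv.symm (h.codChart s, v)) := by
  intro h hv
  have hsrc : s ∈ h.codChart.source := by
    have := h.mem_codChart_source
    rwa [x.property] at this
  have h0 := h.writtenInCharts
    (show h.equiv.symm (h.codChart s, v) ∈ (h.domChart.extend 𝓘(ℂ, E)).target by simpa using hv)
  have h1 : h.codChart (p (h.domChart.symm (h.equiv.symm (h.codChart s, v)))) = h.codChart s := by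
    simpa using h0
  have h2 : p (h.domChart.symm (h.equiv.symm (h.codChart s, v))) = s :=
    h.codChart.injOn (h.mapsto_domChart_source_codChart_source (h.domChart.map_target hv)) hsrc h1
  unfold Fibre.chartInv
  rw [dif_pos h2]

/-- Near a point `x` of the fibre, `p` is in suitable holomorphic charts the projection
`(u, v) ↦ u`; the second component `v` is a chart of the fibre. -/
def Fibre.chart (x : Fibre hp s) : OpenPartialHomeomorph (Fibre hp s) hp.complement :=
  let h := hp.isSubmersionOfComplement_complement x.val
  { toFun := fun y => (h.equiv (h.domChart y.val)).2
    invFun := Fibre.chartInv hp s x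
    source := {y | y.val ∈ h.domChart.source}
    target := {v | h.equiv.symm (h.codChart s, v) ∈ h.domChart.target}
    map_source' := fun y hy => by
      have h1 := Fibre.equiv_eq hp s x y hy
      change h.equiv.symm (h.codChart s, (h.equiv (h.domChart y.val)).2) ∈ h.domChart.target
      rw [h1]
      exact h.domChart.map_source hy
    map_target' := fun v hv => by
      change (Fibre.chartInv hp s x v).val ∈ h.domChart.source
      rw [Fibre.chartInv_val hp s x v hv]
      exact h.domChart.map_target hv
    left_inv' := fun y hy => by
      have h1 := Fibre.equiv_eq hp s x y hy
      apply Fibre.ext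
      rw [Fibre.chartInv_val hp s x _ (by rw [h1]; exact h.domChart.map_source hy), h1]
      exact h.domChart.left_inv hy
    right_inv' := fun v hv => by
      rw [Fibre.chartInv_val hp s x v hv, h.domChart.right_inv hv,
        ContinuousLinearEquiv.apply_symm_apply]
    open_source := h.domChart.open_source.preimage (Fibre.continuous_val hp s)
    open_target := h.domChart.open_target.preimage (by fun_prop)
    continuousOn_toFun := by
      have h1 : ContinuousOn (fun y : Fibre hp s => h.domChart y.val)
          {y | y.val ∈ h.domChart.source} :=
        h.domChart.continuousOn.comp (Fibre.continuous_val hp s).continuousOn (fun y hy => hy)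
      exact continuous_snd.comp_continuousOn (h.equiv.continuous.comp_continuousOn h1)
    continuousOn_invFun := by
      rw [(Fibre.isInducing_val hp s).continuousOn_iff]
      have h1 : ContinuousOn
          (fun v : hp.complement => h.domChart.symm (h.equiv.symm (h.codChart s, v)))
          {v | h.equiv.symm (h.codChart s, v) ∈ h.domChart.target} :=
        h.domChart.symm.continuousOn.comp
          (by fun_prop : Continuous fun v : hp.complement =>
            h.equiv.symm (h.codChart s, v)).continuousOn (fun v hv => hv)
      exact h1.congr fun v hv => Fibre.chartInv_val hp s x v hv }

instance : ChartedSpace hp.complement (Fibre hp s) where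
  atlas := Set.range (Fibre.chart hp s)
  chartAt := Fibre.chart hp s
  mem_chart_source x := (hp.isSubmersionOfComplement_complement x.val).mem_domChart_source
  chart_mem_atlas x := ⟨x, rfl⟩

instance [IsManifold 𝓘(ℂ, E) ω X] : IsManifold 𝓘(ℂ, hp.complement) ω (Fibre hp s) := by
  apply isManifold_of_contDiffOn
  rintro _ _ ⟨x, rfl⟩ ⟨x', rfl⟩
  let h := hp.isSubmersionOfComplement_complement x.val
  let h' := hp.isSubmersionOfComplement_complement x'.val
  have hc : ContDiffOn ℂ ω (h.domChart.symm ≫ₕ h'.domChart)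
      (h.domChart.symm ≫ₕ h'.domChart).source := by
    have h1 := (contDiffGroupoid ω 𝓘(ℂ, E)).compatible_of_mem_maximalAtlas
      h.domChart_mem_maximalAtlas h'.domChart_mem_maximalAtlas
    have h2 := (mem_groupoid_of_pregroupoid.1 h1).1
    simpa [contDiffPregroupoid] using h2
  have hl : ContDiff ℂ ω (fun v : hp.complement => h.equiv.symm (h.codChart s, v)) :=
    h.equiv.symm.contDiff.comp (contDiff_const.prodMk contDiff_id)
  have hr : ContDiff ℂ ω (fun z : E => (h'.equiv z).2) :=
    contDiff_snd.comp h'.equiv.contDiff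
  have key : ∀ v ∈ ((Fibre.chart hp s x).symm ≫ₕ Fibre.chart hp s x').source,
      h.equiv.symm (h.codChart s, v) ∈ (h.domChart.symm ≫ₕ h'.domChart).source ∧
      ((Fibre.chart hp s x).symm ≫ₕ Fibre.chart hp s x') v =
        (h'.equiv ((h.domChart.symm ≫ₕ h'.domChart) (h.equiv.symm (h.codChart s, v)))).2 := by
    intro v hv
    rw [OpenPartialHomeomorph.trans_source] at hv
    obtain ⟨hv1, hv2⟩ := hv
    have hv1' : h.equiv.symm (h.codChart s, v) ∈ h.domChart.target := hv1
    have hval := Fibre.chartInv_val hp s x v hv1'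
    have hv2' : (Fibre.chartInv hp s x v).val ∈ h'.domChart.source := hv2
    rw [hval] at hv2'
    refine ⟨?_, ?_⟩
    · rw [OpenPartialHomeomorph.trans_source]
      exact ⟨hv1', hv2'⟩
    · change (h'.equiv (h'.domChart (Fibre.chartInv hp s x v).val)).2 = _
      rw [hval]
      rfl
  have hfin := (hr.comp_contDiffOn (hc.comp hl.contDiffOn fun v hv => (key v hv).1)).congr
    fun v hv => (key v hv).2
  simpa using hfin

end Fibre

/-! ## Spaces of homotopy classes of paths, as complex manifolds -/

section PathClasses

variable {E₁ E₂ : Type*} [NormedAddCommGroup E₁] [NormedSpace ℂ E₁]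
  [NormedAddCommGroup E₂] [NormedSpace ℂ E₂]
  {A B Y : Type*} [TopologicalSpace A] [TopologicalSpace B] [TopologicalSpace Y]

/-- `U` is an open set in which any two points are joined by a path, and two paths in `U` with the
same end points are homotopic in the ambient space. -/
structure IsTame (U : Set A) : Prop where
  isOpen : IsOpen U
  joined : ∀ x ∈ U, ∀ y ∈ U, ∃ δ : Path x y, ∀ t, δ t ∈ U
  homotopic : ∀ {x y : A} (δ ε : Path x y), (∀ t, δ t ∈ U) → (∀ t, ε t ∈ U) → δ.Homotopic ε

theorem exists_tame [ChartedSpace E₁ A] (x : A) {W : Set A} (hW : W ∈ 𝓝 x) :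
    ∃ U ⊆ W, x ∈ U ∧ IsTame U := by
  let φ := chartAt E₁ x
  have hx : x ∈ φ.source := mem_chart_source E₁ x
  have h1 : φ.target ∩ φ.symm ⁻¹' W ∈ 𝓝 (φ x) := by
    refine Filter.inter_mem (φ.open_target.mem_nhds (φ.map_source hx)) ?_
    have := φ.symm.continuousAt (x := φ x) (φ.map_source hx)
    apply this
    rwa [φ.left_inv hx]
  obtain ⟨r, hr, hball⟩ := Metric.mem_nhds_iff.1 h1
  have hconv : Convex ℝ (Metric.ball (φ x) r) := convex_ball _ _
  have hcomb : ∀ a ∈ Metric.ball (φ x) r, ∀ b ∈ Metric.ball (φ x) r, ∀ t : unitInterval,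
      (1 - (t : ℝ)) • a + (t : ℝ) • b ∈ Metric.ball (φ x) r := fun a ha b hb t =>
    hconv ha hb (by linarith [t.2.2]) t.2.1 (by ring)
  have hU : ∀ z ∈ Metric.ball (φ x) r,
      φ.symm z ∈ φ.source ∩ φ ⁻¹' Metric.ball (φ x) r := fun z hz =>
    ⟨φ.map_target (hball hz).1, by
      change φ (φ.symm z) ∈ Metric.ball (φ x) r
      rwa [φ.right_inv (hball hz).1]⟩
  have hcs : ContinuousOn φ.symm (Metric.ball (φ x) r) :=
    φ.symm.continuousOn.mono fun z hz => (hball hz).1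
  refine ⟨φ.source ∩ φ ⁻¹' Metric.ball (φ x) r, ?_, ⟨hx, Metric.mem_ball_self hr⟩, ?_, ?_, ?_⟩
  · rintro y ⟨hy1, hy2⟩
    have := (hball hy2).2
    rwa [Set.mem_preimage, φ.left_inv hy1] at this
  · exact φ.isOpen_inter_preimage Metric.isOpen_ball
  · rintro y ⟨hy1, hy2⟩ z ⟨hz1, hz2⟩
    refine ⟨⟨⟨fun t => φ.symm ((1 - (t : ℝ)) • φ y + (t : ℝ) • φ z), ?_⟩, ?_, ?_⟩, ?_⟩
    · exact hcs.comp_continuous (by fun_prop) fun t => hcomb _ hy2 _ hz2 t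
    · simp [φ.left_inv hy1]
    · simp [φ.left_inv hz1]
    · exact fun t => hU _ (hcomb _ hy2 _ hz2 t)
  · intro y z δ ε hδ hε
    have hcδ : Continuous fun t => φ (δ t) :=
      φ.continuousOn.comp_continuous δ.continuous fun t => (hδ t).1
    have hcε : Continuous fun t => φ (ε t) :=
      φ.continuousOn.comp_continuous ε.continuous fun t => (hε t).1
    have hy1 : y ∈ φ.source := by simpa using (hδ 0).1
    have hz1 : z ∈ φ.source := by simpa using (hδ 1).1
    refine ⟨⟨⟨⟨fun q => φ.symm ((1 - (q.1 : ℝ)) • φ (δ q.2) + (q.1 : ℝ) • φ (ε q.2)), ?_⟩,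
      ?_, ?_⟩, ?_⟩⟩
    · refine hcs.comp_continuous ?_ fun q => hcomb _ (hδ q.2).2 _ (hε q.2).2 q.1
      have h1 : Continuous fun q : unitInterval × unitInterval => φ (δ q.2) :=
        hcδ.comp continuous_snd
      have h2 : Continuous fun q : unitInterval × unitInterval => φ (ε q.2) :=
        hcε.comp continuous_snd
      have h3 : Continuous fun q : unitInterval × unitInterval => (q.1 : ℝ) :=
        continuous_subtype_val.comp continuous_fst
      exact ((continuous_const.sub h3).smul h1).add (h3.smul h2)
    · intro t
      simp [φ.left_inv (hδ t).1]
    · intro t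
      simp [φ.left_inv (hε t).1]
    · intro s t ht
      rcases ht with rfl | rfl
      · simp [← add_smul, φ.left_inv hy1]
      · simp [← add_smul, φ.left_inv hz1]

/-- A tame neighbourhood of `x` in the domain of the chart at `x`. -/
def tameNhd (E₁ : Type*) [NormedAddCommGroup E₁] [NormedSpace ℂ E₁] [ChartedSpace E₁ A] (x : A) :
    Set A :=
  Classical.choose (exists_tame (E₁ := E₁) x (chart_source_mem_nhds E₁ x))

section
variable (E₁) [ChartedSpace E₁ A] (x : A)

theorem tameNhd_subset : tameNhd E₁ x ⊆ (chartAt E₁ x).source :=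
  (Classical.choose_spec (exists_tame (E₁ := E₁) x (chart_source_mem_nhds E₁ x))).1

theorem mem_tameNhd : x ∈ tameNhd E₁ x :=
  (Classical.choose_spec (exists_tame (E₁ := E₁) x (chart_source_mem_nhds E₁ x))).2.1

theorem isTame_tameNhd : IsTame (tameNhd E₁ x) :=
  (Classical.choose_spec (exists_tame (E₁ := E₁) x (chart_source_mem_nhds E₁ x))).2.2

end

/-- For maps `a : A → Y` and `b : B → Y`, the space of triples of a point `src` of `A`, a point
`tgt` of `B` and a homotopy class (fixing end points) of paths in `Y` from `a src` to `b tgt`. In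
other words, the fibre product of `A × B` with the space of arrows of the fundamental groupoid
`Π₁(Y)` over `Y × Y`. -/
structure PathClasses (a : C(A, Y)) (b : C(B, Y)) where
  /-- The starting point. -/
  src : A
  /-- The end point. -/
  tgt : B
  /-- The homotopy class of paths. -/
  cls : Path.Homotopic.Quotient (a src) (b tgt)

namespace PathClasses

variable {a : C(A, Y)} {b : C(B, Y)}

/-- Move the end points of `q` along paths `δ` in `A` and `ε` in `B`. -/
def move (q : PathClasses a b) {x : A} {y : B} (δ : Path q.src x) (ε : Path q.tgt y) :
    PathClasses a b :=
  ⟨x, y, ((Path.Homotopic.Quotient.mk δ).map a).symm.trans (q.cls.trans ((Path.Homotopic.Quotient.mk ε).map b))⟩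

/-- The path classes obtained from `q` by moving the end points inside `U` and inside `V`. -/
def nhd (q : PathClasses a b) (U : Set A) (V : Set B) : Set (PathClasses a b) :=
  {q' | ∃ (δ : Path q.src q'.src) (ε : Path q.tgt q'.tgt), (∀ t, δ t ∈ U) ∧ (∀ t, ε t ∈ V) ∧
    q' = q.move δ ε}

theorem move_mem_nhd (q : PathClasses a b) {U : Set A} {V : Set B} {x : A} {y : B}
    (δ : Path q.src x) (ε : Path q.tgt y) (hδ : ∀ t, δ t ∈ U) (hε : ∀ t, ε t ∈ V) :
    q.move δ ε ∈ q.nhd U V := ⟨δ, ε, hδ, hε, rfl⟩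

theorem map_trans' {Z : Type*} [TopologicalSpace Z] {x y z : A} (P : Path.Homotopic.Quotient x y)
    (Q : Path.Homotopic.Quotient y z) (f : C(A, Z)) : (P.trans Q).map f = (P.map f).trans (Q.map f) := by
  induction P, Q using Path.Homotopic.Quotient.ind₂
  simp [← Path.Homotopic.Quotient.mk_trans, ← Path.Homotopic.Quotient.mk_map]

theorem symm_trans_rev {x y z : Y} (P : Path.Homotopic.Quotient x y) (Q : Path.Homotopic.Quotient y z) :
    (P.trans Q).symm = Q.symm.trans P.symm := by
  induction P, Q using Path.Homotopic.Quotient.ind₂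
  simp [← Path.Homotopic.Quotient.mk_trans, ← Path.Homotopic.Quotient.mk_symm]

theorem move_move (q : PathClasses a b) {x x' : A} {y y' : B} (δ : Path q.src x)
    (ε : Path q.tgt y) (δ' : Path x x') (ε' : Path y y') :
    (q.move δ ε).move δ' ε' = q.move (δ.trans δ') (ε.trans ε') := by
  simp only [move, Path.Homotopic.Quotient.mk_trans, map_trans', symm_trans_rev, Path.Homotopic.Quotient.trans_assoc]

theorem nhd_unique {q q₁ q₂ : PathClasses a b} {U : Set A} {V : Set B} (hU : IsTame U)
    (hV : IsTame V) (h₁ : q₁ ∈ q.nhd U V) (h₂ : q₂ ∈ q.nhd U V) (hs : q₁.src = q₂.src)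
    (ht : q₁.tgt = q₂.tgt) : q₁ = q₂ := by
  obtain ⟨x₁, y₁, c₁⟩ := q₁
  obtain ⟨x₂, y₂, c₂⟩ := q₂
  obtain rfl : x₁ = x₂ := hs
  obtain rfl : y₁ = y₂ := ht
  obtain ⟨δ₁, ε₁, hδ₁, hε₁, e₁⟩ := h₁
  obtain ⟨δ₂, ε₂, hδ₂, hε₂, e₂⟩ := h₂
  have hδ : Path.Homotopic.Quotient.mk δ₁ = Path.Homotopic.Quotient.mk δ₂ := Path.Homotopic.Quotient.eq.2 (hU.homotopic δ₁ δ₂ hδ₁ hδ₂)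
  have hε : Path.Homotopic.Quotient.mk ε₁ = Path.Homotopic.Quotient.mk ε₂ := Path.Homotopic.Quotient.eq.2 (hV.homotopic ε₁ ε₂ hε₁ hε₂)
  rw [e₁, e₂]
  simp only [move, hδ, hε]

theorem trans_mem {Z : Type*} [TopologicalSpace Z] {W : Set Z} {x y z : Z} (α : Path x y)
    (β : Path y z) (hα : ∀ t, α t ∈ W) (hβ : ∀ t, β t ∈ W) (t : unitInterval) :
    α.trans β t ∈ W := by
  rw [Path.trans_apply]
  split_ifs
  exacts [hα _, hβ _]

theorem mem_src {q q' : PathClasses a b} {U : Set A} {V : Set B} (h : q' ∈ q.nhd U V) :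
    q'.src ∈ U := by
  obtain ⟨δ, -, hδ, -⟩ := h
  simpa using hδ 1

theorem mem_tgt {q q' : PathClasses a b} {U : Set A} {V : Set B} (h : q' ∈ q.nhd U V) :
    q'.tgt ∈ V := by
  obtain ⟨-, ε, -, hε, -⟩ := h
  simpa using hε 1

theorem nhd_step {q r : PathClasses a b} {U : Set A} {V : Set B} (hr : r ∈ q.nhd U V)
    {x : A} {y : B} (δ : Path r.src x) (ε : Path r.tgt y) (hδ : ∀ t, δ t ∈ U)
    (hε : ∀ t, ε t ∈ V) : r.move δ ε ∈ q.nhd U V := by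
  obtain ⟨δ₀, ε₀, hδ₀, hε₀, e⟩ := hr
  obtain ⟨x₁, y₁, c₁⟩ := r
  change Path x₁ x at δ
  change Path y₁ y at ε
  change Path q.src x₁ at δ₀
  change Path q.tgt y₁ at ε₀
  have e' : c₁ = ((Path.Homotopic.Quotient.mk δ₀).map a).symm.trans
      (q.cls.trans ((Path.Homotopic.Quotient.mk ε₀).map b)) := by
    simpa only [move, PathClasses.mk.injEq, heq_eq_eq, true_and] using e
  clear e
  subst e'
  have hm := move_move q δ₀ ε₀ δ ε
  refine ⟨δ₀.trans δ, ε₀.trans ε, trans_mem δ₀ δ hδ₀ hδ, trans_mem ε₀ ε hε₀ hε, hm⟩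

variable (E₁ E₂) [ChartedSpace E₁ A] [ChartedSpace E₂ B]

/-- The neighbourhood of `q` on which the chart at `q` is defined. -/
def chartNhd (q : PathClasses a b) : Set (PathClasses a b) :=
  q.nhd (tameNhd E₁ q.src) (tameNhd E₂ q.tgt)

theorem exists_mem_chartNhd (q : PathClasses a b) {x : A} {y : B} (hx : x ∈ tameNhd E₁ q.src)
    (hy : y ∈ tameNhd E₂ q.tgt) : ∃ q' ∈ chartNhd E₁ E₂ q, q'.src = x ∧ q'.tgt = y := by
  obtain ⟨δ, hδ⟩ := (isTame_tameNhd E₁ q.src).joined _ (mem_tameNhd E₁ q.src) x hx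
  obtain ⟨ε, hε⟩ := (isTame_tameNhd E₂ q.tgt).joined _ (mem_tameNhd E₂ q.tgt) y hy
  exact ⟨q.move δ ε, q.move_mem_nhd δ ε hδ hε, rfl, rfl⟩

open Classical in
/-- Inverse of the chart at `q`: the point of `chartNhd q` with given end points. -/
def chartInv (q : PathClasses a b) (w : E₁ × E₂) : PathClasses a b :=
  if h : (chartAt E₁ q.src).symm w.1 ∈ tameNhd E₁ q.src ∧
      (chartAt E₂ q.tgt).symm w.2 ∈ tameNhd E₂ q.tgt
  then Classical.choose (exists_mem_chartNhd E₁ E₂ q h.1 h.2) else q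

theorem chartInv_spec (q : PathClasses a b) {w : E₁ × E₂}
    (h₁ : (chartAt E₁ q.src).symm w.1 ∈ tameNhd E₁ q.src)
    (h₂ : (chartAt E₂ q.tgt).symm w.2 ∈ tameNhd E₂ q.tgt) :
    chartInv E₁ E₂ q w ∈ chartNhd E₁ E₂ q ∧
      (chartInv E₁ E₂ q w).src = (chartAt E₁ q.src).symm w.1 ∧
      (chartInv E₁ E₂ q w).tgt = (chartAt E₂ q.tgt).symm w.2 := by
  unfold chartInv
  rw [dif_pos ⟨h₁, h₂⟩]
  exact Classical.choose_spec (exists_mem_chartNhd E₁ E₂ q h₁ h₂)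

/-- The set of coordinates of the points of a tame neighbourhood. -/
def coordSet {E : Type*} [NormedAddCommGroup E] [NormedSpace ℂ E] [ChartedSpace E A] (x : A)
    (U : Set A) : Set E :=
  (chartAt E x).target ∩ (chartAt E x).symm ⁻¹' U

theorem isOpen_coordSet {E : Type*} [NormedAddCommGroup E] [NormedSpace ℂ E] [ChartedSpace E A]
    (x : A) {U : Set A} (hU : IsOpen U) : IsOpen (coordSet (E := E) x U) :=
  (chartAt E x).isOpen_inter_preimage_symm hU

/-- The chart at `q`: near `q`, a path class is determined by its end points, and the coordinates
are those of the end points. -/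
def preChart (q : PathClasses a b) : PartialEquiv (PathClasses a b) (E₁ × E₂) where
  toFun q' := (chartAt E₁ q.src q'.src, chartAt E₂ q.tgt q'.tgt)
  invFun := chartInv E₁ E₂ q
  source := chartNhd E₁ E₂ q
  target := coordSet q.src (tameNhd E₁ q.src) ×ˢ coordSet q.tgt (tameNhd E₂ q.tgt)
  map_source' q' hq' := by
    have h₁ := mem_src hq'
    have h₂ := mem_tgt hq'
    have h₁' := tameNhd_subset E₁ _ h₁
    have h₂' := tameNhd_subset E₂ _ h₂
    refine ⟨⟨(chartAt E₁ q.src).map_source h₁', ?_⟩, ⟨(chartAt E₂ q.tgt).map_source h₂', ?_⟩⟩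
    · simpa only [Set.mem_preimage, (chartAt E₁ q.src).left_inv h₁'] using h₁
    · simpa only [Set.mem_preimage, (chartAt E₂ q.tgt).left_inv h₂'] using h₂
  map_target' w hw := (chartInv_spec E₁ E₂ q hw.1.2 hw.2.2).1
  left_inv' q' hq' := by
    have h₁ := mem_src hq'
    have h₂ := mem_tgt hq'
    have e₁ := (chartAt E₁ q.src).left_inv (tameNhd_subset E₁ _ h₁)
    have e₂ := (chartAt E₂ q.tgt).left_inv (tameNhd_subset E₂ _ h₂)
    obtain ⟨k₁, k₂, k₃⟩ := chartInv_spec E₁ E₂ q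
      (w := (chartAt E₁ q.src q'.src, chartAt E₂ q.tgt q'.tgt))
      (by simpa only [e₁] using h₁) (by simpa only [e₂] using h₂)
    exact nhd_unique (isTame_tameNhd E₁ q.src) (isTame_tameNhd E₂ q.tgt) k₁ hq'
      (k₂.trans e₁) (k₃.trans e₂)
  right_inv' w hw := by
    obtain ⟨-, k₂, k₃⟩ := chartInv_spec E₁ E₂ q hw.1.2 hw.2.2
    rw [k₂, k₃, (chartAt E₁ q.src).right_inv hw.1.1, (chartAt E₂ q.tgt).right_inv hw.2.1]

theorem preChart_trans_source_isOpen (q q' : PathClasses a b) :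
    IsOpen ((preChart E₁ E₂ q).symm.trans (preChart E₁ E₂ q')).source := by
  rw [isOpen_iff_mem_nhds]
  intro w hw
  rw [PartialEquiv.trans_source] at hw
  obtain ⟨hw₁, hw₂⟩ := hw
  have hw₁' : w ∈ coordSet (E := E₁) q.src (tameNhd E₁ q.src) ×ˢ
    coordSet (E := E₂) q.tgt (tameNhd E₂ q.tgt) := hw₁
  obtain ⟨k₁, k₂, k₃⟩ := chartInv_spec E₁ E₂ q hw₁'.1.2 hw₁'.2.2
  have hr' : chartInv E₁ E₂ q w ∈ chartNhd E₁ E₂ q' := hw₂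
  set r := chartInv E₁ E₂ q w with hr
  obtain ⟨U, hU, hrU, tU⟩ := exists_tame (E₁ := E₁) r.src
    (Filter.inter_mem ((isTame_tameNhd E₁ q.src).isOpen.mem_nhds (mem_src k₁))
      ((isTame_tameNhd E₁ q'.src).isOpen.mem_nhds (mem_src hr')))
  obtain ⟨V, hV, hrV, tV⟩ := exists_tame (E₁ := E₂) r.tgt
    (Filter.inter_mem ((isTame_tameNhd E₂ q.tgt).isOpen.mem_nhds (mem_tgt k₁))
      ((isTame_tameNhd E₂ q'.tgt).isOpen.mem_nhds (mem_tgt hr')))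
  have hopen : IsOpen (coordSet (E := E₁) q.src U ×ˢ coordSet (E := E₂) q.tgt V) :=
    (isOpen_coordSet q.src tU.isOpen).prod (isOpen_coordSet q.tgt tV.isOpen)
  refine Filter.mem_of_superset (hopen.mem_nhds ?_) ?_
  · refine ⟨⟨hw₁'.1.1, ?_⟩, ⟨hw₁'.2.1, ?_⟩⟩
    · rw [Set.mem_preimage, ← k₂]
      exact hrU
    · rw [Set.mem_preimage, ← k₃]
      exact hrV
  · intro z hz
    obtain ⟨m₁, m₂, m₃⟩ := chartInv_spec E₁ E₂ q (hU hz.1.2).1 (hV hz.2.2).1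
    obtain ⟨δ, hδ⟩ := tU.joined _ hrU _ hz.1.2
    obtain ⟨ε, hε⟩ := tV.joined _ hrV _ hz.2.2
    have n₁ : r.move δ ε ∈ chartNhd E₁ E₂ q :=
      nhd_step k₁ δ ε (fun t => (hU (hδ t)).1) (fun t => (hV (hε t)).1)
    have n₂ : r.move δ ε ∈ chartNhd E₁ E₂ q' :=
      nhd_step hr' δ ε (fun t => (hU (hδ t)).2) (fun t => (hV (hε t)).2)
    have heq : chartInv E₁ E₂ q z = r.move δ ε :=
      nhd_unique (isTame_tameNhd E₁ q.src) (isTame_tameNhd E₂ q.tgt) m₁ n₁ m₂ m₃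
    rw [PartialEquiv.trans_source]
    refine ⟨⟨⟨hz.1.1, (hU hz.1.2).1⟩, ⟨hz.2.1, (hV hz.2.2).1⟩⟩, ?_⟩
    change chartInv E₁ E₂ q z ∈ chartNhd E₁ E₂ q'
    rw [heq]
    exact n₂

theorem preChart_trans_eq (q q' : PathClasses a b) {w : E₁ × E₂}
    (hw : w ∈ ((preChart E₁ E₂ q).symm.trans (preChart E₁ E₂ q')).source) :
    w.1 ∈ ((chartAt E₁ q.src).symm ≫ₕ chartAt E₁ q'.src).source ∧
    w.2 ∈ ((chartAt E₂ q.tgt).symm ≫ₕ chartAt E₂ q'.tgt).source ∧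
    (preChart E₁ E₂ q).symm.trans (preChart E₁ E₂ q') w =
      (((chartAt E₁ q.src).symm ≫ₕ chartAt E₁ q'.src) w.1,
        ((chartAt E₂ q.tgt).symm ≫ₕ chartAt E₂ q'.tgt) w.2) := by
  rw [PartialEquiv.trans_source] at hw
  obtain ⟨hw₁, hw₂⟩ := hw
  have hw₁' : w ∈ coordSet (E := E₁) q.src (tameNhd E₁ q.src) ×ˢ
    coordSet (E := E₂) q.tgt (tameNhd E₂ q.tgt) := hw₁
  obtain ⟨-, k₂, k₃⟩ := chartInv_spec E₁ E₂ q hw₁'.1.2 hw₁'.2.2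
  have hr' : chartInv E₁ E₂ q w ∈ chartNhd E₁ E₂ q' := hw₂
  have s₁ := tameNhd_subset E₁ _ (mem_src hr')
  have s₂ := tameNhd_subset E₂ _ (mem_tgt hr')
  rw [k₂] at s₁
  rw [k₃] at s₂
  refine ⟨?_, ?_, ?_⟩
  · rw [OpenPartialHomeomorph.trans_source]
    exact ⟨hw₁'.1.1, s₁⟩
  · rw [OpenPartialHomeomorph.trans_source]
    exact ⟨hw₁'.2.1, s₂⟩
  · change (chartAt E₁ q'.src (chartInv E₁ E₂ q w).src,
      chartAt E₂ q'.tgt (chartInv E₁ E₂ q w).tgt) = _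
    rw [k₂, k₃]
    rfl

variable (a b) in
/-- The atlas given by all the charts `preChart q`. -/
def core : ChartedSpaceCore (E₁ × E₂) (PathClasses a b) where
  atlas := Set.range (preChart E₁ E₂)
  chartAt := preChart E₁ E₂
  mem_chart_source q := by
    refine ⟨Path.refl _, Path.refl _, fun _ => mem_tameNhd E₁ q.src,
      fun _ => mem_tameNhd E₂ q.tgt, ?_⟩
    obtain ⟨x, y, c⟩ := q
    have h₁ : ((Path.Homotopic.Quotient.mk (Path.refl x)).map a).symm =
        Path.Homotopic.Quotient.refl (a x) := by
      rw [← Path.Homotopic.Quotient.mk_map, ← Path.Homotopic.Quotient.mk_symm]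
      rfl
    have h₂ : (Path.Homotopic.Quotient.mk (Path.refl y)).map b =
        Path.Homotopic.Quotient.refl (b y) := by
      rw [← Path.Homotopic.Quotient.mk_map]
      rfl
    simp only [move, h₁, h₂, Path.Homotopic.Quotient.refl_trans,
      Path.Homotopic.Quotient.trans_refl]
  chart_mem_atlas q := ⟨q, rfl⟩
  open_source := by
    rintro _ _ ⟨q, rfl⟩ ⟨q', rfl⟩
    exact preChart_trans_source_isOpen E₁ E₂ q q'
  continuousOn_toFun := by
    rintro _ _ ⟨q, rfl⟩ ⟨q', rfl⟩
    have h₁ := ((chartAt E₁ q.src).symm ≫ₕ chartAt E₁ q'.src).continuousOn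
    have h₂ := ((chartAt E₂ q.tgt).symm ≫ₕ chartAt E₂ q'.tgt).continuousOn
    refine ContinuousOn.congr (ContinuousOn.prodMk
      (h₁.comp continuous_fst.continuousOn
        fun w hw => (preChart_trans_eq E₁ E₂ q q' hw).1)
      (h₂.comp continuous_snd.continuousOn
        fun w hw => (preChart_trans_eq E₁ E₂ q q' hw).2.1))
      fun w hw => (preChart_trans_eq E₁ E₂ q q' hw).2.2

end PathClasses

/-- The space `PathClasses a b` with the complex structure for which the end point map to `A × B`
is a local biholomorphism, where `A` and `B` are complex manifolds modelled on `E₁` and `E₂`. -/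
def PathManifold (_E₁ _E₂ : Type*) (a : C(A, Y)) (b : C(B, Y)) : Type _ := PathClasses a b

variable [ChartedSpace E₁ A] [ChartedSpace E₂ B] (a : C(A, Y)) (b : C(B, Y))

instance : TopologicalSpace (PathManifold E₁ E₂ a b) :=
  (PathClasses.core E₁ E₂ a b).toTopologicalSpace

instance : ChartedSpace (E₁ × E₂) (PathManifold E₁ E₂ a b) :=
  (PathClasses.core E₁ E₂ a b).toChartedSpace

instance [IsManifold 𝓘(ℂ, E₁) ω A] [IsManifold 𝓘(ℂ, E₂) ω B] :
    IsManifold 𝓘(ℂ, E₁ × E₂) ω (PathManifold E₁ E₂ a b) := by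
  apply isManifold_of_contDiffOn
  intro e e' he he'
  change e ∈ ⋃ (e : PartialEquiv _ _) (he : e ∈ (PathClasses.core E₁ E₂ a b).atlas),
    {(PathClasses.core E₁ E₂ a b).openPartialHomeomorph e he} at he
  change e' ∈ ⋃ (e : PartialEquiv _ _) (he : e ∈ (PathClasses.core E₁ E₂ a b).atlas),
    {(PathClasses.core E₁ E₂ a b).openPartialHomeomorph e he} at he'
  obtain ⟨_, ⟨_, rfl⟩, _, ⟨⟨q, rfl⟩, rfl⟩, he⟩ := he
  obtain ⟨_, ⟨_, rfl⟩, _, ⟨⟨q', rfl⟩, rfl⟩, he'⟩ := he'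
  obtain rfl := he
  obtain rfl := he'
  have h₁ : ContDiffOn ℂ ω ((chartAt E₁ q.src).symm ≫ₕ chartAt E₁ q'.src)
      ((chartAt E₁ q.src).symm ≫ₕ chartAt E₁ q'.src).source := by
    have h1 := (contDiffGroupoid ω 𝓘(ℂ, E₁)).compatible (chart_mem_atlas E₁ q.src)
      (chart_mem_atlas E₁ q'.src)
    have h2 := (mem_groupoid_of_pregroupoid.1 h1).1
    simpa [contDiffPregroupoid] using h2
  have h₂ : ContDiffOn ℂ ω ((chartAt E₂ q.tgt).symm ≫ₕ chartAt E₂ q'.tgt)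
      ((chartAt E₂ q.tgt).symm ≫ₕ chartAt E₂ q'.tgt).source := by
    have h1 := (contDiffGroupoid ω 𝓘(ℂ, E₂)).compatible (chart_mem_atlas E₂ q.tgt)
      (chart_mem_atlas E₂ q'.tgt)
    have h2 := (mem_groupoid_of_pregroupoid.1 h1).1
    simpa [contDiffPregroupoid] using h2
  have h₃ : ContDiffOn ℂ ω
      ((PathClasses.preChart E₁ E₂ q).symm.trans (PathClasses.preChart E₁ E₂ q'))
      ((PathClasses.preChart E₁ E₂ q).symm.trans (PathClasses.preChart E₁ E₂ q')).source :=
    ContDiffOn.congr (ContDiffOn.prodMk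
      (h₁.comp contDiff_fst.contDiffOn
        fun w hw => (PathClasses.preChart_trans_eq E₁ E₂ q q' hw).1)
      (h₂.comp contDiff_snd.contDiffOn
        fun w hw => (PathClasses.preChart_trans_eq E₁ E₂ q q' hw).2.1))
      fun w hw => (PathClasses.preChart_trans_eq E₁ E₂ q q' hw).2.2
  exact h₃.mono fun w hw => hw.1

end PathClasses

/-! ## Holomorphic vector bundles -/

section Bundles

variable {E : Type u} [NormedAddCommGroup E] [NormedSpace ℂ E]
  {M : Type v} [TopologicalSpace M] [ChartedSpace E M]

/-- A holomorphic vector bundle of finite rank on the complex manifold `M`: a family of complex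
vector spaces `Fib x` with, for every point `a`, a trivialisation over an open neighbourhood
`base a` of `a`, such that the transition functions are holomorphic. The rank is only required to
be locally constant. The values of `coord a` and `frame a` outside `base a` are irrelevant. -/
structure HolBundle (E : Type u) [NormedAddCommGroup E] [NormedSpace ℂ E]
    (M : Type v) [TopologicalSpace M] [ChartedSpace E M] where
  /-- The fibres. -/
  Fib : M → Type w
  [addCommGroup : ∀ x, AddCommGroup (Fib x)]
  [module : ∀ x, Module ℂ (Fib x)]
  /-- The rank near `a`. -/
  rk : M → ℕ
  /-- The domain of the trivialisation around `a`. -/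
  base : M → Set M
  isOpen_base : ∀ a, IsOpen (base a)
  mem_base : ∀ a, a ∈ base a
  /-- The trivialisation around `a`. -/
  coord : ∀ a x, Fib x →ₗ[ℂ] (Fin (rk a) → ℂ)
  /-- The inverse of the trivialisation around `a`. -/
  frame : ∀ a x, (Fin (rk a) → ℂ) →ₗ[ℂ] Fib x
  frame_coord : ∀ a, ∀ x ∈ base a, ∀ e, frame a x (coord a x e) = e
  coord_frame : ∀ a, ∀ x ∈ base a, ∀ c, coord a x (frame a x c) = c
  holomorphic : ∀ a b c, ContMDiffOn 𝓘(ℂ, E) 𝓘(ℂ, Fin (rk b) → ℂ) ω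
    (fun x => coord b x (frame a x c)) (base a ∩ base b)

attribute [instance] HolBundle.addCommGroup HolBundle.module

namespace HolBundle

/-- The section `σ` is holomorphic near `x`. -/
def HolAt (V : HolBundle.{u, v, w} E M) (σ : ∀ x, V.Fib x) (x : M) : Prop :=
  ContMDiffAt 𝓘(ℂ, E) 𝓘(ℂ, Fin (V.rk x) → ℂ) ω (fun y => V.coord x y (σ y)) x

/-- The section `σ` is (complex) differentiable at `x`. -/
def DiffAt (V : HolBundle.{u, v, w} E M) (σ : ∀ x, V.Fib x) (x : M) : Prop :=
  MDifferentiableAt 𝓘(ℂ, E) 𝓘(ℂ, Fin (V.rk x) → ℂ) (fun y => V.coord x y (σ y)) x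

theorem eq_sum (V : HolBundle.{u, v, w} E M) {a y : M} (hy : y ∈ V.base a) (e : V.Fib y) :
    e = ∑ i, V.coord a y e i • V.frame a y (Pi.single i 1) := by
  conv_lhs => rw [← V.frame_coord a y hy e]
  conv_lhs => rw [pi_eq_sum_univ' (V.coord a y e)]
  simp only [map_sum, map_smul]

end HolBundle

/-- Let `f : Q → M` and `g : Q → N` be holomorphic maps, `V` a bundle on `M` and `W` a bundle on
`N`. The family of linear maps `τ q : V_{f q} → W_{g q}` is holomorphic, i.e. it is a homomorphism
of holomorphic vector bundles `f^*V → g^*W`: in local trivialisations of `V` and `W` it is given by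
a holomorphic matrix. -/
def IsHolFamily (EQ : Type*) [NormedAddCommGroup EQ] [NormedSpace ℂ EQ] {Q : Type*}
    [TopologicalSpace Q] [ChartedSpace EQ Q] {E' : Type*} [NormedAddCommGroup E']
    [NormedSpace ℂ E'] {N : Type*} [TopologicalSpace N] [ChartedSpace E' N]
    (V : HolBundle E M) (W : HolBundle E' N) (f : Q → M) (g : Q → N)
    (τ : ∀ q, V.Fib (f q) →ₗ[ℂ] W.Fib (g q)) : Prop :=
  ∀ (q : Q) (c : Fin (V.rk (f q)) → ℂ),
    ContMDiffAt 𝓘(ℂ, EQ) 𝓘(ℂ, Fin (W.rk (g q)) → ℂ) ω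
      (fun q' => W.coord (g q) (g q') (τ q' (V.frame (f q) (f q') c))) q

/-- Homomorphisms of holomorphic vector bundles over the identity of `M`. -/
@[ext] structure HolBundle.Hom (V W : HolBundle.{u, v, w} E M) where
  /-- The linear maps between the fibres. -/
  toFun : ∀ x, V.Fib x →ₗ[ℂ] W.Fib x
  holomorphic : IsHolFamily E (Q := M) V W id id toFun

namespace HolBundle.Hom

theorem coord_eventuallyEq {V W : HolBundle.{u, v, w} E M} (T : ∀ x, V.Fib x →ₗ[ℂ] W.Fib x)
    (σ : ∀ x, V.Fib x) (x : M) :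
    (fun y => W.coord x y (T y (σ y))) =ᶠ[𝓝 x] fun y => ∑ i, V.coord x y (σ y) i •
      W.coord x y (T y (V.frame x y (Pi.single i 1))) := by
  filter_upwards [(V.isOpen_base x).mem_nhds (V.mem_base x)] with y hy
  conv_lhs => rw [V.eq_sum hy (σ y)]
  simp only [map_sum, map_smul]

theorem holAt {V W : HolBundle.{u, v, w} E M} (T : Hom V W) {σ : ∀ x, V.Fib x} {x : M}
    (hσ : V.HolAt σ x) : W.HolAt (fun y => T.toFun y (σ y)) x := by
  refine ContMDiffAt.congr_of_eventuallyEq ?_ (coord_eventuallyEq T.toFun σ x)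
  refine ContMDiffAt.sum fun i _ => ?_
  have h₁ : ContMDiffAt 𝓘(ℂ, E) 𝓘(ℂ, ℂ) ω (fun y => V.coord x y (σ y) i) x :=
    contMDiffAt_pi_space.1 hσ i
  exact h₁.smul (T.holomorphic x (Pi.single i 1))

theorem diffAt {V W : HolBundle.{u, v, w} E M} (T : Hom V W) {σ : ∀ x, V.Fib x} {x : M}
    (hσ : V.DiffAt σ x) : W.DiffAt (fun y => T.toFun y (σ y)) x := by
  refine MDifferentiableAt.congr_of_eventuallyEq ?_ (coord_eventuallyEq T.toFun σ x)
  have h : ∀ i, MDifferentiableAt 𝓘(ℂ, E) 𝓘(ℂ, Fin (W.rk x) → ℂ) (fun y => V.coord x y (σ y) i •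
      W.coord x y (T.toFun y (V.frame x y (Pi.single i 1)))) x := fun i => by
    have h₁ : MDifferentiableAt 𝓘(ℂ, E) 𝓘(ℂ, ℂ) (fun y => V.coord x y (σ y) i) x :=
      (ContinuousLinearMap.proj (R := ℂ) (φ := fun _ : Fin (V.rk x) => ℂ)
        i).mdifferentiableAt.comp x hσ
    have h₂ := (T.holomorphic x (Pi.single i 1)).mdifferentiableAt (by simp)
    exact h₁.smul h₂
  have h' := MDifferentiableAt.sum (t := Finset.univ) fun i _ => h i
  rwa [Finset.sum_fn] at h'

/-- The identity of a bundle. -/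
def id (V : HolBundle.{u, v, w} E M) : Hom V V where
  toFun _ := LinearMap.id
  holomorphic x c := by
    refine (contMDiffAt_const (c := c)).congr_of_eventuallyEq ?_
    filter_upwards [(V.isOpen_base x).mem_nhds (V.mem_base x)] with y hy
    exact V.coord_frame x y hy c

/-- Composition of bundle homomorphisms. -/
def comp {U V W : HolBundle.{u, v, w} E M} (S : Hom U V) (T : Hom V W) : Hom U W where
  toFun x := T.toFun x ∘ₗ S.toFun x
  holomorphic x c := T.holAt (σ := fun y => S.toFun y (U.frame x y c)) (S.holomorphic x c)

end HolBundle.Hom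

end Bundles

/-! ## Flat connections -/

section FlatConn

/-- A flat connection on the complex manifold `M`: a holomorphic vector bundle with a holomorphic
connection `∇` whose curvature vanishes. Here `cov σ x ξ` is `(∇_ξ σ)(x)`, for a tangent vector `ξ`
at `x` and a section `σ` which is differentiable at `x` (the value is irrelevant for other `σ`;
by the Leibniz rule for indicator functions of open sets, it depends only on the germ of `σ`). -/
structure FlatConn (E : Type u) [NormedAddCommGroup E] [NormedSpace ℂ E]
    (M : Type v) [TopologicalSpace M] [ChartedSpace E M] [IsManifold 𝓘(ℂ, E) ω M]
    extends HolBundle.{u, v, w} E M where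
  /-- The covariant derivative. -/
  cov : (∀ x, Fib x) → ∀ x, TangentSpace 𝓘(ℂ, E) x →ₗ[ℂ] Fib x
  add : ∀ σ σ' x, toHolBundle.DiffAt σ x → toHolBundle.DiffAt σ' x →
    cov (σ + σ') x = cov σ x + cov σ' x
  leibniz : ∀ (f : M → ℂ) σ x, MDifferentiableAt 𝓘(ℂ, E) 𝓘(ℂ, ℂ) f x →
    toHolBundle.DiffAt σ x → ∀ ξ : TangentSpace 𝓘(ℂ, E) x,
      cov (fun y => f y • σ y) x ξ =
        f x • cov σ x ξ + mvfderiv 𝓘(ℂ, E) f x ξ • σ x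
  holomorphic_cov : ∀ (U : Set M) (ξ : ∀ x, TangentSpace 𝓘(ℂ, E) x) σ, IsOpen U →
    ContMDiffOn 𝓘(ℂ, E) 𝓘(ℂ, E).tangent ω
      (fun x => (⟨x, ξ x⟩ : TangentBundle 𝓘(ℂ, E) M)) U →
    (∀ x ∈ U, toHolBundle.HolAt σ x) → ∀ x ∈ U, toHolBundle.HolAt (fun y => cov σ y (ξ y)) x
  flat : ∀ (U : Set M) (ξ η : ∀ x, TangentSpace 𝓘(ℂ, E) x) σ, IsOpen U →
    ContMDiffOn 𝓘(ℂ, E) 𝓘(ℂ, E).tangent ω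
      (fun x => (⟨x, ξ x⟩ : TangentBundle 𝓘(ℂ, E) M)) U →
    ContMDiffOn 𝓘(ℂ, E) 𝓘(ℂ, E).tangent ω
      (fun x => (⟨x, η x⟩ : TangentBundle 𝓘(ℂ, E) M)) U →
    (∀ x ∈ U, toHolBundle.HolAt σ x) → ∀ x ∈ U,
      cov (fun y => cov σ y (η y)) x (ξ x) - cov (fun y => cov σ y (ξ y)) x (η x) -
        cov σ x (VectorField.mlieBracket 𝓘(ℂ, E) ξ η x) = 0

variable {E : Type u} [NormedAddCommGroup E] [NormedSpace ℂ E]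
  {M : Type v} [TopologicalSpace M] [ChartedSpace E M] [IsManifold 𝓘(ℂ, E) ω M]

namespace FlatConn

/-- Morphisms of flat connections: bundle homomorphisms commuting with the connections. -/
@[ext] structure Hom (V W : FlatConn.{u, v, w} E M)
    extends HolBundle.Hom V.toHolBundle W.toHolBundle where
  comm : ∀ σ x, V.DiffAt σ x → ∀ ξ : TangentSpace 𝓘(ℂ, E) x,
    toFun x (V.cov σ x ξ) = W.cov (fun y => toFun y (σ y)) x ξ

/-- The category of flat connections on `M`. -/
instance : Category (FlatConn.{u, v, w} E M) where
  Hom V W := Hom V W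
  id V := ⟨HolBundle.Hom.id V.toHolBundle, fun _ _ _ _ => rfl⟩
  comp S T := ⟨S.toHom.comp T.toHom, fun σ x hσ ξ => by
    have h₁ := S.comm σ x hσ ξ
    have h₂ := T.comm _ x (S.toHom.diffAt hσ) ξ
    exact (congrArg (T.toFun x) h₁).trans h₂⟩

/-- `e t` is a vector in the fibre over `δ t`, for every `t`. The family `e` is parallel along the
path `δ` if locally it is given by flat sections. -/
def IsParallel (V : FlatConn.{u, v, w} E M) (δ : C(unitInterval, M)) (e : ∀ t, V.Fib (δ t)) :
    Prop :=
  ∀ t₀, ∃ (U : Set M) (σ : ∀ x, V.Fib x), IsOpen U ∧ δ t₀ ∈ U ∧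
    (∀ x ∈ U, V.HolAt σ x) ∧ (∀ x ∈ U, V.cov σ x = 0) ∧ ∀ᶠ t in 𝓝 t₀, e t = σ (δ t)

end FlatConn

end FlatConn

/-! ## Representations of the fundamental groupoid -/

section Rep

/-- The space of arrows of the fundamental groupoid `Π₁(M)` of the complex manifold `M`, with the
complex structure for which the end point map to `M × M` is a local biholomorphism. -/
abbrev Pi₁ (E : Type u) [NormedAddCommGroup E] [NormedSpace ℂ E]
    (M : Type v) [TopologicalSpace M] [ChartedSpace E M] : Type v :=
  PathManifold E E (ContinuousMap.id M) (ContinuousMap.id M)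

/-- A representation of the Lie groupoid `Π₁(M)`: a holomorphic vector bundle on `M` on which
homotopy classes of paths act linearly and holomorphically. Concatenation of paths is written
from left to right, and the class of a path from `x` to `y` acts as a map from the fibre at `x` to
the fibre at `y`. -/
structure Rep (E : Type u) [NormedAddCommGroup E] [NormedSpace ℂ E]
    (M : Type v) [TopologicalSpace M] [ChartedSpace E M]
    extends HolBundle.{u, v, w} E M where
  /-- The action of homotopy classes of paths. -/
  act : ∀ {x y : M}, Path.Homotopic.Quotient x y → Fib x →ₗ[ℂ] Fib y
  act_refl : ∀ x e, act (Path.Homotopic.Quotient.refl x) e = e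
  act_trans : ∀ {x y z : M} (g : Path.Homotopic.Quotient x y) (h : Path.Homotopic.Quotient y z) e,
    act (g.trans h) e = act h (act g e)
  holomorphic_act : IsHolFamily (E × E) (Q := Pi₁ E M) toHolBundle toHolBundle
    PathClasses.src PathClasses.tgt fun g => act (PathClasses.cls g)

variable {E : Type u} [NormedAddCommGroup E] [NormedSpace ℂ E]
  {M : Type v} [TopologicalSpace M] [ChartedSpace E M]

namespace Rep

/-- Morphisms of representations: equivariant bundle homomorphisms. -/
@[ext] structure Hom (V W : Rep.{u, v, w} E M)
    extends HolBundle.Hom V.toHolBundle W.toHolBundle where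
  equivariant : ∀ {x y : M} (g : Path.Homotopic.Quotient x y) e,
    toFun y (V.act g e) = W.act g (toFun x e)

/-- The category of representations of `Π₁(M)`. -/
instance : Category (Rep.{u, v, w} E M) where
  Hom V W := Hom V W
  id V := ⟨HolBundle.Hom.id V.toHolBundle, fun _ _ => rfl⟩
  comp S T := ⟨S.toHom.comp T.toHom, fun g e =>
    (congrArg (T.toFun _) (S.equivariant g e)).trans (T.equivariant g _)⟩

end Rep

/-- The functor `R` from flat connections on `M` to representations of `Π₁(M)` is (up to natural
isomorphism) the one of the Riemann–Hilbert correspondence: it keeps the underlying vector bundle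
and lets homotopy classes of paths act by parallel transport. -/
structure RiemannHilbert [IsManifold 𝓘(ℂ, E) ω M]
    (R : FlatConn.{u, v, w} E M ⥤ Rep.{u, v, w} E M) where
  /-- The identification of the underlying vector bundles. -/
  iso : ∀ (V : FlatConn.{u, v, w} E M) (x : M), V.Fib x ≃ₗ[ℂ] (R.obj V).Fib x
  holomorphic : ∀ V, IsHolFamily E (Q := M) V.toHolBundle (R.obj V).toHolBundle id id
    fun x => (iso V x).toLinearMap
  natural : ∀ {V W : FlatConn.{u, v, w} E M} (T : V ⟶ W) (x : M) (e : V.Fib x),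
    iso W x (T.toFun x e) = (R.map T).toFun x (iso V x e)
  transport : ∀ (V : FlatConn.{u, v, w} E M) (δ : C(unitInterval, M)) (e : ∀ t, V.Fib (δ t)),
    V.IsParallel δ e →
      (R.obj V).act (Path.Homotopic.Quotient.mk ⟨δ, rfl, rfl⟩) (iso V (δ 0) (e 0)) =
        iso V (δ 1) (e 1)

end Rep

/-! ## The Morita equivalence `Q_γ` and the functors it induces -/

section Isomonodromy

variable {E : Type u} {B : Type v} [NormedAddCommGroup E] [NormedSpace ℂ E]
  [NormedAddCommGroup B] [NormedSpace ℂ B]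
  {X S : Type*} [TopologicalSpace X] [ChartedSpace E X]
  [TopologicalSpace S] [ChartedSpace B S] {p : X → S}

/-- A contractible open neighbourhood `𝔻` in `S × ℂ` of the graph of the path `γ`. -/
structure Thickening {s₀ s₁ : S} (γ : Path s₀ s₁) where
  /-- The open set `𝔻`. -/
  carrier : TopologicalSpace.Opens (S × ℂ)
  graph_mem : ∀ t : unitInterval, (γ t, ((t : ℝ) : ℂ)) ∈ carrier
  contractible : ContractibleSpace carrier

namespace Thickening

variable {s₀ s₁ : S} {γ : Path s₀ s₁} (D : Thickening γ)

/-- The canonical path `e : t ↦ (γ t, t)` in `𝔻`. -/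
def canonicalPath : Path (⟨(γ 0, ((0 : unitInterval) : ℝ)), D.graph_mem 0⟩ : D.carrier)
    ⟨(γ 1, ((1 : unitInterval) : ℝ)), D.graph_mem 1⟩ where
  toFun t := ⟨(γ t, ((t : ℝ) : ℂ)), D.graph_mem t⟩
  continuous_toFun := by
    refine Continuous.subtype_mk ?_ _
    exact γ.continuous.prodMk (Complex.continuous_ofReal.comp continuous_subtype_val)
  source' := rfl
  target' := rfl

variable (hp : IsSubmersion 𝓘(ℂ, E) 𝓘(ℂ, B) ω p)

/-- The total space `Γ^*X = X ×_S 𝔻` of the pulled back family. -/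
def Total (D : Thickening γ) (_hp : IsSubmersion 𝓘(ℂ, E) 𝓘(ℂ, B) ω p) : Type _ :=
  {z : X × D.carrier // p z.1 = z.2.val.1}

instance : TopologicalSpace (D.Total hp) :=
  inferInstanceAs (TopologicalSpace {z : X × D.carrier // p z.1 = z.2.val.1})

/-- The projection `π : Γ^*X → 𝔻`. -/
def proj : C(D.Total hp, D.carrier) where
  toFun z := z.1.2
  continuous_toFun := continuous_snd.comp continuous_subtype_val

/-- The inclusion `ι₀ : X_{γ(0)} → Γ^*X` of the fibre over `(γ(0), 0)`. -/
def incl₀ : C(Fibre hp s₀, D.Total hp) where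
  toFun x := ⟨(x.val, ⟨(γ 0, ((0 : unitInterval) : ℝ)), D.graph_mem 0⟩),
    x.property.trans γ.source.symm⟩
  continuous_toFun := ((Fibre.continuous_val hp s₀).prodMk continuous_const).subtype_mk _

/-- The inclusion `ι₁ : X_{γ(1)} → Γ^*X` of the fibre over `(γ(1), 1)`. -/
def incl₁ : C(Fibre hp s₁, D.Total hp) where
  toFun x := ⟨(x.val, ⟨(γ 1, ((1 : unitInterval) : ℝ)), D.graph_mem 1⟩),
    x.property.trans γ.target.symm⟩
  continuous_toFun := ((Fibre.continuous_val hp s₁).prodMk continuous_const).subtype_mk _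

/-- The elements of `Π₁(Γ^*X)` starting at a point of `X_{γ(0)}` and ending at a point of
`X_{γ(1)}`, a complex manifold. -/
abbrev Arrows : Type _ :=
  PathManifold hp.complement hp.complement (D.incl₀ hp) (D.incl₁ hp)

/-- The subset `π_*⁻¹([e])` of `Π₁(Γ^*X)`. -/
def QSet : Set (D.Arrows hp) :=
  {q | (PathClasses.cls q).map (D.proj hp) = Path.Homotopic.Quotient.mk D.canonicalPath}

theorem QSet_eq_univ : D.QSet hp = Set.univ := by
  have := D.contractible
  exact Set.eq_univ_of_forall fun q => Subsingleton.elim (α := Path.Homotopic.Quotient _ _) _ _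

/-- `Q_γ = π_*⁻¹([e])`, as a complex manifold. Being the preimage of a point under the holomorphic
submersion `π_* : Π₁(Γ^*X) → Π₁(𝔻)`, and as the end point maps are local biholomorphisms
`Π₁(Γ^*X) → Γ^*X × Γ^*X` and `Π₁(𝔻) → 𝔻 × 𝔻`, its complex structure is the one for which the
end point map `Q_γ → X_{γ(0)} × X_{γ(1)}` is a local biholomorphism. -/
def Q : TopologicalSpace.Opens (D.Arrows hp) :=
  ⟨D.QSet hp, by rw [QSet_eq_univ]; exact isOpen_univ⟩

/-- The moment map `μ₀ : Q_γ → X_{γ(0)}`, sending a path to its starting point. -/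
def μ₀ (q : D.Q hp) : Fibre hp s₀ := PathClasses.src q.1

/-- The moment map `μ₁ : Q_γ → X_{γ(1)}`, sending a path to its end point. -/
def μ₁ (q : D.Q hp) : Fibre hp s₁ := PathClasses.tgt q.1

/-- The left action `g * q = ι₀(g) · q` of `Π₁(X_{γ(0)})` on `Q_γ`. -/
def leftMul {x : Fibre hp s₀} (q : D.Q hp)
    (g : Path.Homotopic.Quotient x (D.μ₀ hp q)) : D.Q hp :=
  ⟨(⟨x, PathClasses.tgt q.1, (g.map (D.incl₀ hp)).trans (PathClasses.cls q.1)⟩ :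
    PathClasses (D.incl₀ hp) (D.incl₁ hp)), by
      change _ ∈ D.QSet hp
      rw [QSet_eq_univ]
      trivial⟩

/-- The right action `q * h = q · ι₁(h)` of `Π₁(X_{γ(1)})` on `Q_γ`. -/
def rightMul {y : Fibre hp s₁} (q : D.Q hp)
    (h : Path.Homotopic.Quotient (D.μ₁ hp q) y) : D.Q hp :=
  ⟨(⟨PathClasses.src q.1, y, (PathClasses.cls q.1).trans (h.map (D.incl₁ hp))⟩ :
    PathClasses (D.incl₀ hp) (D.incl₁ hp)), by
      change _ ∈ D.QSet hp
      rw [QSet_eq_univ]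
      trivial⟩

/-- The functor `Φ : Rep(Π₁(X_{γ(0)})) → Rep(Π₁(X_{γ(1)}))` is (up to natural isomorphism) the one
induced by the bibundle `Q_γ`: for a representation `V` of `Π₁(X_{γ(0)})`, the bundle `Φ(V)` is
the quotient of `μ₀^*V` by the action of `Π₁(X_{γ(0)})`, with the residual action of `Π₁(X_{γ(1)})`.
The quotient map is given by linear isomorphisms `τ q : V_{μ₀ q} → Φ(V)_{μ₁ q}` depending
holomorphically on `q`, i.e. by an isomorphism of holomorphic bundles `μ₀^*V → μ₁^*Φ(V)` on `Q_γ`;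
it is invariant under `Π₁(X_{γ(0)})` and equivariant under `Π₁(X_{γ(1)})`. -/
structure InducedFunctor [IsManifold 𝓘(ℂ, E) ω X]
    (Φ : Rep.{_, _, w} hp.complement (Fibre hp s₀) ⥤ Rep.{_, _, w} hp.complement (Fibre hp s₁)) where
  /-- The quotient map. -/
  τ : ∀ (V : Rep.{_, _, w} hp.complement (Fibre hp s₀)) (q : D.Q hp),
    V.Fib (D.μ₀ hp q) ≃ₗ[ℂ] (Φ.obj V).Fib (D.μ₁ hp q)
  holomorphic : ∀ V, IsHolFamily (hp.complement × hp.complement) (Q := D.Q hp) V.toHolBundle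
    (Φ.obj V).toHolBundle (D.μ₀ hp) (D.μ₁ hp) fun q => (τ V q).toLinearMap
  left_invariant : ∀ V {x : Fibre hp s₀} (q : D.Q hp) (g : Path.Homotopic.Quotient x (D.μ₀ hp q))
    (e : V.Fib x), τ V (D.leftMul hp q g) e = τ V q (V.act g e)
  right_equivariant : ∀ V {y : Fibre hp s₁} (q : D.Q hp)
    (h : Path.Homotopic.Quotient (D.μ₁ hp q) y) (e : V.Fib (D.μ₀ hp q)),
    τ V (D.rightMul hp q h) e = (Φ.obj V).act h (τ V q e)
  natural : ∀ {V W : Rep.{_, _, w} hp.complement (Fibre hp s₀)} (T : V ⟶ W) (q : D.Q hp)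
    (e : V.Fib (D.μ₀ hp q)),
    τ W q (T.toFun (D.μ₀ hp q) e) = (Φ.map T).toFun (D.μ₁ hp q) (τ V q e)

/-- The functor `P` between the categories of flat connections on `X_{γ(0)}` and `X_{γ(1)}` is
induced by `Q_γ`: under the Riemann–Hilbert equivalences, it corresponds to an equivalence
`Rep(Π₁(X_{γ(0)})) ≌ Rep(Π₁(X_{γ(1)}))` induced by `Q_γ`. -/
def Induces [IsManifold 𝓘(ℂ, E) ω X]
    (P : FlatConn.{_, _, w} hp.complement (Fibre hp s₀) ⥤
      FlatConn.{_, _, w} hp.complement (Fibre hp s₁)) : Prop :=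
  ∃ (R₀ : FlatConn.{_, _, w} hp.complement (Fibre hp s₀) ≌
      Rep.{_, _, w} hp.complement (Fibre hp s₀))
    (R₁ : FlatConn.{_, _, w} hp.complement (Fibre hp s₁) ≌
      Rep.{_, _, w} hp.complement (Fibre hp s₁))
    (Φ : Rep.{_, _, w} hp.complement (Fibre hp s₀) ≌ Rep.{_, _, w} hp.complement (Fibre hp s₁)),
    Nonempty (RiemannHilbert R₀.functor) ∧ Nonempty (RiemannHilbert R₁.functor) ∧
      Nonempty (D.InducedFunctor hp Φ.functor) ∧
      Nonempty (P ≅ R₀.functor ⋙ Φ.functor ⋙ R₁.inverse)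

end Thickening

end Isomonodromy

end Isomonodromy

end

/-!
# Isomonodromy equivalences

On both sides of the Riemann–Hilbert functor, holomorphic structures carry no information beyond
parallel transport, so that the theorem becomes a statement on fundamental groupoids.

*Flat connections.* A flat connection has flat frames near every point
(`FlatConn.exists_flatFrame`). In a trivialisation this is the Frobenius theorem for a connection
`d + A` on a vector space (`exists_flat_frame`): the equation is solved along the rays through a
point, analytically in the direction of the ray, and flatness shows that the solution is flat in all
directions. Hence the étale space of flat sections is a covering of `M`
(`FlatConn.isCoveringMap_etaleProj`), and parallel transport is its monodromy.

*Representations.* In a representation, the short paths at a point transport a basis of the fibre to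
a holomorphic frame (`Rep.transportFrame`). With respect to such frames, everything which is
equivariant under path classes is locally constant, and hence holomorphic
(`HolBundle.isHolFamily_of_equivariant`, `HolBundle.isHolFamily_pathManifold`). Conversely, every
linear action of the path classes on finite-dimensional vector spaces underlies a representation
(`repOfAction`), and these frames define the connection with a given parallel transport
(`Rep.toFlatConn`). This proves the Riemann–Hilbert correspondence
(`FlatConn.isEquivalence_riemannHilbert`) and its uniqueness (`RiemannHilbert.nonempty_iso`).

*Fibres.* The pulled back family over `𝔻` is a Serre fibration over a contractible base, so the
inclusion of each of its fibres is an equivalence of fundamental groupoids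
(`IsFibreInclusion.isGroupoidEquiv`). Only the lifting property for squares and cubes relative to
some of their faces is needed (`IsSerreFibration.exists_corner_lift`). As `𝔻` is simply connected,
`Q_γ` consists of all path classes from one fibre to the other. They identify the
representations of the two fundamental groupoids (`IsGroupoidEquiv.functor`,
`PathInduced.isEquivalence`), and a functor induced by them is unique up to isomorphism
(`PathInduced.nonempty_iso`).

*Neighbourhoods.* Every open neighbourhood of the graph of `γ` contains a contractible one
(`Thickening.exists_subset`), namely a chain of cylinders over balls in charts, connected by thin
necks around the graph. This yields the existence of `𝔻`, and it compares any two choices with a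
third one contained in both (`Thickening.nonempty_iso_of_pathInduced`).
-/

noncomputable section

namespace Isomonodromy

/-! ### Integral equations along rays -/

section Frobenius

variable {E : Type*} [NormedAddCommGroup E] [NormedSpace ℂ E]
  {F : Type*} [NormedAddCommGroup F] [NormedSpace ℂ F] [CompleteSpace F]

/-- Multiplication by the function `t ↦ t ^ n` of the unit interval. -/
def monomialCLM (F : Type*) [NormedAddCommGroup F] [NormedSpace ℂ F] (n : ℕ) :
    F →L[ℂ] C(unitInterval, F) :=
  LinearMap.mkContinuous
    { toFun := fun a => ⟨fun t => ((t : ℝ) : ℂ) ^ n • a, by fun_prop⟩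
      map_add' := fun a b => by ext t; simp
      map_smul' := fun c a => by ext t; simp [smul_comm c] } 1 fun a => by
    rw [ContinuousMap.norm_le _ (by positivity)]
    intro t
    have ht : ‖((t : ℝ) : ℂ) ^ n‖ ≤ 1 := by
      rw [norm_pow, Complex.norm_real, Real.norm_of_nonneg t.2.1]
      exact pow_le_one₀ t.2.1 t.2.2
    simpa [norm_smul] using mul_le_mul_of_nonneg_right ht (norm_nonneg a)

omit [CompleteSpace F] in
theorem norm_monomialCLM_le (n : ℕ) : ‖monomialCLM F n‖ ≤ 1 :=
  LinearMap.mkContinuous_norm_le _ zero_le_one _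

/-- The restrictions of an analytic function to the segments `[z, z + x]` depend analytically
on `x`: the power series is obtained from the one at `z` by inserting powers of the parameter. -/
theorem exists_analyticAt_segment {f : E → F} {z : E} (hf : AnalyticAt ℂ f z) :
    ∃ g : E → C(unitInterval, F), AnalyticAt ℂ g 0 ∧
      ∀ᶠ x in 𝓝 (0 : E), ∀ t : unitInterval, g x t = f (z + ((t : ℝ) : ℂ) • x) := by
  obtain ⟨p, r, hp⟩ := hf
  let P : FormalMultilinearSeries ℂ E C(unitInterval, F) := fun n =>
    (monomialCLM F n).compContinuousMultilinearMap (p n)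
  have hPn : ∀ n, ‖P n‖ ≤ ‖p n‖ := fun n =>
    ((monomialCLM F n).norm_compContinuousMultilinearMap_le (p n)).trans
      (mul_le_of_le_one_left (norm_nonneg _) (norm_monomialCLM_le n))
  have hrad : p.radius ≤ P.radius := by
    refine ENNReal.le_of_forall_nnreal_lt fun ρ hρ => ?_
    obtain ⟨C, -, hC⟩ := p.norm_mul_pow_le_of_lt_radius hρ
    exact P.le_radius_of_bound C fun n =>
      (mul_le_mul_of_nonneg_right (hPn n) (by positivity)).trans (hC n)
  have hpos : 0 < P.radius := (hp.r_pos.trans_le hp.r_le).trans_le hrad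
  refine ⟨P.sum, (P.hasFPowerSeriesOnBall hpos).analyticAt, ?_⟩
  filter_upwards [Metric.eball_mem_nhds (0 : E) hp.r_pos] with x hx t
  have h1 : HasSum (fun n => P n fun _ => x) (P.sum x) :=
    P.hasSum (Metric.eball_subset_eball (hp.r_le.trans hrad) hx)
  have h2 := h1.map (ContinuousMap.evalCLM ℂ t) (ContinuousMap.evalCLM ℂ t).continuous
  have hx' : ((t : ℝ) : ℂ) • x ∈ Metric.eball (0 : E) r := by
    rw [Metric.mem_eball, edist_zero_right] at hx ⊢
    refine lt_of_le_of_lt ?_ hx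
    rw [enorm_smul]
    refine mul_le_of_le_one_left' ?_
    rw [← ofReal_norm, Complex.norm_real, Real.norm_of_nonneg t.2.1]
    simpa using t.2.2
  have h3 := hp.hasSum hx'
  have h4 : (fun n => p n fun _ => ((t : ℝ) : ℂ) • x) =
      (ContinuousMap.evalCLM ℂ t) ∘ fun n => P n fun _ => x := by
    funext n
    have := (p n).map_smul_univ (fun _ => ((t : ℝ) : ℂ)) fun _ => x
    simpa [P, monomialCLM] using this
  rw [h4] at h3
  exact h2.unique h3

/-- The primitive vanishing at `0`, as a bounded operator on continuous functions. The integrand is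
extended to `ℝ` by the constants `u 0` and `u 1`, so that it is continuous everywhere. -/
def primitiveCLM (F : Type*) [NormedAddCommGroup F] [NormedSpace ℂ F] [CompleteSpace F] :
    C(unitInterval, F) →L[ℂ] C(unitInterval, F) :=
  LinearMap.mkContinuous
    { toFun := fun u => ⟨fun t => ∫ s in (0 : ℝ)..t, u (Set.projIcc 0 1 zero_le_one s), by
        have h : Continuous fun s : ℝ => u (Set.projIcc 0 1 zero_le_one s) :=
          u.continuous.comp continuous_projIcc
        exact (intervalIntegral.continuous_primitive (fun a b => h.intervalIntegrable a b) 0).comp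
          continuous_subtype_val⟩
      map_add' := fun u v => by
        ext t
        have h : ∀ u : C(unitInterval, F), Continuous fun s : ℝ =>
            u (Set.projIcc 0 1 zero_le_one s) := fun u => u.continuous.comp continuous_projIcc
        exact intervalIntegral.integral_add ((h u).intervalIntegrable _ _)
          ((h v).intervalIntegrable _ _)
      map_smul' := fun c u => by
        ext t
        exact intervalIntegral.integral_smul c _ } 1 fun u => by
    rw [ContinuousMap.norm_le _ (by positivity)]
    intro t
    refine (intervalIntegral.norm_integral_le_of_norm_le_const
      (C := ‖u‖) fun s _ => u.norm_coe_le_norm _).trans ?_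
    rw [sub_zero, abs_of_nonneg t.2.1, one_mul]
    exact mul_le_of_le_one_right (norm_nonneg _) t.2.2

theorem hasDerivAt_primitiveCLM (u : C(unitInterval, F)) (t : ℝ) :
    HasDerivAt (fun r : ℝ => ∫ s in (0 : ℝ)..r, u (Set.projIcc 0 1 zero_le_one s))
      (u (Set.projIcc 0 1 zero_le_one t)) t := by
  have h : Continuous fun s : ℝ => u (Set.projIcc 0 1 zero_le_one s) :=
    u.continuous.comp continuous_projIcc
  exact intervalIntegral.integral_hasDerivAt_right (h.intervalIntegrable _ _)
    (h.stronglyMeasurableAtFilter _ _) h.continuousAt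

/-- Rescaling the parameter of a continuous function on the unit interval. -/
def rescale (τ : unitInterval) (u : C(unitInterval, F)) : C(unitInterval, F) :=
  ⟨fun s => u (τ * s), by fun_prop⟩

theorem primitiveCLM_rescale (τ : unitInterval) (u : C(unitInterval, F)) :
    primitiveCLM F (((τ : ℝ) : ℂ) • rescale τ u) = rescale τ (primitiveCLM F u) := by
  ext t
  have h := intervalIntegral.smul_integral_comp_mul_left (a := 0) (b := (t : ℝ))
    (fun s : ℝ => u (Set.projIcc 0 1 zero_le_one s)) (τ : ℝ)
  change (∫ s in (0 : ℝ)..t, ((τ : ℝ) : ℂ) • u (τ * Set.projIcc 0 1 zero_le_one s)) =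
    ∫ s in (0 : ℝ)..((τ * t : unitInterval) : ℝ), u (Set.projIcc 0 1 zero_le_one s)
  rw [mul_zero] at h
  rw [show ((τ * t : unitInterval) : ℝ) = τ * t from rfl, ← h, ← intervalIntegral.integral_smul]
  refine intervalIntegral.integral_congr fun s hs => ?_
  rw [Set.uIcc_of_le t.2.1] at hs
  have hs' : s ∈ Set.Icc (0 : ℝ) 1 := ⟨hs.1, hs.2.trans t.2.2⟩
  have hs'' : (τ : ℝ) * s ∈ Set.Icc (0 : ℝ) 1 := (τ * ⟨s, hs'⟩ : unitInterval).2
  simp only [Set.projIcc_of_mem _ hs', Set.projIcc_of_mem _ hs'']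
  rfl

end Frobenius

/-! ### The Frobenius theorem for linear connections -/

section Algebra

variable {E : Type*} [NormedAddCommGroup E] [NormedSpace ℂ E] [FiniteDimensional ℂ E]
  {𝔸 : Type*} [NormedRing 𝔸] [NormedAlgebra ℂ 𝔸] [CompleteSpace 𝔸]

omit [FiniteDimensional ℂ E] in
/-- An equation `u + J (c u) = 1` whose coefficient `c` depends analytically on a parameter and
vanishes at the point `z` has a unique solution near `z`, which depends analytically on the
parameter. -/
theorem exists_analyticAt_resolvent {R : Type*} [NormedRing R] [NormedAlgebra ℂ R]
    [CompleteSpace R] (J : R →L[ℂ] R) {c : E → R} {z : E} (hc : AnalyticAt ℂ c z) (hz : c z = 0) :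
    ∃ U : E → R, AnalyticAt ℂ U z ∧ U z = 1 ∧
      ∀ᶠ x in 𝓝 z, U x + J (c x * U x) = 1 ∧ ∀ u, u + J (c x * u) = 1 → u = U x := by
  let T : E → R →L[ℂ] R := fun x => J.comp (ContinuousLinearMap.mul ℂ R (c x))
  have hT : AnalyticAt ℂ T z :=
    (((ContinuousLinearMap.compL ℂ R R R J).comp (ContinuousLinearMap.mul ℂ R)).analyticAt _).comp
      hc
  have hT0 : T z = 0 := by simp [T, hz]
  have h1T : AnalyticAt ℂ (fun x => 1 + T x) z := analyticAt_const.add hT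
  have h1 : AnalyticAt ℂ Ring.inverse (1 + T z) := by
    rw [hT0, add_zero]
    exact analyticAt_inverse (𝕜 := ℂ) (1 : (R →L[ℂ] R)ˣ)
  refine ⟨fun x => Ring.inverse (1 + T x) 1,
    ((ContinuousLinearMap.apply ℂ R (1 : R)).analyticAt _).fun_comp
      (AnalyticAt.fun_comp (f := fun x => 1 + T x) h1 h1T), by simp [hT0], ?_⟩
  have hunit : ∀ᶠ x in 𝓝 z, IsUnit (1 + T x) := by
    refine h1T.continuousAt.eventually (Units.isOpen.mem_nhds ?_)
    change IsUnit (1 + T z)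
    rw [hT0, add_zero]
    exact isUnit_one
  filter_upwards [hunit] with x hx
  refine ⟨?_, fun u hu => ?_⟩
  · have := congrArg (fun S => S 1) (Ring.mul_inverse_cancel _ hx)
    simpa [T] using this
  · have h2 := congrArg (fun S => S u) (Ring.inverse_mul_cancel _ hx)
    have h3 : (1 + T x) u = 1 := hu
    simp only [mul_apply_eq_comp, h3, one_apply_eq_self] at h2
    exact h2.symm

/-- The linear differential equation `Φ' = -A Φ` along the rays through `z` has a solution which is
analytic near `z`: written as an integral equation on each ray, it is solved by inverting an
operator that depends analytically on the end point of the ray. No smallness of `A` is needed, since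
the coefficient of the equation on the segment from `z` to `z + x` vanishes for `x = 0`. -/
theorem exists_radial_solution {A : E → E →L[ℂ] 𝔸} {z : E} (hA : AnalyticAt ℂ A z) :
    ∃ Φ : E → 𝔸, AnalyticAt ℂ Φ z ∧ Φ z = 1 ∧
      ∀ᶠ y in 𝓝 z, fderiv ℂ Φ y (y - z) = -(A y (y - z) * Φ y) := by
  obtain ⟨g, hg, hgA⟩ := exists_analyticAt_segment hA
  let L : E →L[ℂ] C(unitInterval, E →L[ℂ] 𝔸) →L[ℂ] C(unitInterval, 𝔸) :=
    LinearMap.toContinuousLinearMap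
      { toFun := fun x => (ContinuousLinearMap.apply ℂ 𝔸 x).compLeftContinuous ℂ unitInterval
        map_add' := fun x y => by ext u t; exact map_add (u t) x y
        map_smul' := fun c x => by ext u t; exact map_smul (u t) c x }
  have hL : ∀ x u t, L x u t = u t x := fun x u t => rfl
  let c : E → C(unitInterval, 𝔸) := fun x => L x (g x)
  have hc : AnalyticAt ℂ c 0 := (L.analyticAt_bilinear (0, g 0)).comp₂ analyticAt_id hg
  have hc0 : c 0 = 0 := by simp [c]
  obtain ⟨U, hU, hU0, hUs⟩ := exists_analyticAt_resolvent (primitiveCLM 𝔸) hc hc0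
  let Φ : E → 𝔸 := fun y => U (y - z) 1
  have hΦ : AnalyticAt ℂ Φ z := by
    have h1 : AnalyticAt ℂ U (z - z) := by rwa [sub_self]
    exact ((ContinuousMap.evalCLM ℂ (1 : unitInterval)).analyticAt _).comp
      (h1.fun_comp (f := fun y => y - z) (analyticAt_id.sub analyticAt_const))
  refine ⟨Φ, hΦ, ?_, ?_⟩
  · simp [Φ, hU0]
  obtain ⟨r, hr, hball⟩ := Metric.eventually_nhds_iff_ball.1 (hUs.and hgA)
  have hscale : ∀ x ∈ Metric.ball (0 : E) r, ∀ τ : unitInterval,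
      ((τ : ℝ) : ℂ) • x ∈ Metric.ball (0 : E) r := fun x hx τ => by
    rw [mem_ball_zero_iff] at hx ⊢
    rw [norm_smul, Complex.norm_real, Real.norm_of_nonneg τ.2.1]
    exact (mul_le_of_le_one_left (norm_nonneg _) τ.2.2).trans_lt hx
  have hresc : ∀ x ∈ Metric.ball (0 : E) r, ∀ τ : unitInterval,
      U (((τ : ℝ) : ℂ) • x) = rescale τ (U x) := fun x hx τ => by
    have h1 := hball _ hx
    have h2 := hball _ (hscale x hx τ)
    have hcs : c (((τ : ℝ) : ℂ) • x) = ((τ : ℝ) : ℂ) • rescale τ (c x) := by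
      ext s
      have e : rescale τ (c x) s = c x (τ * s) := rfl
      have e' : (((τ * s : unitInterval) : ℝ) : ℂ) = ((τ : ℝ) : ℂ) * ((s : ℝ) : ℂ) :=
        Complex.ofReal_mul _ _
      rw [ContinuousMap.smul_apply, e]
      change L (((τ : ℝ) : ℂ) • x) (g (((τ : ℝ) : ℂ) • x)) s = ((τ : ℝ) : ℂ) • L x (g x) (τ * s)
      rw [hL, hL, h1.2, h2.2, map_smul, e', smul_smul, mul_comm]
    refine (h2.1.2 _ ?_).symm
    have h4 : c (((τ : ℝ) : ℂ) • x) * rescale τ (U x) =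
        ((τ : ℝ) : ℂ) • rescale τ (c x * U x) := by
      rw [hcs, smul_mul_assoc]
      rfl
    rw [h4, primitiveCLM_rescale]
    exact congrArg (rescale τ) h1.1.1
  have hray : ∀ x ∈ Metric.ball (0 : E) r, ∀ t ∈ Set.Icc (0 : ℝ) 1,
      Φ (z + (t : ℂ) • x) = 1 - ∫ s in (0 : ℝ)..t,
        (c x * U x) (Set.projIcc 0 1 zero_le_one s) := fun x hx t ht => by
    have h1 : Φ (z + (t : ℂ) • x) = U x ⟨t, ht⟩ := by
      have := congrArg (fun u => u 1) (hresc x hx ⟨t, ht⟩)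
      simpa [Φ, rescale] using this
    have h2 := congrArg (fun u => u ⟨t, ht⟩) (hball x hx).1.1
    rw [h1]
    exact eq_sub_of_add_eq h2
  have hnhds : ∀ᶠ y in 𝓝 z, y - z ∈ Metric.ball (0 : E) r := by
    have : ContinuousAt (fun y => y - z) z := by fun_prop
    apply this.eventually_mem
    simpa using Metric.ball_mem_nhds (0 : E) hr
  filter_upwards [hΦ.eventually_analyticAt, hnhds] with y hy hyr
  set x := y - z with hx
  have hyx : y = z + ((1 : ℝ) : ℂ) • x := by simp [hx]
  have hline : HasDerivWithinAt (fun t : ℝ => z + (t : ℂ) • x) x (Set.Icc 0 1) 1 := by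
    have h1 : HasDerivAt (fun t : ℝ => (t : ℂ)) 1 1 := Complex.ofRealCLM.hasDerivAt
    simpa using ((h1.smul_const x).const_add z).hasDerivWithinAt
  have hd1 : HasDerivWithinAt (fun t : ℝ => Φ (z + (t : ℂ) • x)) (fderiv ℂ Φ y x)
      (Set.Icc 0 1) 1 := by
    have h1 : HasFDerivAt Φ (fderiv ℂ Φ y) (z + ((1 : ℝ) : ℂ) • x) := by
      rw [← hyx]
      exact hy.differentiableAt.hasFDerivAt
    exact (h1.restrictScalars ℝ).comp_hasDerivWithinAt (1 : ℝ) hline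
  have hd2 : HasDerivWithinAt (fun t : ℝ => Φ (z + (t : ℂ) • x))
      (-((c x * U x) (Set.projIcc 0 1 zero_le_one 1))) (Set.Icc 0 1) 1 := by
    refine HasDerivWithinAt.congr ?_ (fun t ht => hray x hyr t ht) (hray x hyr 1 (by simp))
    exact ((hasDerivAt_primitiveCLM (c x * U x) 1).const_sub 1).hasDerivWithinAt
  have h3 := (uniqueDiffOn_Icc zero_lt_one 1 (by simp)).eq_deriv _ hd1 hd2
  rw [h3, Set.projIcc_right]
  have h4 : c x 1 = A y x := by
    change g x 1 x = _
    rw [(hball x hyr).2]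
    simp [hx]
  change -(c x 1 * U x 1) = _
  rw [h4]

/-- The holomorphic Frobenius theorem for linear connections: if the connection `d + A` is flat,
then there is a fundamental matrix of flat sections near any point. The solution `Φ` along the rays is
one: by flatness, its covariant derivative `ψ = dΦ + A Φ` satisfies a linear differential equation
along the rays, and hence vanishes. -/
theorem exists_flat_frame {A : E → E →L[ℂ] 𝔸} {z : E} (hA : AnalyticAt ℂ A z)
    (hflat : ∀ᶠ y in 𝓝 z, ∀ v w : E,
      fderiv ℂ A y v w - fderiv ℂ A y w v + (A y v * A y w - A y w * A y v) = 0) :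
    ∃ Φ : E → 𝔸, AnalyticAt ℂ Φ z ∧ Φ z = 1 ∧
      ∀ᶠ y in 𝓝 z, ∀ v : E, fderiv ℂ Φ y v = -(A y v * Φ y) := by
  obtain ⟨Φ, hΦ, hΦz, hrad⟩ := exists_radial_solution hA
  refine ⟨Φ, hΦ, hΦz, ?_⟩
  let ψ : E → E →L[ℂ] 𝔸 := fun y => fderiv ℂ Φ y +
    (ContinuousLinearMap.mul ℂ 𝔸).flip (Φ y) ∘L A y
  have hψa : ∀ y v, ψ y v = fderiv ℂ Φ y v + A y v * Φ y := fun y v => by simp [ψ]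
  -- the covariant derivative of `Φ` satisfies a linear differential equation along rays
  have hev : ∀ᶠ y in 𝓝 z, ContinuousAt A y ∧ DifferentiableAt ℂ ψ y ∧ ∀ h : E,
      ψ y h + fderiv ℂ ψ y (y - z) h = -(A y (y - z) * ψ y h) := by
    filter_upwards [hA.eventually_analyticAt, hΦ.eventually_analyticAt, hflat,
      hrad.eventually_nhds] with y hAy hΦy hfl hry
    have hdA := hAy.differentiableAt.hasFDerivAt
    have hdΦ := hΦy.differentiableAt.hasFDerivAt
    have hd2 := hΦy.fderiv.differentiableAt.hasFDerivAt
    have hdψ : HasFDerivAt ψ (fderiv ℂ ψ y) y := by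
      refine DifferentiableAt.hasFDerivAt (DifferentiableAt.add hd2.differentiableAt ?_)
      exact (((ContinuousLinearMap.mul ℂ 𝔸).flip.differentiableAt).comp y
        hdΦ.differentiableAt).clm_comp hdA.differentiableAt
    have hdψh : ∀ v h : E, fderiv ℂ ψ y v h =
        fderiv ℂ (fderiv ℂ Φ) y v h + (fderiv ℂ A y v h * Φ y + A y h * fderiv ℂ Φ y v) := by
      intro v h
      have e1 : HasFDerivAt (fun y => ψ y h) ((fderiv ℂ ψ y).flip h) y :=
        (hdψ.clm_apply (hasFDerivAt_const h y)).congr_fderiv (by ext; simp)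
      have e2 : HasFDerivAt (fun y => fderiv ℂ Φ y h + A y h * Φ y)
          ((fderiv ℂ (fderiv ℂ Φ) y).flip h +
            (A y h • fderiv ℂ Φ y + MulOpposite.op (Φ y) • (fderiv ℂ A y).flip h)) y := by
        refine HasFDerivAt.add ?_ ?_
        · exact (hd2.clm_apply (hasFDerivAt_const h y)).congr_fderiv (by ext; simp)
        · exact HasFDerivAt.mul' ((hdA.clm_apply (hasFDerivAt_const h y)).congr_fderiv
            (by ext; simp)) hdΦ
      simp only [hψa] at e1
      have := congrArg (fun T => T v) (e1.unique e2)
      simpa [add_comm] using this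
    have hsym : ∀ v h : E, fderiv ℂ (fderiv ℂ Φ) y v h = fderiv ℂ (fderiv ℂ Φ) y h v := fun v h =>
      (hΦy.contDiffAt (n := ω)).isSymmSndFDerivAt_of_omega v h
    have hrad0 : ∀ᶠ y in 𝓝 y, ψ y (y - z) = 0 := by
      filter_upwards [hry] with y hy
      rw [hψa, hy, neg_add_cancel]
    refine ⟨hAy.continuousAt, hdψ.differentiableAt, fun h => ?_⟩
    have e3 : HasFDerivAt (fun y => ψ y (y - z))
        ((ψ y).comp (ContinuousLinearMap.id ℂ E) + (fderiv ℂ ψ y).flip (y - z)) y :=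
      hdψ.clm_apply ((hasFDerivAt_id y).sub_const z)
    have e4 : HasFDerivAt (fun y => ψ y (y - z)) (0 : E →L[ℂ] 𝔸) y :=
      (hasFDerivAt_const (0 : 𝔸) y).congr_of_eventuallyEq hrad0
    have e5 : ψ y h + fderiv ℂ ψ y h (y - z) = 0 := by
      have := congrArg (fun T => T h) (e3.unique e4)
      simpa using this
    have e6 := hrad0.self_of_nhds
    have e7 : fderiv ℂ ψ y (y - z) h = fderiv ℂ ψ y h (y - z) - A y (y - z) * ψ y h := by
      have f1 := hfl (y - z) h
      rw [hψa] at e6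
      rw [hdψh, hdψh, hψa, hsym, eq_neg_of_add_eq_zero_left e6]
      have f2 : fderiv ℂ A y (y - z) h = fderiv ℂ A y h (y - z) -
          (A y (y - z) * A y h - A y h * A y (y - z)) := by
        rw [← sub_eq_zero, ← f1]
        abel
      rw [f2]
      noncomm_ring
    rw [e7, add_sub, e5, zero_sub]
  obtain ⟨r, hr, hball⟩ := Metric.eventually_nhds_iff_ball.1 hev
  refine Metric.eventually_nhds_iff_ball.2 ⟨r, hr, fun y hy v => ?_⟩
  rw [← add_eq_zero_iff_eq_neg, ← hψa]
  set x := y - z with hx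
  have hseg : ∀ t ∈ Set.Icc (0 : ℝ) 1, z + (t : ℂ) • x ∈ Metric.ball z r := fun t ht => by
    rw [mem_ball_iff_norm, add_sub_cancel_left, norm_smul, Complex.norm_real,
      Real.norm_of_nonneg ht.1]
    exact (mul_le_of_le_one_left (norm_nonneg _) ht.2).trans_lt (mem_ball_iff_norm.1 hy)
  have hline : ∀ t : ℝ, HasDerivAt (fun t : ℝ => z + (t : ℂ) • x) x t := fun t => by
    have h1 : HasDerivAt (fun t : ℝ => (t : ℂ)) 1 t := Complex.ofRealCLM.hasDerivAt
    simpa using (h1.smul_const x).const_add z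
  -- the factor `t` provides the initial value `0`
  have hw : ∀ t ∈ Set.Icc (0 : ℝ) 1, HasDerivAt (fun t : ℝ => (t : ℂ) • ψ (z + (t : ℂ) • x) v)
      (-(A (z + (t : ℂ) • x) x * ((t : ℂ) • ψ (z + (t : ℂ) • x) v))) t := fun t ht => by
    obtain ⟨-, h1, h2⟩ := hball _ (hseg t ht)
    have h3 := ((h1.hasFDerivAt.restrictScalars ℝ).comp_hasDerivAt t (hline t))
    have h4 : HasDerivAt (fun t : ℝ => ψ (z + (t : ℂ) • x) v)
        (fderiv ℂ ψ (z + (t : ℂ) • x) x v) t :=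
      (((ContinuousLinearMap.apply ℂ 𝔸 v).hasFDerivAt.restrictScalars ℝ).comp_hasDerivAt t h3)
    have h5 : HasDerivAt (fun t : ℝ => (t : ℂ)) 1 t := Complex.ofRealCLM.hasDerivAt
    refine (h5.smul h4).congr_deriv ?_
    have h6 := h2 v
    rw [add_sub_cancel_left] at h6
    simp only [map_smul, smul_apply, one_smul, smul_mul_assoc,
      mul_smul_comm] at h6 ⊢
    rw [← h6, add_comm]
  obtain ⟨K, hK⟩ : ∃ K, ∀ t ∈ Set.Icc (0 : ℝ) 1, ‖A (z + (t : ℂ) • x) x‖ ≤ K := by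
    refine isCompact_Icc.exists_bound_of_continuousOn fun t ht => ContinuousAt.continuousWithinAt ?_
    exact (ContinuousAt.comp' (f := fun t : ℝ => z + (t : ℂ) • x) (hball _ (hseg t ht)).1
      (hline t).continuousAt).clm_apply continuousAt_const
  have h0 := eq_zero_of_abs_deriv_le_mul_abs_self_of_eq_zero_right (K := K)
    (fun t ht => (hw t ht).continuousAt.continuousWithinAt)
    (fun t ht => (hw t ⟨ht.1, ht.2.le⟩).hasDerivWithinAt) (by simp)
    (fun t ht => by
      rw [norm_neg]
      exact (norm_mul_le _ _).trans
        (mul_le_mul_of_nonneg_right (hK t ⟨ht.1, ht.2.le⟩) (norm_nonneg _))) 1 (by simp)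
  simpa [hx] using h0

end Algebra

/-! ### Frames of holomorphic bundles -/

section Frames

variable {E : Type u} [NormedAddCommGroup E] [NormedSpace ℂ E]
  {M : Type v} [TopologicalSpace M] [ChartedSpace E M]

/-- A family of linear maps out of `ℂⁿ` is holomorphic if it is pointwise holomorphic. -/
theorem contMDiffAt_clm_of_apply {n : ℕ} {G : Type*} [NormedAddCommGroup G] [NormedSpace ℂ G]
    {m : M → (Fin n → ℂ) →L[ℂ] G} {x : M}
    (h : ∀ c, ContMDiffAt 𝓘(ℂ, E) 𝓘(ℂ, G) ω (fun y => m y c) x) :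
    ContMDiffAt 𝓘(ℂ, E) 𝓘(ℂ, (Fin n → ℂ) →L[ℂ] G) ω m x := by
  have e : m = fun y => ∑ i, (ContinuousLinearMap.smulRightL ℂ (Fin n → ℂ) G
      (ContinuousLinearMap.proj i)) (m y (Pi.single i 1)) := by
    funext y
    ext c
    conv_lhs => rw [pi_eq_sum_univ' c]
    simp
  rw [e]
  refine ContMDiffAt.sum fun i _ => ?_
  exact (ContinuousLinearMap.contMDiff _).contMDiffAt.comp x (h (Pi.single i 1))

namespace HolBundle

/-- A holomorphic frame of `V` over the open set `U`, together with the coordinates with respect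
to it. The values outside `U` are irrelevant. -/
structure Frame (V : HolBundle.{u, v, w} E M) (U : Set M) (n : ℕ) where
  /-- The linear combination of the frame with given coefficients. -/
  comb : ∀ y, (Fin n → ℂ) →ₗ[ℂ] V.Fib y
  /-- The coefficients with respect to the frame. -/
  coeff : ∀ y, V.Fib y →ₗ[ℂ] (Fin n → ℂ)
  isOpen : IsOpen U
  coeff_comb : ∀ y ∈ U, ∀ c, coeff y (comb y c) = c
  comb_coeff : ∀ y ∈ U, ∀ e, comb y (coeff y e) = e
  holAt : ∀ y ∈ U, ∀ c, V.HolAt (fun z => comb z c) y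

variable {V : HolBundle.{u, v, w} E M}

/-- The frame given by one of the trivialisations of the bundle. -/
def baseFrame (V : HolBundle.{u, v, w} E M) (a : M) : V.Frame (V.base a) (V.rk a) where
  comb := V.frame a
  coeff := V.coord a
  isOpen := V.isOpen_base a
  coeff_comb := V.coord_frame a
  comb_coeff := V.frame_coord a
  holAt y hy c := (V.holomorphic a y c).contMDiffAt
    (((V.isOpen_base a).inter (V.isOpen_base y)).mem_nhds ⟨hy, V.mem_base y⟩)

namespace Frame

variable {U U' : Set M} {n k : ℕ}

/-- The matrix expressing the combinations of one frame in terms of the other one. -/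
def transition (F : V.Frame U n) (G : V.Frame U' k) (y : M) : (Fin n → ℂ) →L[ℂ] (Fin k → ℂ) :=
  LinearMap.toContinuousLinearMap (G.coeff y ∘ₗ F.comb y)

theorem transition_apply (F : V.Frame U n) (G : V.Frame U' k) (y : M) (c : Fin n → ℂ) :
    F.transition G y c = G.coeff y (F.comb y c) := rfl

/-- The transition matrix, as an isomorphism. -/
def transitionEquiv (F : V.Frame U n) (G : V.Frame U' k) (y : M) (h : y ∈ U) (h' : y ∈ U') :
    (Fin n → ℂ) ≃L[ℂ] (Fin k → ℂ) :=
  LinearEquiv.toContinuousLinearEquiv <|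
    LinearEquiv.ofLinearMap (G.coeff y ∘ₗ F.comb y) (F.coeff y ∘ₗ G.comb y)
      (LinearMap.ext fun c => by simp [G.coeff_comb y h', F.comb_coeff y h])
      (LinearMap.ext fun c => by simp [F.coeff_comb y h, G.comb_coeff y h'])

/-- Holomorphy at `y` is defined by the trivialisation centred at `y`. Two arbitrary frames are
compared by means of this one. -/
theorem contMDiffAt_transition_base (F : V.Frame U n) {y : M} (hy : y ∈ U) :
    ContMDiffAt 𝓘(ℂ, E) 𝓘(ℂ, (Fin n → ℂ) →L[ℂ] (Fin (V.rk y) → ℂ)) ω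
      (F.transition (V.baseFrame y)) y :=
  contMDiffAt_clm_of_apply fun c => F.holAt y hy c

theorem contMDiffAt_transition (F : V.Frame U n) (G : V.Frame U' k) {y : M} (h : y ∈ U)
    (h' : y ∈ U') :
    ContMDiffAt 𝓘(ℂ, E) 𝓘(ℂ, (Fin n → ℂ) →L[ℂ] (Fin k → ℂ)) ω (F.transition G) y := by
  have h1 := F.contMDiffAt_transition_base h
  have h2 := G.contMDiffAt_transition_base h'
  have h3 : ContMDiffAt 𝓘(ℂ, E) 𝓘(ℂ, (Fin (V.rk y) → ℂ) →L[ℂ] (Fin k → ℂ)) ω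
      (fun z => ContinuousLinearMap.inverse (G.transition (V.baseFrame y) z)) y := by
    have e : G.transition (V.baseFrame y) y =
        (G.transitionEquiv (V.baseFrame y) y h' (V.mem_base y) : _ →L[ℂ] _) := rfl
    have h4 := contDiffAt_map_inverse (𝕜 := ℂ) (n := ω)
      (G.transitionEquiv (V.baseFrame y) y h' (V.mem_base y))
    rw [← e] at h4
    exact h4.contMDiffAt.comp y h2
  refine (h3.clm_comp h1).congr_of_eventuallyEq ?_
  filter_upwards [F.isOpen.mem_nhds h, G.isOpen.mem_nhds h',
    (V.isOpen_base y).mem_nhds (V.mem_base y)] with z hz hz' hz''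
  have e : G.transition (V.baseFrame y) z =
      (G.transitionEquiv (V.baseFrame y) z hz' hz'' : _ →L[ℂ] _) := rfl
  rw [e, ContinuousLinearMap.inverse_equiv]
  ext1 c
  change _ = G.coeff z (V.frame y z (V.coord y z (F.comb z c)))
  rw [V.frame_coord y z hz'']
  rfl

theorem coeff_eventuallyEq (F : V.Frame U n) (G : V.Frame U' k) {y : M} (h : y ∈ U)
    (σ : ∀ x, V.Fib x) :
    (fun z => G.coeff z (σ z)) =ᶠ[𝓝 y] fun z => F.transition G z (F.coeff z (σ z)) := by
  filter_upwards [F.isOpen.mem_nhds h] with z hz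
  rw [transition_apply, F.comb_coeff z hz]

theorem holAt_iff (F : V.Frame U n) {σ : ∀ x, V.Fib x} {y : M} (hy : y ∈ U) :
    V.HolAt σ y ↔ ContMDiffAt 𝓘(ℂ, E) 𝓘(ℂ, Fin n → ℂ) ω (fun z => F.coeff z (σ z)) y := by
  constructor
  · intro h
    exact (((V.baseFrame y).contMDiffAt_transition F (V.mem_base y) hy).clm_apply
      h).congr_of_eventuallyEq ((V.baseFrame y).coeff_eventuallyEq F (V.mem_base y) σ)
  · intro h
    exact ((F.contMDiffAt_transition_base hy).clm_apply h).congr_of_eventuallyEq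
      (F.coeff_eventuallyEq (V.baseFrame y) hy σ)

theorem diffAt_iff (F : V.Frame U n) {σ : ∀ x, V.Fib x} {y : M} (hy : y ∈ U) :
    V.DiffAt σ y ↔ MDifferentiableAt 𝓘(ℂ, E) 𝓘(ℂ, Fin n → ℂ) (fun z => F.coeff z (σ z)) y := by
  constructor
  · intro h
    exact ((((V.baseFrame y).contMDiffAt_transition F (V.mem_base y) hy).mdifferentiableAt
      (by simp)).clm_apply h).congr_of_eventuallyEq
        ((V.baseFrame y).coeff_eventuallyEq F (V.mem_base y) σ)
  · intro h
    exact (((F.contMDiffAt_transition_base hy).mdifferentiableAt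
      (by simp)).clm_apply h).congr_of_eventuallyEq
        (F.coeff_eventuallyEq (V.baseFrame y) hy σ)

end Frame

theorem HolAt.diffAt {σ : ∀ x, V.Fib x} {y : M} (h : V.HolAt σ y) : V.DiffAt σ y :=
  ContMDiffAt.mdifferentiableAt h (by simp)

section Family

variable {EQ : Type*} [NormedAddCommGroup EQ] [NormedSpace ℂ EQ] {Q : Type*}
  [TopologicalSpace Q] [ChartedSpace EQ Q] {E' : Type*} [NormedAddCommGroup E']
  [NormedSpace ℂ E'] {N : Type*} [TopologicalSpace N] [ChartedSpace E' N]
  {V : HolBundle E M} {W : HolBundle E' N} {f : Q → M} {g : Q → N}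
  {τ : ∀ q, V.Fib (f q) →ₗ[ℂ] W.Fib (g q)}

/-- Holomorphy of a family of linear maps may be tested in any holomorphic frames. -/
theorem contMDiffAt_family_of_frames {U₁ U₂ : Set M} {U₃ U₄ : Set N} {n₁ n₂ n₃ n₄ : ℕ}
    (F : V.Frame U₁ n₁) (F' : V.Frame U₂ n₂) (G : W.Frame U₃ n₃) (G' : W.Frame U₄ n₄) {q : Q}
    (h₁ : f q ∈ U₁) (h₂ : f q ∈ U₂) (h₃ : g q ∈ U₃) (h₄ : g q ∈ U₄)
    (hf : ContMDiffAt 𝓘(ℂ, EQ) 𝓘(ℂ, E) ω f q) (hg : ContMDiffAt 𝓘(ℂ, EQ) 𝓘(ℂ, E') ω g q)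
    (h : ∀ c, ContMDiffAt 𝓘(ℂ, EQ) 𝓘(ℂ, Fin n₃ → ℂ) ω
      (fun q' => G.coeff (g q') (τ q' (F.comb (f q') c))) q) (c : Fin n₂ → ℂ) :
    ContMDiffAt 𝓘(ℂ, EQ) 𝓘(ℂ, Fin n₄ → ℂ) ω
      (fun q' => G'.coeff (g q') (τ q' (F'.comb (f q') c))) q := by
  let m : Q → (Fin n₁ → ℂ) →L[ℂ] (Fin n₃ → ℂ) := fun q' =>
    LinearMap.toContinuousLinearMap (G.coeff (g q') ∘ₗ τ q' ∘ₗ F.comb (f q'))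
  have hm : ContMDiffAt 𝓘(ℂ, EQ) 𝓘(ℂ, (Fin n₁ → ℂ) →L[ℂ] (Fin n₃ → ℂ)) ω m q :=
    contMDiffAt_clm_of_apply h
  have hF := (F'.contMDiffAt_transition F h₂ h₁).comp q hf
  have hG := (G.contMDiffAt_transition G' h₃ h₄).comp q hg
  refine ((hG.clm_comp hm).clm_apply
    (hF.clm_apply (contMDiffAt_const (c := c)))).congr_of_eventuallyEq ?_
  filter_upwards [hf.continuousAt.eventually_mem (F.isOpen.mem_nhds h₁),
    hg.continuousAt.eventually_mem (G.isOpen.mem_nhds h₃)] with q' hq hq'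
  change _ = G'.coeff (g q') (G.comb (g q') (G.coeff (g q')
    (τ q' (F.comb (f q') (F.coeff (f q') (F'.comb (f q') c))))))
  rw [F.comb_coeff _ hq, G.comb_coeff _ hq']

/-- A family of linear maps which is constant with respect to suitable frames near every point is
holomorphic. -/
theorem isHolFamily_of_frames (hf : ContMDiff 𝓘(ℂ, EQ) 𝓘(ℂ, E) ω f)
    (hg : ContMDiff 𝓘(ℂ, EQ) 𝓘(ℂ, E') ω g)
    (h : ∀ q, ∃ (U : Set M) (U' : Set N) (n n' : ℕ) (F : V.Frame U n) (G : W.Frame U' n')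
      (m : (Fin n → ℂ) → (Fin n' → ℂ)), f q ∈ U ∧ g q ∈ U' ∧
        ∀ᶠ q' in 𝓝 q, ∀ c, τ q' (F.comb (f q') c) = G.comb (g q') (m c)) :
    IsHolFamily EQ V W f g τ := by
  intro q c
  obtain ⟨U, U', n, n', F, G, m, hU, hU', hm⟩ := h q
  refine contMDiffAt_family_of_frames F (V.baseFrame (f q)) G (W.baseFrame (g q)) hU
    (V.mem_base _) hU' (W.mem_base _) (hf q) (hg q) (fun c => ?_) c
  refine (contMDiffAt_const (c := m c)).congr_of_eventuallyEq ?_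
  filter_upwards [hm, (hg q).continuousAt.eventually_mem (G.isOpen.mem_nhds hU')] with q' hq hq'
  rw [hq, G.coeff_comb _ hq']

end Family

end HolBundle

end Frames

/-! ### Coordinate vector fields and the Lie bracket -/

section CoordinateFields

variable {E : Type*} [NormedAddCommGroup E] [NormedSpace ℂ E]
  {M : Type*} [TopologicalSpace M] [ChartedSpace E M] [IsManifold 𝓘(ℂ, E) ω M]
  {G : Type*} [NormedAddCommGroup G] [NormedSpace ℂ G]

/-- The derivative of a holomorphic function along a holomorphic vector field is holomorphic. -/
theorem contMDiffAt_mvfderiv_apply {f : M → G} {ξ : ∀ x, TangentSpace 𝓘(ℂ, E) x} {x : M}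
    (hf : ContMDiffAt 𝓘(ℂ, E) 𝓘(ℂ, G) ω f x)
    (hξ : ContMDiffAt 𝓘(ℂ, E) 𝓘(ℂ, E).tangent ω
      (fun x => (⟨x, ξ x⟩ : TangentBundle 𝓘(ℂ, E) M)) x) :
    ContMDiffAt 𝓘(ℂ, E) 𝓘(ℂ, G) ω (fun y => mvfderiv 𝓘(ℂ, E) f y (ξ y)) x := by
  obtain ⟨O, hO, hxO, hfO⟩ : ∃ O, IsOpen O ∧ x ∈ O ∧ ContMDiffOn 𝓘(ℂ, E) 𝓘(ℂ, G) ω f O := by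
    obtain ⟨O, hO, hfO⟩ := (contMDiffAt_iff_contMDiffOn_nhds (by simp)).1 hf
    exact ⟨interior O, isOpen_interior, mem_interior_iff_mem_nhds.2 hO,
      hfO.mono interior_subset⟩
  have h1 := hfO.contMDiffOn_tangentMapWithin (m := ω) (by simp) hO.uniqueMDiffOn
  have h2 := (h1.contMDiffAt (x := ⟨x, ξ x⟩) (by
    exact (hO.preimage (FiberBundle.continuous_proj E (TangentSpace 𝓘(ℂ, E)))).mem_nhds
      hxO)).comp x hξ
  have h3 : ContMDiff 𝓘(ℂ, G).tangent 𝓘(ℂ, G) ω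
      (fun p : TangentBundle 𝓘(ℂ, G) G => p.2) := contMDiff_snd_tangentBundle_modelSpace G 𝓘(ℂ, G)
  refine (h3.contMDiffAt.comp x h2).congr_of_eventuallyEq ?_
  filter_upwards [hO.mem_nhds hxO] with y hy
  change _ = mfderivWithin _ _ f O y (ξ y)
  rw [mfderivWithin_of_isOpen hO hy]
  rfl

/-- The vector field with constant coordinates `v` in the chart at `a`. -/
def coordField (a : M) (v : E) : ∀ x : M, TangentSpace 𝓘(ℂ, E) x :=
  VectorField.mpullback 𝓘(ℂ, E) 𝓘(ℂ, E) (extChartAt 𝓘(ℂ, E) a) fun _ => v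

variable {a x : M}

theorem contMDiffAt_extChart (hx : x ∈ (chartAt E a).source) :
    ContMDiffAt 𝓘(ℂ, E) 𝓘(ℂ, E) ω (extChartAt 𝓘(ℂ, E) a) x :=
  contMDiffAt_extChartAt' hx

theorem isInvertible_mfderiv_chart (hx : x ∈ (chartAt E a).source) :
    (mfderiv 𝓘(ℂ, E) 𝓘(ℂ, E) (extChartAt 𝓘(ℂ, E) a) x).IsInvertible :=
  isInvertible_mfderiv_extChartAt (by simpa using hx)

theorem mvfderiv_coordField (hx : x ∈ (chartAt E a).source) (v : E) :
    mvfderiv 𝓘(ℂ, E) (extChartAt 𝓘(ℂ, E) a) x (coordField a v x) = v := by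
  obtain ⟨e, he⟩ := isInvertible_mfderiv_chart (E := E) hx
  change mfderiv _ _ _ x ((mfderiv _ _ _ x).inverse v) = v
  rw [← he, ContinuousLinearMap.inverse_equiv]
  exact e.apply_symm_apply v

theorem coordField_mvfderiv (hx : x ∈ (chartAt E a).source) (ξ : TangentSpace 𝓘(ℂ, E) x) :
    coordField a (mvfderiv 𝓘(ℂ, E) (extChartAt 𝓘(ℂ, E) a) x ξ) x = ξ := by
  obtain ⟨e, he⟩ := isInvertible_mfderiv_chart (E := E) hx
  change (mfderiv _ _ _ x).inverse (mfderiv _ _ _ x ξ) = ξ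
  rw [← he, ContinuousLinearMap.inverse_equiv]
  exact e.symm_apply_apply ξ

/-- The derivative of a function, computed in a chart. -/
theorem mvfderiv_eq_fderiv {f : M → G} (hx : x ∈ (chartAt E a).source)
    (hf : MDifferentiableAt 𝓘(ℂ, E) 𝓘(ℂ, G) f x) (ξ : TangentSpace 𝓘(ℂ, E) x) :
    DifferentiableAt ℂ (f ∘ (chartAt E a).symm) (chartAt E a x) ∧
    mvfderiv 𝓘(ℂ, E) f x ξ = fderiv ℂ (f ∘ (chartAt E a).symm) (chartAt E a x)
      (mvfderiv 𝓘(ℂ, E) (extChartAt 𝓘(ℂ, E) a) x ξ) := by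
  have h0 : MDifferentiableAt 𝓘(ℂ, E) 𝓘(ℂ, E) (chartAt E a).symm (chartAt E a x) :=
    (contMDiffOn_chart_symm (n := ω)|>.contMDiffAt ((chartAt E a).open_target.mem_nhds
      ((chartAt E a).map_source hx))).mdifferentiableAt (by simp)
  have h1 : MDifferentiableAt 𝓘(ℂ, E) 𝓘(ℂ, G) (f ∘ (chartAt E a).symm) (chartAt E a x) := by
    refine MDifferentiableAt.comp _ ?_ h0
    rwa [(chartAt E a).left_inv hx]
  refine ⟨h1.differentiableAt, ?_⟩
  have h2 : f =ᶠ[𝓝 x] (f ∘ (chartAt E a).symm) ∘ extChartAt 𝓘(ℂ, E) a := by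
    filter_upwards [(chartAt E a).open_source.mem_nhds hx] with y hy
    exact congrArg f ((chartAt E a).left_inv hy).symm
  have h3 := h2.mfderiv_eq (I := 𝓘(ℂ, E)) (I' := 𝓘(ℂ, G))
  have h4 := mfderiv_comp x (g := f ∘ (chartAt E a).symm) (f := extChartAt 𝓘(ℂ, E) a) h1
    ((contMDiffAt_extChart hx).mdifferentiableAt (by simp))
  rw [mfderiv_eq_fderiv] at h4
  have h5 := congrArg (fun T => T ξ) (h3.trans h4)
  exact h5

variable [CompleteSpace E]

theorem contMDiffAt_mpullback_chart {V : E → E} (hx : x ∈ (chartAt E a).source)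
    (hV : ContDiffAt ℂ ω V (chartAt E a x)) :
    ContMDiffAt 𝓘(ℂ, E) 𝓘(ℂ, E).tangent ω (fun y => (⟨y, VectorField.mpullback 𝓘(ℂ, E) 𝓘(ℂ, E)
      (extChartAt 𝓘(ℂ, E) a) V y⟩ : TangentBundle 𝓘(ℂ, E) M)) x := by
  refine ContMDiffAt.mpullback_vectorField_preimage (n := ω) ?_ (contMDiffAt_extChart hx)
    (isInvertible_mfderiv_chart hx) (by simp)
  exact contMDiffAt_vectorSpace_iff_contDiffAt.2 hV

theorem contMDiffAt_coordField (hx : x ∈ (chartAt E a).source) (v : E) :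
    ContMDiffAt 𝓘(ℂ, E) 𝓘(ℂ, E).tangent ω
      (fun y => (⟨y, coordField a v y⟩ : TangentBundle 𝓘(ℂ, E) M)) x :=
  contMDiffAt_mpullback_chart (V := fun _ => v) hx contDiffAt_const

theorem mlieBracket_mpullback_chart {V W : E → E} (hx : x ∈ (chartAt E a).source)
    (hV : ContDiffAt ℂ ω V (chartAt E a x)) (hW : ContDiffAt ℂ ω W (chartAt E a x)) :
    mvfderiv 𝓘(ℂ, E) (extChartAt 𝓘(ℂ, E) a) x (VectorField.mlieBracket 𝓘(ℂ, E)
      (VectorField.mpullback 𝓘(ℂ, E) 𝓘(ℂ, E) (extChartAt 𝓘(ℂ, E) a) V)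
      (VectorField.mpullback 𝓘(ℂ, E) 𝓘(ℂ, E) (extChartAt 𝓘(ℂ, E) a) W) x) =
      VectorField.lieBracket ℂ V W (chartAt E a x) := by
  have h := VectorField.mpullback_mlieBracket (I := 𝓘(ℂ, E)) (I' := 𝓘(ℂ, E)) (n := ω)
    (f := extChartAt 𝓘(ℂ, E) a) (V := V) (W := W) (x₀ := x)
    ((contMDiffAt_vectorSpace_iff_contDiffAt.2 hV).mdifferentiableAt (by simp))
    ((contMDiffAt_vectorSpace_iff_contDiffAt.2 hW).mdifferentiableAt (by simp))
    (contMDiffAt_extChart hx) (by simp)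
  have h' : VectorField.mlieBracket 𝓘(ℂ, E) V W = VectorField.lieBracket ℂ V W :=
    VectorField.mlieBracketWithin_univ.symm.trans
      (VectorField.mlieBracketWithin_eq_lieBracketWithin.trans VectorField.lieBracketWithin_univ)
  rw [← h]
  exact (mvfderiv_coordField hx _).trans (congrFun h' _)

theorem mlieBracket_coordField (hx : x ∈ (chartAt E a).source) (v w : E) :
    VectorField.mlieBracket 𝓘(ℂ, E) (coordField a v) (coordField a w) x = 0 := by
  have h := mlieBracket_mpullback_chart (V := fun _ => v) (W := fun _ => w) hx
    contDiffAt_const contDiffAt_const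
  have h0 : VectorField.lieBracket ℂ (fun _ : E => v) (fun _ => w) (chartAt E a x) = 0 := by
    simp [VectorField.lieBracket]
  have h1 := coordField_mvfderiv hx
    (VectorField.mlieBracket 𝓘(ℂ, E) (coordField a v) (coordField a w) x)
  refine h1.symm.trans ((congrArg (fun u => coordField a u x) (h.trans h0)).trans ?_)
  exact map_zero (mfderiv 𝓘(ℂ, E) 𝓘(ℂ, E) (extChartAt 𝓘(ℂ, E) a) x).inverse

/-- The Lie bracket of vector fields is the commutator of the corresponding derivations. -/
theorem mvfderiv_mlieBracket {f : M → G} {ξ η : ∀ x, TangentSpace 𝓘(ℂ, E) x} {x : M}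
    (hf : ContMDiffAt 𝓘(ℂ, E) 𝓘(ℂ, G) ω f x)
    (hξ : ContMDiffAt 𝓘(ℂ, E) 𝓘(ℂ, E).tangent ω
      (fun x => (⟨x, ξ x⟩ : TangentBundle 𝓘(ℂ, E) M)) x)
    (hη : ContMDiffAt 𝓘(ℂ, E) 𝓘(ℂ, E).tangent ω
      (fun x => (⟨x, η x⟩ : TangentBundle 𝓘(ℂ, E) M)) x) :
    mvfderiv 𝓘(ℂ, E) f x (VectorField.mlieBracket 𝓘(ℂ, E) ξ η x) =
      mvfderiv 𝓘(ℂ, E) (fun y => mvfderiv 𝓘(ℂ, E) f y (η y)) x (ξ x) -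
      mvfderiv 𝓘(ℂ, E) (fun y => mvfderiv 𝓘(ℂ, E) f y (ξ y)) x (η x) := by
  have hx : x ∈ (chartAt E x).source := mem_chart_source E x
  let φ := chartAt E x
  have hsymm : ContMDiffAt 𝓘(ℂ, E) 𝓘(ℂ, E) ω φ.symm (φ x) :=
    contMDiffOn_chart_symm.contMDiffAt (φ.open_target.mem_nhds (φ.map_source hx))
  -- the coordinate expression of a vector field
  let co : (∀ x, TangentSpace 𝓘(ℂ, E) x) → E → E := fun ξ =>
    (fun y => mvfderiv 𝓘(ℂ, E) (extChartAt 𝓘(ℂ, E) x) y (ξ y)) ∘ φ.symm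
  have hco : ∀ ξ : ∀ x, TangentSpace 𝓘(ℂ, E) x, ContMDiffAt 𝓘(ℂ, E) 𝓘(ℂ, E).tangent ω
      (fun x => (⟨x, ξ x⟩ : TangentBundle 𝓘(ℂ, E) M)) x → ContDiffAt ℂ ω (co ξ) (φ x) := by
    intro ξ hξ
    refine ContMDiffAt.contDiffAt (ContMDiffAt.comp (φ x) ?_ hsymm)
    rw [φ.left_inv hx]
    exact contMDiffAt_mvfderiv_apply (contMDiffAt_extChart hx) hξ
  have hpull : ∀ ξ : ∀ x, TangentSpace 𝓘(ℂ, E) x, ξ =ᶠ[𝓝 x]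
      VectorField.mpullback 𝓘(ℂ, E) 𝓘(ℂ, E) (extChartAt 𝓘(ℂ, E) x) (co ξ) := by
    intro ξ
    filter_upwards [φ.open_source.mem_nhds hx] with y hy
    have e : co ξ (extChartAt 𝓘(ℂ, E) x y) =
        mvfderiv 𝓘(ℂ, E) (extChartAt 𝓘(ℂ, E) x) y (ξ y) := by
      change mvfderiv 𝓘(ℂ, E) (extChartAt 𝓘(ℂ, E) x) (φ.symm (φ y)) (ξ (φ.symm (φ y))) = _
      rw [φ.left_inv hy]
    refine (coordField_mvfderiv hy (ξ y)).symm.trans ?_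
    exact congrArg (mfderiv 𝓘(ℂ, E) 𝓘(ℂ, E) (extChartAt 𝓘(ℂ, E) x) y).inverse e.symm
  let F := f ∘ φ.symm
  have hF : ContDiffAt ℂ ω F (φ x) := by
    refine ContMDiffAt.contDiffAt (ContMDiffAt.comp (φ x) ?_ hsymm)
    rwa [φ.left_inv hx]
  have hdf : ∀ ξ : ∀ x, TangentSpace 𝓘(ℂ, E) x,
      (fun y => mvfderiv 𝓘(ℂ, E) f y (ξ y)) ∘ φ.symm =ᶠ[𝓝 (φ x)]
        fun z => fderiv ℂ F z (co ξ z) := by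
    intro ξ
    have h1 : ∀ᶠ y in 𝓝 x, MDifferentiableAt 𝓘(ℂ, E) 𝓘(ℂ, G) f y := by
      filter_upwards [(contMDiffAt_iff_contMDiffAt_nhds (by simp)).1 hf] with y hy
        using hy.mdifferentiableAt (by simp)
    have h2 : ∀ᶠ z in 𝓝 (φ x), MDifferentiableAt 𝓘(ℂ, E) 𝓘(ℂ, G) f (φ.symm z) := by
      have := hsymm.continuousAt.tendsto
      rw [φ.left_inv hx] at this
      exact this.eventually h1
    filter_upwards [h2, φ.open_target.mem_nhds (φ.map_source hx)] with z hz hz'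
    have h3 := (mvfderiv_eq_fderiv (a := x) (φ.map_target hz') hz (ξ (φ.symm z))).2
    rw [φ.right_inv hz'] at h3
    exact h3
  have hsecond : ∀ ξ η : ∀ x, TangentSpace 𝓘(ℂ, E) x, ContMDiffAt 𝓘(ℂ, E) 𝓘(ℂ, E).tangent ω
      (fun x => (⟨x, η x⟩ : TangentBundle 𝓘(ℂ, E) M)) x →
      mvfderiv 𝓘(ℂ, E) (fun y => mvfderiv 𝓘(ℂ, E) f y (η y)) x (ξ x) =
        fderiv ℂ (fderiv ℂ F) (φ x) (co ξ (φ x)) (co η (φ x)) +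
          fderiv ℂ F (φ x) (fderiv ℂ (co η) (φ x) (co ξ (φ x))) := by
    intro ξ η hη
    have h1 := (mvfderiv_eq_fderiv (a := x) hx
      ((contMDiffAt_mvfderiv_apply hf hη).mdifferentiableAt (by simp)) (ξ x)).2
    rw [h1, (hdf η).fderiv_eq]
    have e : mvfderiv 𝓘(ℂ, E) (extChartAt 𝓘(ℂ, E) x) x (ξ x) = co ξ (φ x) := by
      change _ = mvfderiv 𝓘(ℂ, E) (extChartAt 𝓘(ℂ, E) x) (φ.symm (φ x)) (ξ (φ.symm (φ x)))
      rw [φ.left_inv hx]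
    rw [e]
    have h2 : HasFDerivAt (fderiv ℂ F) (fderiv ℂ (fderiv ℂ F) (φ x)) (φ x) :=
      ((hF.fderiv_right (m := ω) (by simp)).differentiableAt (by simp)).hasFDerivAt
    have h3 := ((hco η hη).differentiableAt (by simp)).hasFDerivAt
    have h4 := (h2.clm_apply h3).fderiv
    change fderiv ℂ (fun z => fderiv ℂ F z (co η z)) (φ x) _ = _
    rw [h4]
    simp [add_comm]
  rw [hsecond ξ η hη, hsecond η ξ hξ, (hpull ξ).mlieBracket_vectorField_eq (hpull η),
    (mvfderiv_eq_fderiv (a := x) hx (hf.mdifferentiableAt (by simp)) _).2,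
    mlieBracket_mpullback_chart hx (hco ξ hξ) (hco η hη), VectorField.lieBracket_eq,
    hF.isSymmSndFDerivAt_of_omega (co ξ (φ x)) (co η (φ x))]
  simp only [map_sub, add_sub_add_left_eq_sub]
  rfl

end CoordinateFields

/-! ### Flat frames -/

section FlatFrames

variable {E : Type u} [NormedAddCommGroup E] [NormedSpace ℂ E]
  {M : Type v} [TopologicalSpace M] [ChartedSpace E M]

namespace HolBundle

variable {V : HolBundle.{u, v, w} E M}

theorem DiffAt.congr {σ σ' : ∀ x, V.Fib x} {x : M} (h : V.DiffAt σ x)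
    (e : ∀ᶠ y in 𝓝 x, σ' y = σ y) : V.DiffAt σ' x :=
  MDifferentiableAt.congr_of_eventuallyEq h (e.mono fun y hy => by simp only [hy])

theorem DiffAt.smul {f : M → ℂ} {σ : ∀ x, V.Fib x} {x : M}
    (hf : MDifferentiableAt 𝓘(ℂ, E) 𝓘(ℂ, ℂ) f x) (h : V.DiffAt σ x) :
    V.DiffAt (fun y => f y • σ y) x := by
  have := MDifferentiableAt.smul hf h
  unfold DiffAt
  simp only [map_smul]
  exact this

theorem DiffAt.sum {ι : Type} (s : Finset ι) {σ : ι → ∀ x, V.Fib x} {x : M}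
    (h : ∀ i, V.DiffAt (σ i) x) : V.DiffAt (fun y => ∑ i ∈ s, σ i y) x := by
  have := MDifferentiableAt.sum (t := s) (f := fun i y => V.coord x y (σ i y)) fun i _ => h i
  rw [Finset.sum_fn] at this
  unfold DiffAt
  simp only [map_sum]
  exact this

end HolBundle

variable [IsManifold 𝓘(ℂ, E) ω M]

namespace FlatConn

variable {V : FlatConn.{u, v, w} E M}

open HolBundle

/-- Connections are local operators: by the Leibniz rule, a section may be multiplied with the
indicator function of a neighbourhood of `x`. -/
theorem cov_congr {σ σ' : ∀ x, V.Fib x} {x : M} (hσ : V.DiffAt σ x)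
    (h : ∀ᶠ y in 𝓝 x, σ' y = σ y) : V.cov σ' x = V.cov σ x := by
  classical
  obtain ⟨O, hO, hOo, hxO⟩ := eventually_nhds_iff.1 h
  -- the Leibniz rule for the indicator function of `O`
  let f : M → ℂ := O.indicator 1
  have hf1 : f =ᶠ[𝓝 x] fun _ => 1 := by
    filter_upwards [hOo.mem_nhds hxO] with y hy
    simp [f, hy]
  have hf : MDifferentiableAt 𝓘(ℂ, E) 𝓘(ℂ, ℂ) f x :=
    mdifferentiableAt_const.congr_of_eventuallyEq hf1
  have hdf : mvfderiv 𝓘(ℂ, E) f x = 0 := by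
    have := hf1.mfderiv_eq (I := 𝓘(ℂ, E)) (I' := 𝓘(ℂ, ℂ))
    rw [mfderiv_const] at this
    ext ξ
    exact congrArg (fun T => T ξ) this
  have key : ∀ τ : ∀ x, V.Fib x, V.DiffAt τ x → V.cov (fun y => f y • τ y) x = V.cov τ x := by
    intro τ hτ
    ext ξ
    rw [V.leibniz f τ x hf hτ ξ, hdf, hf1.self_of_nhds]
    simp
  rw [← key σ hσ, ← key σ' (hσ.congr h)]
  congr 1
  funext y
  by_cases hy : y ∈ O
  · rw [hO y hy]
  · simp [f, hy]

theorem cov_zero (x : M) : V.cov (fun _ => 0) x = 0 := by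
  have h0 : V.DiffAt (fun _ => 0) x := by
    unfold HolBundle.DiffAt
    simp only [map_zero]
    exact mdifferentiableAt_const
  have := V.add _ _ x h0 h0
  have e : ((fun _ => 0) + fun _ => 0 : ∀ x, V.Fib x) = fun _ => 0 := by
    funext y
    simp
  rw [e] at this
  simpa using this

theorem cov_sum {ι : Type} (s : Finset ι) {σ : ι → ∀ x, V.Fib x} {x : M}
    (h : ∀ i, V.DiffAt (σ i) x) : V.cov (fun y => ∑ i ∈ s, σ i y) x = ∑ i ∈ s, V.cov (σ i) x := by
  classical
  induction s using Finset.induction_on with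
  | empty => simp only [Finset.sum_empty]; exact cov_zero x
  | insert i s hi ih =>
    simp only [Finset.sum_insert hi]
    rw [← ih]
    exact V.add _ _ x (h i) (DiffAt.sum s h)

theorem mdifferentiableAt_coeff {U : Set M} {n : ℕ} (F : V.Frame U n) {σ : ∀ x, V.Fib x} {y : M}
    (hy : y ∈ U) (hσ : V.DiffAt σ y) (i : Fin n) :
    MDifferentiableAt 𝓘(ℂ, E) 𝓘(ℂ, ℂ) (fun z => F.coeff z (σ z) i) y :=
  (ContinuousLinearMap.proj (R := ℂ) (φ := fun _ : Fin n => ℂ) i).mdifferentiableAt.comp y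
    ((F.diffAt_iff hy).1 hσ)

/-- The covariant derivative of a section with constant coefficients is linear in them. -/
theorem cov_comb_eq_sum {U : Set M} {n : ℕ} (F : V.Frame U n) {y : M} (hy : y ∈ U)
    (c : Fin n → ℂ) (ξ : TangentSpace 𝓘(ℂ, E) y) :
    V.cov (fun z => F.comb z c) y ξ =
      ∑ i, c i • V.cov (fun z => F.comb z (Pi.single i 1)) y ξ := by
  have hd : ∀ i, V.DiffAt (fun z => F.comb z (Pi.single i 1)) y := fun i =>
    (F.holAt y hy _).diffAt
  have e : (fun z => F.comb z c) = fun z => ∑ i, (fun _ : M => c i) z •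
      F.comb z (Pi.single i 1) := by
    funext z
    conv_lhs => rw [pi_eq_sum_univ' c]
    simp only [map_sum, map_smul]
  rw [e, cov_sum _ fun i => (hd i).smul mdifferentiableAt_const, LinearMap.sum_apply]
  refine Finset.sum_congr rfl fun i _ => ?_
  rw [V.leibniz _ _ y mdifferentiableAt_const (hd i), mvfderiv_const]
  simp

/-- The covariant derivative in terms of the coordinates with respect to a frame. -/
theorem cov_eq {U : Set M} {n : ℕ} (F : V.Frame U n) {σ : ∀ x, V.Fib x} {y : M}
    (hy : y ∈ U) (hσ : V.DiffAt σ y) (ξ : TangentSpace 𝓘(ℂ, E) y) :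
    V.cov σ y ξ = F.comb y (mvfderiv 𝓘(ℂ, E) (fun z => F.coeff z (σ z)) y ξ) +
      V.cov (fun z => F.comb z (F.coeff y (σ y))) y ξ := by
  have hd : ∀ i, V.DiffAt (fun z => F.comb z (Pi.single i 1)) y := fun i =>
    (F.holAt y hy _).diffAt
  have hc := mdifferentiableAt_coeff F hy hσ
  have e : ∀ᶠ z in 𝓝 y, (∑ i, F.coeff z (σ z) i • F.comb z (Pi.single i 1)) = σ z := by
    filter_upwards [F.isOpen.mem_nhds hy] with z hz
    conv_rhs => rw [← F.comb_coeff z hz (σ z), pi_eq_sum_univ' (F.coeff z (σ z))]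
    simp only [map_sum, map_smul]
  have hdc : ∀ i, mvfderiv 𝓘(ℂ, E) (fun z => F.coeff z (σ z) i) y ξ =
      mvfderiv 𝓘(ℂ, E) (fun z => F.coeff z (σ z)) y ξ i := by
    intro i
    have h1 := mfderiv_comp y (I'' := 𝓘(ℂ, ℂ))
      (ContinuousLinearMap.proj (R := ℂ) (φ := fun _ : Fin n => ℂ) i).mdifferentiableAt
      ((F.diffAt_iff hy).1 hσ)
    rw [ContinuousLinearMap.mfderiv_eq] at h1
    exact congrArg (fun T => T ξ) h1
  rw [← cov_congr hσ e, cov_sum _ fun i => (hd i).smul (hc i), LinearMap.sum_apply,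
    cov_comb_eq_sum F hy]
  conv_rhs => rw [pi_eq_sum_univ' (mvfderiv 𝓘(ℂ, E) (fun z => F.coeff z (σ z)) y ξ)]
  simp only [map_sum, map_smul]
  rw [← Finset.sum_add_distrib]
  refine Finset.sum_congr rfl fun i _ => ?_
  rw [V.leibniz _ _ y (hc i) (hd i), hdc, add_comm]

/-- A frame consisting of flat sections. -/
structure FlatFrame (V : FlatConn.{u, v, w} E M) (U : Set M) (n : ℕ) extends
    V.toHolBundle.Frame U n where
  cov_comb : ∀ y ∈ U, ∀ c, V.cov (fun z => comb z c) y = 0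

namespace FlatFrame

variable {U : Set M} {n : ℕ}

theorem cov_eq (F : V.FlatFrame U n) {σ : ∀ x, V.Fib x} {y : M}
    (hy : y ∈ U) (hσ : V.DiffAt σ y) (ξ : TangentSpace 𝓘(ℂ, E) y) :
    V.cov σ y ξ = F.comb y (mvfderiv 𝓘(ℂ, E) (fun z => F.coeff z (σ z)) y ξ) := by
  rw [FlatConn.cov_eq F.toFrame hy hσ, F.cov_comb y hy]
  simp

/-- Flat sections have locally constant coefficients with respect to a flat frame. -/
theorem eventually_coeff_eq (F : V.FlatFrame U n) {σ : ∀ x, V.Fib x} {y : M}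
    (hy : y ∈ U) (hσ : ∀ᶠ z in 𝓝 y, V.DiffAt σ z ∧ V.cov σ z = 0) :
    ∀ᶠ z in 𝓝 y, σ z = F.comb z (F.coeff y (σ y)) := by
  let φ := chartAt E y
  have hys : y ∈ φ.source := mem_chart_source E y
  let s : M → Fin n → ℂ := fun z => F.coeff z (σ z)
  have h1 : ∀ᶠ z in 𝓝 (φ y), φ.symm z ∈ U ∧ z ∈ φ.target ∧ V.DiffAt σ (φ.symm z) ∧
      V.cov σ (φ.symm z) = 0 := by
    have ht := (φ.symm.continuousAt (φ.map_source hys)).tendsto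
    rw [φ.left_inv hys] at ht
    filter_upwards [ht.eventually (F.isOpen.eventually_mem hy), ht.eventually hσ,
      φ.open_target.mem_nhds (φ.map_source hys)] with z h1 h2 h3 using ⟨h1, h3, h2⟩
  obtain ⟨r, hr, hball⟩ := Metric.eventually_nhds_iff_ball.1 h1
  have h2 : ∀ z ∈ Metric.ball (φ y) r, HasFDerivAt (s ∘ φ.symm) (0 : E →L[ℂ] Fin n → ℂ) z := by
    intro z hz
    obtain ⟨k1, k2, k3, k4⟩ := hball z hz
    have h3 := fun ξ => mvfderiv_eq_fderiv (a := y) (φ.map_target k2)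
      ((F.diffAt_iff k1).1 k3) ξ
    change ∀ ξ, DifferentiableAt ℂ (s ∘ φ.symm) (φ (φ.symm z)) ∧ _ =
      fderiv ℂ (s ∘ φ.symm) (φ (φ.symm z)) _ at h3
    rw [φ.right_inv k2] at h3
    refine (h3 0).1.hasFDerivAt.congr_fderiv ?_
    ext1 v
    have h4 := (h3 (coordField y v (φ.symm z))).2
    rw [mvfderiv_coordField (φ.map_target k2)] at h4
    rw [← h4]
    have h5 := congrArg (fun T => F.coeff _ (T (coordField y v (φ.symm z)))) k4
    simp only [F.cov_eq k1 k3] at h5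
    rw [F.coeff_comb _ k1] at h5
    simpa using h5
  have h3 : ∀ z ∈ Metric.ball (φ y) r, (s ∘ φ.symm) z = (s ∘ φ.symm) (φ y) := fun z hz =>
    Metric.isOpen_ball.is_const_of_fderiv_eq_zero (𝕜 := ℂ)
      (convex_ball (φ y) r).isPreconnected
      (fun z hz => (h2 z hz).differentiableAt.differentiableWithinAt)
      (fun z hz => (h2 z hz).fderiv) hz (Metric.mem_ball_self hr)
  have h4 := (φ.continuousAt hys).eventually_mem (Metric.ball_mem_nhds (φ y) hr)
  filter_upwards [h4, φ.open_source.mem_nhds hys, F.isOpen.mem_nhds hy] with z hz hz' hzU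
  have h5 := h3 _ hz
  simp only [Function.comp_apply, φ.left_inv hz', φ.left_inv hys] at h5
  change F.coeff z (σ z) = F.coeff y (σ y) at h5
  rw [← h5, F.comb_coeff z hzU]

end FlatFrame

end FlatConn

end FlatFrames

/-! ### Existence of flat frames -/

section FlatFrameExistence

variable {E : Type u} [NormedAddCommGroup E] [NormedSpace ℂ E]
  {M : Type v} [TopologicalSpace M] [ChartedSpace E M] [IsManifold 𝓘(ℂ, E) ω M]

namespace FlatConn

variable {V : FlatConn.{u, v, w} E M}

open HolBundle

/-- The connection matrix of `V`, in the coordinates given by the chart at `a` and with respect to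
the frame `F`: its value at `v ∈ E` is the matrix of `∇_v` applied to the frame. -/
def connMatrix {U : Set M} {n : ℕ} (F : V.Frame U n) (a : M) (z : E) :
    E →ₗ[ℂ] (Fin n → ℂ) →L[ℂ] (Fin n → ℂ) where
  toFun v := ∑ i, (ContinuousLinearMap.proj (R := ℂ) (φ := fun _ : Fin n => ℂ) i).smulRight
    (F.coeff ((chartAt E a).symm z) (V.cov (fun y => F.comb y (Pi.single i 1))
      ((chartAt E a).symm z) (coordField a v ((chartAt E a).symm z))))
  map_add' v w := by
    have h : coordField a (v + w) ((chartAt E a).symm z) =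
        coordField a v ((chartAt E a).symm z) + coordField a w ((chartAt E a).symm z) :=
      map_add (mfderiv 𝓘(ℂ, E) 𝓘(ℂ, E) (extChartAt 𝓘(ℂ, E) a) _).inverse v w
    ext c
    simp [h, Finset.sum_add_distrib]
  map_smul' r v := by
    have h : coordField a (r • v) ((chartAt E a).symm z) =
        r • coordField a v ((chartAt E a).symm z) :=
      map_smul (mfderiv 𝓘(ℂ, E) 𝓘(ℂ, E) (extChartAt 𝓘(ℂ, E) a) _).inverse r v
    ext c
    simp [h, Finset.mul_sum, mul_left_comm]

theorem connMatrix_apply {U : Set M} {n : ℕ} (F : V.Frame U n) (a : M) {y : M} (hy : y ∈ U)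
    (ha : y ∈ (chartAt E a).source) (v : E) (c : Fin n → ℂ) :
    connMatrix F a (chartAt E a y) v c =
      F.coeff y (V.cov (fun z => F.comb z c) y (coordField a v y)) := by
  rw [cov_comb_eq_sum F hy, map_sum]
  have key : ∀ y', y' = y → (∑ i, (ContinuousLinearMap.proj (R := ℂ) (φ := fun _ : Fin n => ℂ)
      i).smulRight (F.coeff y' (V.cov (fun y => F.comb y (Pi.single i 1)) y'
        (coordField a v y')))) c =
      ∑ i, F.coeff y (c i • V.cov (fun z => F.comb z (Pi.single i 1)) y (coordField a v y)) := by
    rintro _ rfl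
    simp
  exact key _ ((chartAt E a).left_inv ha)

variable [FiniteDimensional ℂ E]

theorem contDiffAt_connMatrix {U : Set M} {n : ℕ} (F : V.Frame U n) (a : M) {y : M} (hy : y ∈ U)
    (ha : y ∈ (chartAt E a).source) :
    ContDiffAt ℂ ω (fun z => LinearMap.toContinuousLinearMap (connMatrix F a z))
      (chartAt E a y) := by
  let φ := chartAt E a
  let O : Set E := φ.target ∩ φ.symm ⁻¹' U
  have hO : IsOpen O := φ.isOpen_inter_preimage_symm F.isOpen
  have hyO : φ y ∈ O := ⟨φ.map_source ha, by
    change φ.symm (φ y) ∈ U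
    rwa [φ.left_inv ha]⟩
  refine ContDiffOn.contDiffAt (s := O) ?_ (hO.mem_nhds hyO)
  have : CompleteSpace E := FiniteDimensional.complete ℂ E
  rw [contDiffOn_clm_apply]
  intro v
  rw [contDiffOn_clm_apply]
  intro c z hz
  refine ContDiffAt.contDiffWithinAt ?_
  have hzs := φ.map_target hz.1
  have h1 : ContMDiffAt 𝓘(ℂ, E) 𝓘(ℂ, Fin n → ℂ) ω
      (fun y => F.coeff y (V.cov (fun z => F.comb z c) y (coordField a v y))) (φ.symm z) := by
    refine (F.holAt_iff hz.2).1 (V.holomorphic_cov (φ.source ∩ U) _ _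
      (φ.open_source.inter F.isOpen) ?_ ?_ _ ⟨hzs, hz.2⟩)
    · exact fun y hy => (contMDiffAt_coordField hy.1 v).contMDiffWithinAt
    · exact fun y hy => F.holAt y hy.2 c
  have h2 : ContMDiffAt 𝓘(ℂ, E) 𝓘(ℂ, E) ω φ.symm z :=
    contMDiffOn_chart_symm.contMDiffAt (φ.open_target.mem_nhds hz.1)
  refine (h1.comp z h2).contDiffAt.congr_of_eventuallyEq ?_
  filter_upwards [hO.mem_nhds hz] with x hx
  have := connMatrix_apply F a hx.2 (φ.map_target hx.1) v c
  change connMatrix F a (φ (φ.symm x)) v c = _ at this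
  rwa [φ.right_inv hx.1] at this

/-- The flatness of the connection, in coordinates: as coordinate vector fields commute, it says
that `∇_v ∇_w = ∇_w ∇_v`. -/
theorem connMatrix_flat {U : Set M} {n : ℕ} (F : V.Frame U n) (a : M) {y : M} (hy : y ∈ U)
    (ha : y ∈ (chartAt E a).source) (v w : E) :
    let A := fun z => LinearMap.toContinuousLinearMap (connMatrix F a z)
    fderiv ℂ A (chartAt E a y) v w - fderiv ℂ A (chartAt E a y) w v +
      (A (chartAt E a y) v * A (chartAt E a y) w - A (chartAt E a y) w * A (chartAt E a y) v) =
      0 := by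
  intro A
  let φ := chartAt E a
  have : CompleteSpace E := FiniteDimensional.complete ℂ E
  ext1 c
  have hhol : ∀ v, ∀ x ∈ φ.source ∩ U,
      V.HolAt (fun y => V.cov (fun z => F.comb z c) y (coordField a v y)) x := fun v x hx =>
    V.holomorphic_cov (φ.source ∩ U) _ _ (φ.open_source.inter F.isOpen)
      (fun y hy => (contMDiffAt_coordField hy.1 v).contMDiffWithinAt)
      (fun y hy => F.holAt y hy.2 c) x hx
  have key : ∀ v w, F.coeff y (V.cov (fun y => V.cov (fun z => F.comb z c) y (coordField a w y)) y
      (coordField a v y)) = fderiv ℂ A (φ y) v w c + A (φ y) v (A (φ y) w c) := by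
    intro v w
    have h1 := hhol w y ⟨ha, hy⟩
    rw [cov_eq F hy h1.diffAt, map_add, F.coeff_comb y hy,
      (mvfderiv_eq_fderiv (a := a) ha ((F.diffAt_iff hy).1 h1.diffAt) _).2,
      mvfderiv_coordField ha, ← connMatrix_apply F a hy ha w c,
      ← connMatrix_apply F a hy ha v]
    congr 1
    have h2 : ((fun x => F.coeff x (V.cov (fun z => F.comb z c) x (coordField a w x))) ∘
        φ.symm) =ᶠ[𝓝 (φ y)] fun z => A z w c := by
      filter_upwards [(φ.isOpen_inter_preimage_symm F.isOpen).mem_nhds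
        ⟨φ.map_source ha, by
          change φ.symm (φ y) ∈ U
          rwa [φ.left_inv ha]⟩] with x hx
      have := connMatrix_apply F a hx.2 (φ.map_target hx.1) w c
      change connMatrix F a (φ (φ.symm x)) w c = _ at this
      rw [φ.right_inv hx.1] at this
      exact this.symm
    have h3 := ((contDiffAt_connMatrix F a hy ha).differentiableAt (by simp)).hasFDerivAt
    have h4 := (h3.clm_apply (hasFDerivAt_const w (φ y))).clm_apply (hasFDerivAt_const c (φ y))
    rw [h2.fderiv_eq]
    change fderiv ℂ (fun z => A z w c) (φ y) v = _
    rw [h4.fderiv]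
    simp
    rfl
  have h := V.flat (φ.source ∩ U) (coordField a v) (coordField a w) (fun z => F.comb z c)
    (φ.open_source.inter F.isOpen)
    (fun y hy => (contMDiffAt_coordField hy.1 v).contMDiffWithinAt)
    (fun y hy => (contMDiffAt_coordField hy.1 w).contMDiffWithinAt)
    (fun y hy => F.holAt y hy.2 c) y ⟨ha, hy⟩
  rw [mlieBracket_coordField ha, map_zero, sub_zero] at h
  have h' := congrArg (F.coeff y) h
  rw [map_sub, map_zero] at h'
  have e1 := key v w
  have e2 := key w v
  rw [e1, e2] at h'
  change fderiv ℂ A (φ y) v w c - fderiv ℂ A (φ y) w v c +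
    (A (φ y) v (A (φ y) w c) - A (φ y) w (A (φ y) v c)) = 0
  rw [← h']
  abel

/-- A flat connection has a flat frame near every point: the frame given by a trivialisation is
multiplied by a fundamental matrix of the connection. -/
theorem exists_flatFrame (V : FlatConn.{u, v, w} E M) (a : M) :
    ∃ (U : Set M) (n : ℕ) (_ : V.FlatFrame U n), a ∈ U := by
  have : CompleteSpace E := FiniteDimensional.complete ℂ E
  let φ := chartAt E a
  let F := V.baseFrame a
  have ha : a ∈ φ.source := mem_chart_source E a
  have haU : a ∈ V.base a := V.mem_base a
  let A : E → E →L[ℂ] (Fin (V.rk a) → ℂ) →L[ℂ] (Fin (V.rk a) → ℂ) :=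
    fun z => LinearMap.toContinuousLinearMap (connMatrix F a z)
  have hO : ∀ᶠ z in 𝓝 (φ a), z ∈ φ.target ∧ φ.symm z ∈ V.base a :=
    (φ.isOpen_inter_preimage_symm F.isOpen).mem_nhds ⟨φ.map_source ha, by
      change φ.symm (φ a) ∈ V.base a
      rwa [φ.left_inv ha]⟩
  obtain ⟨Φ, hΦ, hΦa, hdΦ⟩ := exists_flat_frame (A := A) (z := φ a)
    (contDiffAt_connMatrix F a haU ha).analyticAt (by
      filter_upwards [hO] with z hz v w
      have := connMatrix_flat F a hz.2 (φ.map_target hz.1) v w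
      change fderiv ℂ A (φ (φ.symm z)) v w - _ + _ = 0 at this
      change _ - fderiv ℂ A (φ (φ.symm z)) w v + (A (φ (φ.symm z)) v * A (φ (φ.symm z)) w -
        A (φ (φ.symm z)) w * A (φ (φ.symm z)) v) = 0 at this
      rwa [φ.right_inv hz.1] at this)
  have hunit : ∀ᶠ z in 𝓝 (φ a), IsUnit (Φ z) := by
    refine hΦ.continuousAt.eventually (Units.isOpen.mem_nhds ?_)
    rw [hΦa]
    exact isUnit_one
  obtain ⟨O, hO', hOo, haO⟩ := eventually_nhds_iff.1
    (hO.and (hunit.and (hdΦ.and hΦ.eventually_analyticAt)))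
  let U : Set M := φ.source ∩ φ ⁻¹' O
  have hU : ∀ y ∈ U, y ∈ φ.source ∧ y ∈ V.base a ∧ IsUnit (Φ (φ y)) ∧
      (∀ v, fderiv ℂ Φ (φ y) v = -(A (φ y) v * Φ (φ y))) ∧ AnalyticAt ℂ Φ (φ y) := fun y hy => by
    obtain ⟨⟨-, h1⟩, h2, h3, h4⟩ := hO' _ hy.2
    rw [φ.left_inv hy.1] at h1
    exact ⟨hy.1, h1, h2, h3, h4⟩
  have hchart : ∀ y ∈ U, ContMDiffAt 𝓘(ℂ, E) 𝓘(ℂ, E) ω φ y := fun y hy =>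
    contMDiffAt_extChart (hU y hy).1
  have hmat : ∀ y ∈ U, ∀ c : Fin (V.rk a) → ℂ,
      ContMDiffAt 𝓘(ℂ, E) 𝓘(ℂ, Fin (V.rk a) → ℂ) ω (fun z => Φ (φ z) c) y := fun y hy c => by
    have h1 : ContDiffAt ℂ ω (fun z => Φ z c) (φ y) :=
      (hU y hy).2.2.2.2.contDiffAt.clm_apply contDiffAt_const
    exact h1.contMDiffAt.comp y (hchart y hy)
  have hcoeff : ∀ y ∈ U, ∀ c, (fun z => F.coeff z (F.comb z (Φ (φ z) c))) =ᶠ[𝓝 y]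
      fun z => Φ (φ z) c := fun y hy c => by
    filter_upwards [F.isOpen.mem_nhds (hU y hy).2.1] with z hz
    exact F.coeff_comb z hz _
  have hhol : ∀ y ∈ U, ∀ c, V.HolAt (fun z => F.comb z (Φ (φ z) c)) y := fun y hy c =>
    (F.holAt_iff (hU y hy).2.1).2 ((hmat y hy c).congr_of_eventuallyEq (hcoeff y hy c))
  refine ⟨U, V.rk a, ⟨⟨fun y => F.comb y ∘ₗ (Φ (φ y)).toLinearMap,
    fun y => (Ring.inverse (Φ (φ y))).toLinearMap ∘ₗ F.coeff y,
    φ.isOpen_inter_preimage hOo, fun y hy c => ?_, fun y hy e => ?_, hhol⟩, fun y hy c => ?_⟩,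
    ⟨ha, haO⟩⟩
  · have h1 := congrArg (fun T => T c) (Ring.inverse_mul_cancel _ (hU y hy).2.2.1)
    change Ring.inverse (Φ (φ y)) (F.coeff y (F.comb y (Φ (φ y) c))) = c
    rw [F.coeff_comb y (hU y hy).2.1]
    exact h1
  · have h1 := congrArg (fun T => T (F.coeff y e)) (Ring.mul_inverse_cancel _ (hU y hy).2.2.1)
    change F.comb y (Φ (φ y) (Ring.inverse (Φ (φ y)) (F.coeff y e))) = e
    conv_rhs => rw [← F.comb_coeff y (hU y hy).2.1 e]
    exact congrArg _ h1
  · obtain ⟨k1, k2, -, k3, k4⟩ := hU y hy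
    ext ξ
    change V.cov (fun z => F.comb z (Φ (φ z) c)) y ξ = 0
    rw [FlatConn.cov_eq F k2 (hhol y hy c).diffAt ξ]
    have h1 := (hcoeff y hy c).mfderiv_eq (I := 𝓘(ℂ, E)) (I' := 𝓘(ℂ, Fin (V.rk a) → ℂ))
    have h2 : mvfderiv 𝓘(ℂ, E) (fun z => F.coeff z (F.comb z (Φ (φ z) c))) y ξ =
        mvfderiv 𝓘(ℂ, E) (fun z => Φ (φ z) c) y ξ := congrArg (fun T => T ξ) h1
    have h3 := (mvfderiv_eq_fderiv (a := a) k1 ((hmat y hy c).mdifferentiableAt (by simp)) ξ).2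
    have h4 : ((fun z => Φ (φ z) c) ∘ φ.symm) =ᶠ[𝓝 (φ y)] fun z => Φ z c := by
      filter_upwards [φ.open_target.mem_nhds (φ.map_source k1)] with z hz
      simp only [Function.comp_apply, φ.right_inv hz]
    have h5 := (k4.differentiableAt.hasFDerivAt.clm_apply (hasFDerivAt_const c (φ y))).fderiv
    set v := mvfderiv 𝓘(ℂ, E) (extChartAt 𝓘(ℂ, E) a) y ξ with hv
    have h6 : fderiv ℂ ((fun z => Φ (φ z) c) ∘ φ.symm) (φ y) v = -(A (φ y) v (Φ (φ y) c)) := by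
      rw [h4.fderiv_eq, h5]
      simp [k3]
    rw [h2, h3, h6]
    have h7 := connMatrix_apply F a k2 k1 v (Φ (φ y) c)
    rw [hv, coordField_mvfderiv k1] at h7
    have h8 : A (φ y) v (Φ (φ y) c) = F.coeff y (V.cov (fun z => F.comb z (Φ (φ y) c)) y ξ) := h7
    rw [h8, map_neg, F.comb_coeff y k2, F.coeff_comb y k2]
    exact neg_add_cancel _

end FlatConn

end FlatFrameExistence

/-! ### The manifold of path classes -/

section PathManifold

variable {E₁ E₂ : Type*} [NormedAddCommGroup E₁] [NormedSpace ℂ E₁]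
  [NormedAddCommGroup E₂] [NormedSpace ℂ E₂]
  {A B Y : Type*} [TopologicalSpace A] [TopologicalSpace B] [TopologicalSpace Y]
  [ChartedSpace E₁ A] [ChartedSpace E₂ B] {a : C(A, Y)} {b : C(B, Y)}

namespace PathManifold

/-- The path classes obtained by moving the end points of `q` a little form a neighbourhood. -/
theorem nhd_mem_nhds (q : PathManifold E₁ E₂ a b) {U : Set A} {V : Set B}
    (hU : U ∈ 𝓝 (PathClasses.src q)) (hV : V ∈ 𝓝 (PathClasses.tgt q)) :
    PathClasses.nhd q U V ∈ 𝓝 q := by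
  have hq := mem_chart_source (E₁ × E₂) q
  obtain ⟨U', hU', hqU', tU'⟩ := exists_tame (E₁ := E₁) (PathClasses.src q)
    (Filter.inter_mem hU ((isTame_tameNhd E₁ (PathClasses.src q)).isOpen.mem_nhds
      (mem_tameNhd E₁ (PathClasses.src q))))
  obtain ⟨V', hV', hqV', tV'⟩ := exists_tame (E₁ := E₂) (PathClasses.tgt q)
    (Filter.inter_mem hV ((isTame_tameNhd E₂ (PathClasses.tgt q)).isOpen.mem_nhds
      (mem_tameNhd E₂ (PathClasses.tgt q))))
  have hopen := (chartAt (E₁ × E₂) q).isOpen_inter_preimage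
    ((PathClasses.isOpen_coordSet (E := E₁) (PathClasses.src q) tU'.isOpen).prod
      (PathClasses.isOpen_coordSet (E := E₂) (PathClasses.tgt q) tV'.isOpen))
  have s₁ := mem_chart_source E₁ (PathClasses.src q)
  have s₂ := mem_chart_source E₂ (PathClasses.tgt q)
  refine Filter.mem_of_superset (hopen.mem_nhds ⟨hq, ⟨(chartAt E₁ _).map_source s₁, ?_⟩,
    (chartAt E₂ _).map_source s₂, ?_⟩) ?_
  · rw [Set.mem_preimage]
    exact ((chartAt E₁ (PathClasses.src q)).left_inv s₁).symm ▸ hqU'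
  · rw [Set.mem_preimage]
    exact ((chartAt E₂ (PathClasses.tgt q)).left_inv s₂).symm ▸ hqV'
  · rintro q' ⟨h₁, ⟨-, h₂⟩, -, h₃⟩
    have h₁' : q' ∈ PathClasses.chartNhd E₁ E₂ q := h₁
    have k₁ := (chartAt E₁ (PathClasses.src q)).left_inv
      (tameNhd_subset E₁ _ (PathClasses.mem_src h₁'))
    have k₂ := (chartAt E₂ (PathClasses.tgt q)).left_inv
      (tameNhd_subset E₂ _ (PathClasses.mem_tgt h₁'))
    have h₂' : PathClasses.src q' ∈ U' := k₁ ▸ h₂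
    have h₃' : PathClasses.tgt q' ∈ V' := k₂ ▸ h₃
    obtain ⟨δ, hδ⟩ := tU'.joined _ hqU' _ h₂'
    obtain ⟨ε, hε⟩ := tV'.joined _ hqV' _ h₃'
    refine ⟨δ, ε, fun t => (hU' (hδ t)).1, fun t => (hV' (hε t)).1, ?_⟩
    exact PathClasses.nhd_unique (isTame_tameNhd E₁ _) (isTame_tameNhd E₂ _) h₁'
      (PathClasses.move_mem_nhd q δ ε (fun t => (hU' (hδ t)).2) fun t => (hV' (hε t)).2) rfl rfl

variable [IsManifold 𝓘(ℂ, E₁) ω A] [IsManifold 𝓘(ℂ, E₂) ω B]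

theorem contMDiff_src : ContMDiff 𝓘(ℂ, E₁ × E₂) 𝓘(ℂ, E₁) ω
    (fun q : PathManifold E₁ E₂ a b => PathClasses.src q) := by
  intro q
  have hq := mem_chart_source (E₁ × E₂) q
  have h₁ : ContMDiffAt 𝓘(ℂ, E₁ × E₂) 𝓘(ℂ, E₁ × E₂) ω (chartAt (E₁ × E₂) q) q :=
    contMDiffAt_of_mem_maximalAtlas (IsManifold.chart_mem_maximalAtlas q) hq
  have h₂ : ContMDiffAt 𝓘(ℂ, E₁) 𝓘(ℂ, E₁) ω (chartAt E₁ (PathClasses.src q)).symm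
      (chartAt (E₁ × E₂) q q).1 :=
    contMDiffOn_chart_symm.contMDiffAt ((chartAt E₁ (PathClasses.src q)).open_target.mem_nhds
      ((chartAt E₁ (PathClasses.src q)).map_source (mem_chart_source E₁ (PathClasses.src q))))
  have h₃ : ContMDiffAt 𝓘(ℂ, E₁ × E₂) 𝓘(ℂ, E₁) ω (Prod.fst : E₁ × E₂ → E₁)
      (chartAt (E₁ × E₂) q q) := contDiffAt_fst.contMDiffAt
  refine (h₂.comp q (h₃.comp q h₁)).congr_of_eventuallyEq ?_
  filter_upwards [(chartAt (E₁ × E₂) q).open_source.mem_nhds hq] with q' hq'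
  exact ((chartAt E₁ (PathClasses.src q)).left_inv
    (tameNhd_subset E₁ _ (PathClasses.mem_src hq'))).symm

theorem contMDiff_tgt : ContMDiff 𝓘(ℂ, E₁ × E₂) 𝓘(ℂ, E₂) ω
    (fun q : PathManifold E₁ E₂ a b => PathClasses.tgt q) := by
  intro q
  have hq := mem_chart_source (E₁ × E₂) q
  have h₁ : ContMDiffAt 𝓘(ℂ, E₁ × E₂) 𝓘(ℂ, E₁ × E₂) ω (chartAt (E₁ × E₂) q) q :=
    contMDiffAt_of_mem_maximalAtlas (IsManifold.chart_mem_maximalAtlas q) hq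
  have h₂ : ContMDiffAt 𝓘(ℂ, E₂) 𝓘(ℂ, E₂) ω (chartAt E₂ (PathClasses.tgt q)).symm
      (chartAt (E₁ × E₂) q q).2 :=
    contMDiffOn_chart_symm.contMDiffAt ((chartAt E₂ (PathClasses.tgt q)).open_target.mem_nhds
      ((chartAt E₂ (PathClasses.tgt q)).map_source (mem_chart_source E₂ (PathClasses.tgt q))))
  have h₃ : ContMDiffAt 𝓘(ℂ, E₁ × E₂) 𝓘(ℂ, E₂) ω (Prod.snd : E₁ × E₂ → E₂)
      (chartAt (E₁ × E₂) q q) := contDiffAt_snd.contMDiffAt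
  refine (h₂.comp q (h₃.comp q h₁)).congr_of_eventuallyEq ?_
  filter_upwards [(chartAt (E₁ × E₂) q).open_source.mem_nhds hq] with q' hq'
  exact ((chartAt E₂ (PathClasses.tgt q)).left_inv
    (tameNhd_subset E₂ _ (PathClasses.mem_tgt hq'))).symm

/-- A map into a space of path classes which takes values in the domain of one of the charts is
holomorphic if the end points depend holomorphically on the parameter. -/
theorem contMDiffAt_of_endpoints {EN : Type*} [NormedAddCommGroup EN] [NormedSpace ℂ EN]
    {N : Type*} [TopologicalSpace N] [ChartedSpace EN N] {g : N → PathManifold E₁ E₂ a b} {y : N}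
    (hg : ∀ᶠ z in 𝓝 y, g z ∈ PathClasses.chartNhd E₁ E₂ (g y))
    (h₁ : ContMDiffAt 𝓘(ℂ, EN) 𝓘(ℂ, E₁) ω (fun z => PathClasses.src (g z)) y)
    (h₂ : ContMDiffAt 𝓘(ℂ, EN) 𝓘(ℂ, E₂) ω (fun z => PathClasses.tgt (g z)) y) :
    ContMDiffAt 𝓘(ℂ, EN) 𝓘(ℂ, E₁ × E₂) ω g y := by
  have hq := mem_chart_source (E₁ × E₂) (g y)
  have k₁ : ContMDiffAt 𝓘(ℂ, E₁) 𝓘(ℂ, E₁) ω (chartAt E₁ (PathClasses.src (g y)))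
      (PathClasses.src (g y)) :=
    contMDiffAt_of_mem_maximalAtlas (IsManifold.chart_mem_maximalAtlas _) (mem_chart_source E₁ _)
  have k₂ : ContMDiffAt 𝓘(ℂ, E₂) 𝓘(ℂ, E₂) ω (chartAt E₂ (PathClasses.tgt (g y)))
      (PathClasses.tgt (g y)) :=
    contMDiffAt_of_mem_maximalAtlas (IsManifold.chart_mem_maximalAtlas _) (mem_chart_source E₂ _)
  have k₃ := (k₁.comp y h₁).prodMk_space (k₂.comp y h₂)
  have k₄ : ContMDiffAt 𝓘(ℂ, E₁ × E₂) 𝓘(ℂ, E₁ × E₂) ω (chartAt (E₁ × E₂) (g y)).symm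
      (chartAt (E₁ × E₂) (g y) (g y)) :=
    contMDiffOn_chart_symm.contMDiffAt ((chartAt (E₁ × E₂) (g y)).open_target.mem_nhds
      ((chartAt (E₁ × E₂) (g y)).map_source hq))
  refine (ContMDiffAt.comp y k₄ k₃).congr_of_eventuallyEq ?_
  filter_upwards [hg] with z hz
  exact ((chartAt (E₁ × E₂) (g y)).left_inv hz).symm

end PathManifold

end PathManifold

/-! ### Frames preserved by an action of path classes -/

section TransportFrames

variable {E : Type u} [NormedAddCommGroup E] [NormedSpace ℂ E]
  {M : Type v} [TopologicalSpace M] [ChartedSpace E M]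

namespace HolBundle

/-- A frame over `U` which is preserved by the action `act` of the paths in `U`. -/
structure TransportFrame (V : HolBundle.{u, v, w} E M)
    (act : ∀ {x y : M}, Path.Homotopic.Quotient x y → V.Fib x →ₗ[ℂ] V.Fib y) (U : Set M) (n : ℕ)
    extends V.Frame U n where
  act_comb : ∀ {y z : M} (δ : Path y z), (∀ t, δ t ∈ U) → ∀ c,
    act (Path.Homotopic.Quotient.mk δ) (comb y c) = comb z c

/-- Every point has a neighbourhood over which there is a frame preserved by the action. -/
def HasTransportFrames (V : HolBundle.{u, v, w} E M)
    (act : ∀ {x y : M}, Path.Homotopic.Quotient x y → V.Fib x →ₗ[ℂ] V.Fib y) : Prop :=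
  ∀ a : M, ∃ (U : Set M) (n : ℕ) (_ : V.TransportFrame act U n), a ∈ U

/-- Equivariant families of linear maps between bundles with transport frames are holomorphic. -/
theorem isHolFamily_of_equivariant {V W : HolBundle.{u, v, w} E M}
    {actV : ∀ {x y : M}, Path.Homotopic.Quotient x y → V.Fib x →ₗ[ℂ] V.Fib y}
    {actW : ∀ {x y : M}, Path.Homotopic.Quotient x y → W.Fib x →ₗ[ℂ] W.Fib y}
    (hV : V.HasTransportFrames actV) (hW : W.HasTransportFrames actW)
    (τ : ∀ x, V.Fib x →ₗ[ℂ] W.Fib x)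
    (hτ : ∀ {x y : M} (g : Path.Homotopic.Quotient x y) e, τ y (actV g e) = actW g (τ x e)) :
    IsHolFamily E (Q := M) V W id id τ := by
  refine isHolFamily_of_frames contMDiff_id contMDiff_id fun x => ?_
  obtain ⟨U, n, F, hU⟩ := hV x
  obtain ⟨U', n', G, hU'⟩ := hW x
  refine ⟨U, U', n, n', F.toFrame, G.toFrame, fun c => G.coeff x (τ x (F.comb x c)), hU, hU', ?_⟩
  obtain ⟨O, hO, hxO, tO⟩ := exists_tame (E₁ := E) x
    ((F.isOpen.inter G.isOpen).mem_nhds ⟨hU, hU'⟩)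
  filter_upwards [tO.isOpen.mem_nhds hxO] with y hy c
  obtain ⟨δ, hδ⟩ := tO.joined x hxO y hy
  change τ y (F.comb y c) = G.comb y _
  rw [← F.act_comb δ (fun t => (hO (hδ t)).1) c, hτ,
    ← G.act_comb δ (fun t => (hO (hδ t)).2), G.comb_coeff x hU']

/-- Families of linear maps indexed by path classes are holomorphic if they are equivariant with
respect to moving the end points. -/
theorem isHolFamily_pathManifold {E' : Type*} [NormedAddCommGroup E'] [NormedSpace ℂ E']
    {N : Type*} [TopologicalSpace N] [ChartedSpace E' N] [IsManifold 𝓘(ℂ, E) ω M]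
    [IsManifold 𝓘(ℂ, E') ω N] {Y : Type*} [TopologicalSpace Y] {a : C(M, Y)} {b : C(N, Y)}
    {V : HolBundle E M} {W : HolBundle E' N}
    {actV : ∀ {x y : M}, Path.Homotopic.Quotient x y → V.Fib x →ₗ[ℂ] V.Fib y}
    {actW : ∀ {x y : N}, Path.Homotopic.Quotient x y → W.Fib x →ₗ[ℂ] W.Fib y}
    (hV : V.HasTransportFrames actV) (hW : W.HasTransportFrames actW)
    (τ : ∀ q : PathManifold E E' a b, V.Fib (PathClasses.src q) →ₗ[ℂ] W.Fib (PathClasses.tgt q))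
    (hτ : ∀ (q : PathClasses a b) {x : M} {y : N} (δ : Path q.src x) (ε : Path q.tgt y) e,
      τ (q.move δ ε) (actV (Path.Homotopic.Quotient.mk δ) e) =
        actW (Path.Homotopic.Quotient.mk ε) (τ q e)) :
    IsHolFamily (E × E') (Q := PathManifold E E' a b) V W PathClasses.src PathClasses.tgt τ := by
  refine isHolFamily_of_frames PathManifold.contMDiff_src PathManifold.contMDiff_tgt fun q => ?_
  obtain ⟨U, n, F, hU⟩ := hV (PathClasses.src q)
  obtain ⟨U', n', G, hU'⟩ := hW (PathClasses.tgt q)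
  refine ⟨U, U', n, n', F.toFrame, G.toFrame,
    fun c => G.coeff (PathClasses.tgt q) (τ q (F.comb (PathClasses.src q) c)), hU, hU', ?_⟩
  filter_upwards [PathManifold.nhd_mem_nhds q (F.isOpen.mem_nhds hU) (G.isOpen.mem_nhds hU')]
    with q' hq' c
  obtain ⟨δ, ε, hδ, hε, e⟩ := hq'
  have key : τ (PathClasses.move q δ ε) (F.comb (PathClasses.src q') c) =
      G.comb (PathClasses.tgt q') (G.coeff (PathClasses.tgt q)
        (τ q (F.comb (PathClasses.src q) c))) := by
    have h₁ : actV (Path.Homotopic.Quotient.mk δ) (F.comb (PathClasses.src q) c) =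
      F.comb (PathClasses.src q') c := F.act_comb δ hδ c
    have h₂ : actW (Path.Homotopic.Quotient.mk ε) (G.comb (PathClasses.tgt q)
      (G.coeff (PathClasses.tgt q) (τ q (F.comb (PathClasses.src q) c)))) = G.comb _ _ :=
      G.act_comb ε hε _
    have h₃ := hτ q δ ε (F.comb (PathClasses.src q) c)
    rw [h₁] at h₃
    rw [G.comb_coeff _ hU'] at h₂
    exact h₃.trans h₂
  have key' : ∀ q'' : PathManifold E E' a b, q'' = PathClasses.move q δ ε →
      τ q'' (F.comb (PathClasses.src q'') c) =
      G.comb (PathClasses.tgt q'') (G.coeff (PathClasses.tgt q)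
        (τ q (F.comb (PathClasses.src q) c))) := by
    rintro _ rfl
    exact key
  exact key' q' e

end HolBundle

end TransportFrames

/-! ### Short paths -/

section TameClass

variable (E : Type u) [NormedAddCommGroup E] [NormedSpace ℂ E]
  {M : Type v} [TopologicalSpace M] [ChartedSpace E M]

/-- The class of the paths from `a` to `y` inside the tame neighbourhood of `a`. -/
def tameClass (a : M) {y : M} (hy : y ∈ tameNhd E a) : Path.Homotopic.Quotient a y :=
  Path.Homotopic.Quotient.mk
    (Classical.choose ((isTame_tameNhd E a).joined a (mem_tameNhd E a) y hy))

theorem tameClass_eq {a y : M} (hy : y ∈ tameNhd E a) (δ : Path a y)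
    (hδ : ∀ t, δ t ∈ tameNhd E a) : tameClass E a hy = Path.Homotopic.Quotient.mk δ :=
  Path.Homotopic.Quotient.eq.2 ((isTame_tameNhd E a).homotopic _ _
    (Classical.choose_spec ((isTame_tameNhd E a).joined a (mem_tameNhd E a) y hy)) hδ)

theorem tameClass_trans {a y z : M} (hy : y ∈ tameNhd E a) (hz : z ∈ tameNhd E a) (δ : Path y z)
    (hδ : ∀ t, δ t ∈ tameNhd E a) :
    (tameClass E a hy).trans (Path.Homotopic.Quotient.mk δ) = tameClass E a hz := by
  obtain ⟨ε, hε⟩ := (isTame_tameNhd E a).joined a (mem_tameNhd E a) y hy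
  rw [tameClass_eq E hy ε hε, tameClass_eq E hz (ε.trans δ) (PathClasses.trans_mem ε δ hε hδ),
    Path.Homotopic.Quotient.mk_trans]

end TameClass

theorem quotient_map_id {Y : Type*} [TopologicalSpace Y] {x y : Y}
    (g : Path.Homotopic.Quotient x y) : g.map (ContinuousMap.id Y) = g := by
  induction g using Path.Homotopic.Quotient.ind
  rw [← Path.Homotopic.Quotient.mk_map]
  rfl

/-! ### Representations of the fundamental groupoid -/

section Actions

variable {E : Type u} [NormedAddCommGroup E] [NormedSpace ℂ E]
  {M : Type v} [TopologicalSpace M] [ChartedSpace E M]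
  {Fib : M → Type w} [∀ x, AddCommGroup (Fib x)] [∀ x, Module ℂ (Fib x)]

/-- A linear action of the homotopy classes of paths on a family of vector spaces. -/
structure IsAction (act : ∀ {x y : M}, Path.Homotopic.Quotient x y → Fib x →ₗ[ℂ] Fib y) :
    Prop where
  refl : ∀ x e, act (Path.Homotopic.Quotient.refl x) e = e
  trans : ∀ {x y z : M} (g : Path.Homotopic.Quotient x y) (h : Path.Homotopic.Quotient y z) e,
    act (g.trans h) e = act h (act g e)

namespace IsAction

variable {act : ∀ {x y : M}, Path.Homotopic.Quotient x y → Fib x →ₗ[ℂ] Fib y}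

theorem symm_act (h : IsAction act) {x y : M} (g : Path.Homotopic.Quotient x y) (e : Fib x) :
    act g.symm (act g e) = e := by
  rw [← h.trans, Path.Homotopic.Quotient.trans_symm, h.refl]

theorem act_symm (h : IsAction act) {x y : M} (g : Path.Homotopic.Quotient x y) (e : Fib y) :
    act g (act g.symm e) = e := by
  rw [← h.trans, Path.Homotopic.Quotient.symm_trans, h.refl]

/-- The action of a path class, as an isomorphism. -/
def equiv (h : IsAction act) {x y : M} (g : Path.Homotopic.Quotient x y) : Fib x ≃ₗ[ℂ] Fib y :=
  LinearEquiv.ofLinearMap (act g) (act g.symm) (LinearMap.ext (h.act_symm g))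
    (LinearMap.ext (h.symm_act g))

/-- The action of the arrows of the fundamental groupoid is compatible with moving end points. -/
theorem act_move (h : IsAction act) (q : PathClasses (ContinuousMap.id M) (ContinuousMap.id M))
    {x y : M} (δ : Path q.src x) (ε : Path q.tgt y) (e : Fib q.src) :
    act (q.move δ ε).cls (act (Path.Homotopic.Quotient.mk δ) e) =
      act (Path.Homotopic.Quotient.mk ε) (act q.cls e) := by
  have e₁ : (q.move δ ε).cls = (Path.Homotopic.Quotient.mk δ).symm.trans
      (q.cls.trans (Path.Homotopic.Quotient.mk ε)) := by
    change ((Path.Homotopic.Quotient.mk δ).map _).symm.trans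
      (q.cls.trans ((Path.Homotopic.Quotient.mk ε).map _)) = _
    rw [quotient_map_id, quotient_map_id]
    rfl
  exact (congrArg (fun g => act g _) e₁).trans
    ((h.trans _ _ _).trans ((h.trans _ _ _).trans
      (congrArg (fun v => act _ (act _ v)) (h.symm_act _ _))))

end IsAction

open Classical in
/-- The bundle underlying a linear action of the homotopy classes of paths: the action of the short
paths provides the trivialisations, and the transition functions are locally constant. -/
def bundleOfAction (act : ∀ {x y : M}, Path.Homotopic.Quotient x y → Fib x →ₗ[ℂ] Fib y)
    (h : IsAction act) [∀ x, FiniteDimensional ℂ (Fib x)] : HolBundle.{u, v, w} E M where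
  Fib := Fib
  rk a := Module.finrank ℂ (Fib a)
  base a := tameNhd E a
  isOpen_base a := (isTame_tameNhd E a).isOpen
  mem_base a := mem_tameNhd E a
  coord a y := if hy : y ∈ tameNhd E a then
    (Module.finBasis ℂ (Fib a)).equivFun.toLinearMap ∘ₗ act (tameClass E a hy).symm else 0
  frame a y := if hy : y ∈ tameNhd E a then
    act (tameClass E a hy) ∘ₗ (Module.finBasis ℂ (Fib a)).equivFun.symm.toLinearMap else 0
  frame_coord a y hy e := by
    simp only [dif_pos hy, LinearMap.comp_apply, LinearEquiv.coe_coe, h.act_symm,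
      LinearEquiv.symm_apply_apply]
  coord_frame a y hy e := by
    simp only [dif_pos hy, LinearMap.comp_apply, LinearEquiv.coe_coe, h.symm_act,
      LinearEquiv.apply_symm_apply]
  holomorphic a b c := by
    rintro y ⟨hya, hyb⟩
    refine ContMDiffAt.contMDiffWithinAt ?_
    obtain ⟨O, hO, hyO, tO⟩ := exists_tame (E₁ := E) y
      (((isTame_tameNhd E a).isOpen.inter (isTame_tameNhd E b).isOpen).mem_nhds ⟨hya, hyb⟩)
    refine (contMDiffAt_const (c := (Module.finBasis ℂ (Fib b)).equivFun
      (act (tameClass E b hyb).symm (act (tameClass E a hya)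
        ((Module.finBasis ℂ (Fib a)).equivFun.symm c))))).congr_of_eventuallyEq ?_
    filter_upwards [tO.isOpen.mem_nhds hyO] with z hz
    obtain ⟨δ, hδ⟩ := tO.joined y hyO z hz
    rw [dif_pos (hO hz).1, dif_pos (hO hz).2,
      ← tameClass_trans E hya (hO hz).1 δ fun t => (hO (hδ t)).1,
      ← tameClass_trans E hyb (hO hz).2 δ fun t => (hO (hδ t)).2]
    simp only [LinearMap.comp_apply, LinearEquiv.coe_coe, PathClasses.symm_trans_rev, h.trans,
      h.symm_act]

theorem bundleOfAction_frame
    (act : ∀ {x y : M}, Path.Homotopic.Quotient x y → Fib x →ₗ[ℂ] Fib y) (h : IsAction act)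
    [∀ x, FiniteDimensional ℂ (Fib x)] {a y : M} (hy : y ∈ tameNhd E a)
    (c : Fin (Module.finrank ℂ (Fib a)) → ℂ) :
    (bundleOfAction (E := E) act h).frame a y c =
      act (tameClass E a hy) ((Module.finBasis ℂ (Fib a)).equivFun.symm c) := by
  unfold bundleOfAction
  simp only [dif_pos hy]
  rfl

theorem hasTransportFrames_bundleOfAction
    (act : ∀ {x y : M}, Path.Homotopic.Quotient x y → Fib x →ₗ[ℂ] Fib y) (h : IsAction act)
    [∀ x, FiniteDimensional ℂ (Fib x)] :
    (bundleOfAction (E := E) act h).HasTransportFrames act := fun a =>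
  ⟨tameNhd E a, _, ⟨(bundleOfAction act h).baseFrame a, fun {y z} δ hδ c => by
    have hy : y ∈ tameNhd E a := by
      have := hδ 0
      rwa [δ.source] at this
    have hz : z ∈ tameNhd E a := by
      have := hδ 1
      rwa [δ.target] at this
    have e₁ := bundleOfAction_frame (E := E) act h hy c
    have e₂ := bundleOfAction_frame (E := E) act h hz c
    rw [← tameClass_trans E hy hz δ hδ, h.trans] at e₂
    exact (congrArg (act (Path.Homotopic.Quotient.mk δ)) e₁).trans e₂.symm⟩, mem_tameNhd E a⟩

variable [IsManifold 𝓘(ℂ, E) ω M]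

/-- The representation given by a linear action of the homotopy classes of paths on a family of
finite-dimensional vector spaces: there is no condition of holomorphy, as the bundle structure
is recovered from the action. -/
def repOfAction (act : ∀ {x y : M}, Path.Homotopic.Quotient x y → Fib x →ₗ[ℂ] Fib y)
    (h : IsAction act) [∀ x, FiniteDimensional ℂ (Fib x)] : Rep.{u, v, w} E M where
  toHolBundle := bundleOfAction act h
  act := act
  act_refl := h.refl
  act_trans := h.trans
  holomorphic_act := HolBundle.isHolFamily_pathManifold
    (hasTransportFrames_bundleOfAction act h) (hasTransportFrames_bundleOfAction act h)
    (fun g : PathManifold E E (ContinuousMap.id M) (ContinuousMap.id M) =>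
      act (PathClasses.cls g)) h.act_move

namespace Rep

variable (V : Rep.{u, v, w} E M)

omit [IsManifold 𝓘(ℂ, E) ω M] in
theorem isAction : IsAction (Fib := V.Fib) V.act := ⟨V.act_refl, V.act_trans⟩

open Classical in
/-- The arrow from `a` to `z` in the tame neighbourhood of `a`. -/
def tameArrow (E : Type u) [NormedAddCommGroup E] [NormedSpace ℂ E]
    [ChartedSpace E M] (a z : M) : Pi₁ E M :=
  if hz : z ∈ tameNhd E a then (⟨a, z, tameClass E a hz⟩ : PathClasses _ _)
  else (⟨a, a, Path.Homotopic.Quotient.refl a⟩ : PathClasses _ _)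

omit [IsManifold 𝓘(ℂ, E) ω M] in
theorem tameArrow_of_mem {a z : M} (hz : z ∈ tameNhd E a) : tameArrow E a z =
    (⟨a, z, tameClass E a hz⟩ : PathClasses (ContinuousMap.id M) (ContinuousMap.id M)) :=
  dif_pos hz

theorem contMDiffAt_tameArrow {a y : M} (hy : y ∈ tameNhd E a) :
    ContMDiffAt 𝓘(ℂ, E) 𝓘(ℂ, E × E) ω (tameArrow E a) y := by
  have hU : ∀ᶠ z in 𝓝 y, z ∈ tameNhd E a := (isTame_tameNhd E a).isOpen.mem_nhds hy
  refine PathManifold.contMDiffAt_of_endpoints ?_ ?_ ?_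
  · obtain ⟨O, hO, hyO, tO⟩ := exists_tame (E₁ := E) y
      (((isTame_tameNhd E a).isOpen.inter (isTame_tameNhd E y).isOpen).mem_nhds
        ⟨hy, mem_tameNhd E y⟩)
    filter_upwards [tO.isOpen.mem_nhds hyO] with z hz
    obtain ⟨δ, hδ⟩ := tO.joined y hyO z hz
    rw [tameArrow_of_mem hy, tameArrow_of_mem (hO hz).1]
    refine ⟨Path.refl a, δ, fun _ => mem_tameNhd E a, fun t => (hO (hδ t)).2, ?_⟩
    have e : (Path.Homotopic.Quotient.mk (Path.refl a)).symm =
        Path.Homotopic.Quotient.refl a := by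
      rw [← Path.Homotopic.Quotient.mk_symm, Path.refl_symm]
      rfl
    have e₂ : ((Path.Homotopic.Quotient.mk (Path.refl a)).map (ContinuousMap.id M)).symm.trans
        ((tameClass E a hy).trans
          ((Path.Homotopic.Quotient.mk δ).map (ContinuousMap.id M))) =
        tameClass E a (hO hz).1 := by
      rw [quotient_map_id, quotient_map_id]
      refine Eq.trans ?_ (tameClass_trans E hy (hO hz).1 δ fun t => (hO (hδ t)).1)
      exact (congrArg (fun g : Path.Homotopic.Quotient a a => g.trans
        ((tameClass E a hy).trans (Path.Homotopic.Quotient.mk δ))) e).trans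
          (Path.Homotopic.Quotient.refl_trans _)
    exact congrArg (fun g => (⟨a, z, g⟩ :
      PathClasses (ContinuousMap.id M) (ContinuousMap.id M))) e₂.symm
  · refine (contMDiffAt_const (c := a)).congr_of_eventuallyEq ?_
    filter_upwards [hU] with z hz
    rw [tameArrow_of_mem hz]
  · refine contMDiffAt_id.congr_of_eventuallyEq ?_
    filter_upwards [hU] with z hz
    rw [tameArrow_of_mem hz]
    rfl

open Classical in
/-- The frame near `a` obtained by letting short paths act on a basis of the fibre at `a`. -/
def transportFrame (a : M) : V.toHolBundle.TransportFrame V.act (tameNhd E a) (V.rk a) where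
  comb y := if hy : y ∈ tameNhd E a then V.act (tameClass E a hy) ∘ₗ V.frame a a else 0
  coeff y := if hy : y ∈ tameNhd E a then V.coord a a ∘ₗ V.act (tameClass E a hy).symm else 0
  isOpen := (isTame_tameNhd E a).isOpen
  coeff_comb y hy c := by
    simp [dif_pos hy, V.isAction.symm_act, V.coord_frame a a (V.mem_base a)]
  comb_coeff y hy c := by
    simp [dif_pos hy, V.isAction.act_symm, V.frame_coord a a (V.mem_base a)]
  holAt y hy c := by
    have h₀ := V.holomorphic_act (⟨a, y, tameClass E a hy⟩ :
      PathClasses (ContinuousMap.id M) (ContinuousMap.id M)) c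
    refine (h₀.comp_of_eq (contMDiffAt_tameArrow hy) (tameArrow_of_mem hy)).congr_of_eventuallyEq ?_
    filter_upwards [(isTame_tameNhd E a).isOpen.mem_nhds hy] with z hz
    have key : ∀ q : Pi₁ E M, q = (⟨a, z, tameClass E a hz⟩ : PathClasses _ _) →
        V.coord y z (V.act (tameClass E a hz) (V.frame a a c)) =
          V.coord y (PathClasses.tgt q)
            (V.act (PathClasses.cls q) (V.frame a (PathClasses.src q) c)) := by
      rintro _ rfl
      rfl
    refine Eq.trans ?_ (key _ (tameArrow_of_mem hz))
    rw [dif_pos hz]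
    rfl
  act_comb {y z} δ hδ c := by
    have hy : y ∈ tameNhd E a := by
      have := hδ 0
      rwa [δ.source] at this
    have hz : z ∈ tameNhd E a := by
      have := hδ 1
      rwa [δ.target] at this
    rw [dif_pos hy, dif_pos hz, ← tameClass_trans E hy hz δ hδ]
    exact (V.act_trans _ _ _).symm

theorem hasTransportFrames : V.toHolBundle.HasTransportFrames V.act := fun a =>
  ⟨_, _, V.transportFrame a, mem_tameNhd E a⟩

omit [IsManifold 𝓘(ℂ, E) ω M] in
theorem finiteDimensional_fib (x : M) : FiniteDimensional ℂ (V.Fib x) :=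
  Module.Finite.of_surjective (V.frame x x) fun e =>
    ⟨_, V.frame_coord x x (V.mem_base x) e⟩

/-- A morphism of representations is just an equivariant family of linear maps. -/
def homOfEquivariant {V W : Rep.{u, v, w} E M} (τ : ∀ x, V.Fib x →ₗ[ℂ] W.Fib x)
    (hτ : ∀ {x y : M} (g : Path.Homotopic.Quotient x y) e,
      τ y (V.act g e) = W.act g (τ x e)) : V ⟶ W :=
  (⟨⟨τ, HolBundle.isHolFamily_of_equivariant V.hasTransportFrames W.hasTransportFrames τ hτ⟩, hτ⟩ :
    Rep.Hom V W)

/-- An isomorphism of representations is just an equivariant family of linear isomorphisms. -/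
def isoOfEquivariant {V W : Rep.{u, v, w} E M} (τ : ∀ x, V.Fib x ≃ₗ[ℂ] W.Fib x)
    (hτ : ∀ {x y : M} (g : Path.Homotopic.Quotient x y) e,
      τ y (V.act g e) = W.act g (τ x e)) : V ≅ W where
  hom := homOfEquivariant (fun x => (τ x).toLinearMap) hτ
  inv := homOfEquivariant (fun x => (τ x).symm.toLinearMap) fun {x y} g e => by
    have := hτ g ((τ x).symm e)
    rw [(τ x).apply_symm_apply] at this
    exact (τ y).symm_apply_eq.2 this.symm
  hom_inv_id := by
    refine Rep.Hom.ext (funext fun x => LinearMap.ext fun e => ?_)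
    exact (τ x).symm_apply_apply e
  inv_hom_id := by
    refine Rep.Hom.ext (funext fun x => LinearMap.ext fun e => ?_)
    exact (τ x).apply_symm_apply e

end Rep

end Actions

/-! ### Parallel transport -/

section Transport

variable {E : Type u} [NormedAddCommGroup E] [NormedSpace ℂ E]
  {M : Type v} [TopologicalSpace M] [ChartedSpace E M] [IsManifold 𝓘(ℂ, E) ω M]

namespace FlatConn

variable (V : FlatConn.{u, v, w} E M)

/-- The étale space of the sheaf of flat sections: the total space of the bundle, with the
topology for which flat sections are local homeomorphisms. -/
@[ext] structure EtaleSpace where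
  /-- The base point. -/
  pt : M
  /-- The vector over it. -/
  vec : V.Fib pt

/-- A set is open if its preimage under every flat local section is open. -/
instance : TopologicalSpace V.EtaleSpace where
  IsOpen s := ∀ (U : Set M) (n : ℕ) (F : V.FlatFrame U n) (c : Fin n → ℂ),
    IsOpen {y | y ∈ U ∧ (⟨y, F.comb y c⟩ : V.EtaleSpace) ∈ s}
  isOpen_univ U n F c := by
    convert F.isOpen using 1
    ext y
    exact and_iff_left trivial
  isOpen_inter s t hs ht U n F c := by
    have := (hs U n F c).inter (ht U n F c)
    convert this using 1
    ext y
    exact ⟨fun h => ⟨⟨h.1, h.2.1⟩, h.1, h.2.2⟩, fun h => ⟨h.1.1, h.1.2, h.2.2⟩⟩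
  isOpen_sUnion S hS U n F c := by
    have := isOpen_biUnion fun s hs => hS s hs U n F c
    convert this using 1
    ext y
    rw [Set.mem_iUnion₂]
    exact ⟨fun ⟨h, s, hs, h'⟩ => ⟨s, hs, h, h'⟩, fun ⟨s, hs, h, h'⟩ => ⟨h, s, hs, h'⟩⟩

/-- The projection of the étale space. -/
def etaleProj (z : V.EtaleSpace) : M := z.1

variable {V}

theorem continuous_etaleProj : Continuous V.etaleProj :=
  ⟨fun _ hO _ _ F _ => F.isOpen.inter hO⟩

/-- The flat section with given coefficients is continuous as a section of the étale space. -/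
theorem FlatFrame.continuousOn_comb {U : Set M} {n : ℕ} (F : V.FlatFrame U n) (c : Fin n → ℂ) :
    ContinuousOn (fun y => (⟨y, F.comb y c⟩ : V.EtaleSpace)) U :=
  (continuousOn_open_iff F.isOpen).2 fun _ hs => hs U n F c

/-- The image of a flat section is open in the étale space. -/
theorem FlatFrame.isOpen_sheet {U : Set M} {n : ℕ} (F : V.FlatFrame U n) (c : Fin n → ℂ) :
    IsOpen {z : V.EtaleSpace | z.1 ∈ U ∧ F.coeff z.1 z.2 = c} := by
  intro U' n' F' c'
  rw [isOpen_iff_mem_nhds]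
  rintro y ⟨hy', hy, e⟩
  have h := F.eventually_coeff_eq hy (σ := fun z => F'.comb z c') <| by
    filter_upwards [F'.isOpen.mem_nhds hy'] with z hz
    exact ⟨(F'.holAt z hz c').diffAt, F'.cov_comb z hz c'⟩
  filter_upwards [h, F'.isOpen.mem_nhds hy', F.isOpen.mem_nhds hy] with z hz hz' hz''
  refine ⟨hz', hz'', ?_⟩
  change F.coeff z (F'.comb z c') = c
  rw [hz, F.coeff_comb z hz'']
  exact e

/-- Over the domain of a flat frame the étale space is the product with a discrete fibre. -/
def FlatFrame.etaleHomeomorph {U : Set M} {n : ℕ} (F : V.FlatFrame U n) {x : M} (hx : x ∈ U) :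
    letI : TopologicalSpace (V.Fib x) := ⊥
    V.etaleProj ⁻¹' U ≃ₜ U × V.Fib x :=
  letI : TopologicalSpace (V.Fib x) := ⊥
  haveI : DiscreteTopology (V.Fib x) := ⟨rfl⟩
  { toFun := fun z => (⟨z.1.1, z.2⟩, F.comb x (F.coeff z.1.1 z.1.2))
    invFun := fun z => ⟨⟨z.1, F.comb z.1 (F.coeff x z.2)⟩, z.1.2⟩
    left_inv := by
      rintro ⟨⟨y, e⟩, hy⟩
      refine Subtype.ext (EtaleSpace.ext rfl (heq_of_eq ?_))
      change F.comb y (F.coeff x (F.comb x (F.coeff y e))) = e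
      rw [F.coeff_comb x hx, F.comb_coeff y hy]
    right_inv := by
      rintro ⟨⟨y, hy⟩, e⟩
      refine Prod.ext rfl ?_
      change F.comb x (F.coeff y (F.comb y (F.coeff x e))) = e
      rw [F.coeff_comb y hy, F.comb_coeff x hx]
    continuous_toFun := by
      refine Continuous.prodMk
        ((continuous_etaleProj.comp continuous_subtype_val).subtype_mk _) ?_
      refine continuous_discrete_rng.2 fun e => ?_
      have := (F.isOpen_sheet (F.coeff x e)).preimage
        (continuous_subtype_val (p := fun z => z ∈ V.etaleProj ⁻¹' U))
      convert this using 1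
      ext ⟨⟨y, e'⟩, hy⟩
      change F.comb x (F.coeff y e') = e ↔ y ∈ U ∧ F.coeff y e' = F.coeff x e
      constructor
      · rintro rfl
        exact ⟨hy, (F.coeff_comb x hx _).symm⟩
      · rintro ⟨-, h⟩
        rw [h, F.comb_coeff x hx]
    continuous_invFun := by
      refine Continuous.subtype_mk (continuous_prod_of_discrete_right.2 fun e => ?_) _
      exact (F.continuousOn_comb (F.coeff x e)).comp_continuous continuous_subtype_val
        fun y => y.2 }

theorem isCoveringMap_etaleProj (hV : ∀ a : M, ∃ (U : Set M) (n : ℕ) (_ : V.FlatFrame U n), a ∈ U) :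
    IsCoveringMap V.etaleProj := by
  intro x
  obtain ⟨U, n, F, hx⟩ := hV x
  let _ : TopologicalSpace (V.Fib x) := ⊥
  have h : IsEvenlyCovered V.etaleProj x (V.Fib x) :=
    ⟨⟨rfl⟩, U, hx, F.isOpen, F.isOpen.preimage continuous_etaleProj,
      F.etaleHomeomorph hx, fun _ => rfl⟩
  exact h.to_isEvenlyCovered_preimage

theorem IsParallel.eventually_eq {δ : C(unitInterval, M)} {e : ∀ t, V.Fib (δ t)}
    (h : V.IsParallel δ e) {U : Set M} {n : ℕ} (F : V.FlatFrame U n) {t₀ : unitInterval}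
    (ht₀ : δ t₀ ∈ U) : ∀ᶠ t in 𝓝 t₀, e t = F.comb (δ t) (F.coeff (δ t₀) (e t₀)) := by
  obtain ⟨O, σ, hO, hxO, hσ, hσ', he⟩ := h t₀
  have h₁ := F.eventually_coeff_eq ht₀ (σ := σ) <| by
    filter_upwards [hO.mem_nhds hxO] with z hz using ⟨(hσ z hz).diffAt, hσ' z hz⟩
  filter_upwards [he, δ.continuous.continuousAt.eventually h₁] with t ht ht'
  rw [ht, ht', he.self_of_nhds]

theorem isParallel_of_frames {δ : C(unitInterval, M)} {e : ∀ t, V.Fib (δ t)}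
    (h : ∀ t₀, ∃ (U : Set M) (n : ℕ) (F : V.FlatFrame U n) (c : Fin n → ℂ), δ t₀ ∈ U ∧
      ∀ᶠ t in 𝓝 t₀, e t = F.comb (δ t) c) : V.IsParallel δ e := by
  intro t₀
  obtain ⟨U, n, F, c, hU, he⟩ := h t₀
  exact ⟨U, fun y => F.comb y c, F.isOpen, hU, fun y hy => F.holAt y hy c,
    fun y hy => F.cov_comb y hy c, he⟩

/-- A linear combination of parallel families is parallel. -/
theorem IsParallel.smul_add (hV : ∀ a : M, ∃ (U : Set M) (n : ℕ) (_ : V.FlatFrame U n), a ∈ U)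
    {δ : C(unitInterval, M)} {e e' : ∀ t, V.Fib (δ t)} (k : ℂ) (h : V.IsParallel δ e)
    (h' : V.IsParallel δ e') : V.IsParallel δ fun t => k • e t + e' t := by
  refine isParallel_of_frames fun t₀ => ?_
  obtain ⟨U, n, F, hU⟩ := hV (δ t₀)
  refine ⟨U, n, F, k • F.coeff _ (e t₀) + F.coeff _ (e' t₀), hU, ?_⟩
  filter_upwards [h.eventually_eq F hU, h'.eventually_eq F hU] with t ht ht'
  rw [map_add, map_smul, ht, ht']

/-- A parallel family is the same as a path in the étale space. -/
theorem IsParallel.continuous {δ : C(unitInterval, M)} {e : ∀ t, V.Fib (δ t)}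
    (hV : ∀ a : M, ∃ (U : Set M) (n : ℕ) (_ : V.FlatFrame U n), a ∈ U)
    (h : V.IsParallel δ e) : Continuous fun t => (⟨δ t, e t⟩ : V.EtaleSpace) := by
  refine continuous_iff_continuousAt.2 fun t₀ => ?_
  obtain ⟨U, n, F, hU⟩ := hV (δ t₀)
  refine (((F.continuousOn_comb (F.coeff _ (e t₀))).continuousAt
    (F.isOpen.mem_nhds hU)).comp δ.continuous.continuousAt).congr ?_
  filter_upwards [h.eventually_eq F hU] with t ht
  exact EtaleSpace.ext rfl (heq_of_eq ht.symm)

theorem isParallel_of_continuous {δ : C(unitInterval, M)} {e : ∀ t, V.Fib (δ t)}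
    (hV : ∀ a : M, ∃ (U : Set M) (n : ℕ) (_ : V.FlatFrame U n), a ∈ U)
    (h : Continuous fun t => (⟨δ t, e t⟩ : V.EtaleSpace)) : V.IsParallel δ e := by
  refine isParallel_of_frames fun t₀ => ?_
  obtain ⟨U, n, F, hU⟩ := hV (δ t₀)
  refine ⟨U, n, F, F.coeff _ (e t₀), hU, ?_⟩
  filter_upwards [h.continuousAt.eventually_mem
    ((F.isOpen_sheet (F.coeff _ (e t₀))).mem_nhds ⟨hU, rfl⟩)] with t ht
  rw [← F.comb_coeff (δ t) ht.1 (e t)]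
  exact congrArg _ ht.2

variable (hV : ∀ a : M, ∃ (U : Set M) (n : ℕ) (_ : V.FlatFrame U n), a ∈ U)

include hV in
/-- Every vector over the starting point of a path extends to a parallel family. -/
theorem exists_isParallel {x y : M} (δ : Path x y) (v : V.Fib x) :
    ∃ e : ∀ t, V.Fib (δ t), V.IsParallel δ.toContinuousMap e ∧
      (⟨δ 0, e 0⟩ : V.EtaleSpace) = ⟨x, v⟩ := by
  have cov := isCoveringMap_etaleProj hV
  have h₀ : δ.toContinuousMap 0 = V.etaleProj ⟨x, v⟩ := δ.source
  let Γ := cov.liftPath δ.toContinuousMap ⟨x, v⟩ h₀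
  have hΓ : ∀ t, (Γ t).1 = δ t := fun t => congrFun (cov.liftPath_lifts _ _ h₀) t
  have hΓ₀ : Γ 0 = ⟨x, v⟩ := cov.liftPath_zero _ _ h₀
  have key : ∀ t, (⟨δ t, hΓ t ▸ (Γ t).2⟩ : V.EtaleSpace) = Γ t := fun t =>
    EtaleSpace.ext (hΓ t).symm (eqRec_heq _ _)
  refine ⟨fun t => hΓ t ▸ (Γ t).2, isParallel_of_continuous hV ?_, (key 0).trans hΓ₀⟩
  exact Γ.continuous.congr fun t => (key t).symm

/-- Parallel transport, as a map: the monodromy of the étale space, which takes values in the fibre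
of the covering over `y` and is turned into a vector of `V.Fib y` by a cast. -/
def transportFun {x y : M} (g : Path.Homotopic.Quotient x y) (v : V.Fib x) : V.Fib y :=
  let w := (isCoveringMap_etaleProj hV).monodromy g ⟨(⟨x, v⟩ : V.EtaleSpace), rfl⟩
  (w.2 : w.1.1 = y) ▸ w.1.2

theorem mk_transportFun {x y : M} (g : Path.Homotopic.Quotient x y) (v : V.Fib x) :
    (⟨y, transportFun hV g v⟩ : V.EtaleSpace) =
      ((isCoveringMap_etaleProj hV).monodromy g ⟨(⟨x, v⟩ : V.EtaleSpace), rfl⟩).1 := by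
  let w := (isCoveringMap_etaleProj hV).monodromy g ⟨(⟨x, v⟩ : V.EtaleSpace), rfl⟩
  exact EtaleSpace.ext (w.2 : w.1.1 = y).symm (eqRec_heq _ _)

/-- Parallel transport is given by parallel families. -/
theorem transportFun_eq {x y : M} (δ : Path x y) {e : ∀ t, V.Fib (δ t)}
    (he : V.IsParallel δ.toContinuousMap e) {v : V.Fib x} {w : V.Fib y}
    (h₀ : (⟨δ 0, e 0⟩ : V.EtaleSpace) = ⟨x, v⟩) (h₁ : (⟨δ 1, e 1⟩ : V.EtaleSpace) = ⟨y, w⟩) :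
    transportFun hV (Path.Homotopic.Quotient.mk δ) v = w := by
  have cov := isCoveringMap_etaleProj hV
  let Γ : C(unitInterval, V.EtaleSpace) := ⟨_, IsParallel.continuous hV he⟩
  have hγ : δ.toContinuousMap 0 = V.etaleProj ⟨x, v⟩ := δ.source
  have h : Γ = cov.liftPath δ.toContinuousMap ⟨x, v⟩ hγ :=
    (cov.eq_liftPath_iff' hγ).2 ⟨rfl, h₀⟩
  have h₂ : (⟨y, transportFun hV (Path.Homotopic.Quotient.mk δ) v⟩ : V.EtaleSpace) = ⟨y, w⟩ :=
    (mk_transportFun hV _ v).trans ((congrArg (fun Γ : C(unitInterval, V.EtaleSpace) => Γ 1)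
      h.symm).trans h₁)
  exact eq_of_heq (EtaleSpace.mk.inj h₂).2

/-- Vectors over provably equal base points are compared as points of the étale space. The linear
operations are compatible with such equalities. -/
theorem etale_smul_add {x x' : M} {e e' : V.Fib x'} {v v' : V.Fib x} (k : ℂ)
    (h : (⟨x', e⟩ : V.EtaleSpace) = ⟨x, v⟩) (h' : (⟨x', e'⟩ : V.EtaleSpace) = ⟨x, v'⟩) :
    (⟨x', k • e + e'⟩ : V.EtaleSpace) = ⟨x, k • v + v'⟩ := by
  cases h
  cases h'
  rfl

include hV in
theorem exists_isParallel_to {x y : M} (δ : Path x y) (v : V.Fib x) :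
    ∃ e : ∀ t, V.Fib (δ t), V.IsParallel δ.toContinuousMap e ∧
      (⟨δ 0, e 0⟩ : V.EtaleSpace) = ⟨x, v⟩ ∧
      (⟨δ 1, e 1⟩ : V.EtaleSpace) = ⟨y, transportFun hV (Path.Homotopic.Quotient.mk δ) v⟩ := by
  obtain ⟨e, he, h₀⟩ := exists_isParallel hV δ v
  have h₁ : (⟨δ 1, e 1⟩ : V.EtaleSpace) = ⟨y, δ.target ▸ e 1⟩ :=
    EtaleSpace.ext δ.target (eqRec_heq _ _).symm
  refine ⟨e, he, h₀, ?_⟩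
  rw [transportFun_eq hV δ he h₀ h₁]
  exact h₁

/-- Parallel transport along a homotopy class of paths. -/
def transport {x y : M} (g : Path.Homotopic.Quotient x y) : V.Fib x →ₗ[ℂ] V.Fib y :=
  have key : ∀ (k : ℂ) (v v' : V.Fib x), transportFun hV g (k • v + v') =
      k • transportFun hV g v + transportFun hV g v' := by
    induction g using Path.Homotopic.Quotient.ind with | mk δ => ?_
    intro k v v'
    obtain ⟨e, he, h₀, h₁⟩ := exists_isParallel_to hV δ v
    obtain ⟨e', he', h₀', h₁'⟩ := exists_isParallel_to hV δ v'
    exact transportFun_eq hV δ (IsParallel.smul_add hV k he he') (etale_smul_add k h₀ h₀')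
      (etale_smul_add k h₁ h₁')
  { toFun := transportFun hV g
    map_add' := fun v v' => by simpa using key 1 v v'
    map_smul' := fun k v => by
      have h0 : transportFun hV g 0 = 0 := by simpa using key 1 0 0
      simpa [h0] using key k v 0 }

theorem isAction_transport : IsAction (Fib := V.Fib) (transport hV) where
  refl x e := by
    refine eq_of_heq (EtaleSpace.mk.inj ((mk_transportFun hV _ e).trans ?_)).2
    rw [IsCoveringMap.monodromy_refl]
    rfl
  trans {x y z} g h e := by
    refine eq_of_heq (EtaleSpace.mk.inj ((mk_transportFun hV _ e).trans ?_)).2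
    rw [IsCoveringMap.monodromy_trans_apply]
    have e₁ : (isCoveringMap_etaleProj hV).monodromy g ⟨(⟨x, e⟩ : V.EtaleSpace), rfl⟩ =
      ⟨(⟨y, transportFun hV g e⟩ : V.EtaleSpace), rfl⟩ := Subtype.ext (mk_transportFun hV g e).symm
    rw [e₁]
    exact (mk_transportFun hV h _).symm

/-- Flat frames are preserved by parallel transport. -/
def FlatFrame.transportFrame {U : Set M} {n : ℕ} (F : V.FlatFrame U n) :
    V.toHolBundle.TransportFrame (transport hV) U n where
  toFrame := F.toFrame
  act_comb {y z} δ hδ c := transportFun_eq hV δ (e := fun t => F.comb (δ t) c)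
    (isParallel_of_frames fun t => ⟨U, n, F, c, hδ t, Filter.Eventually.of_forall fun _ => rfl⟩)
    (by
      have : ∀ y', y' = y → (⟨y', F.comb y' c⟩ : V.EtaleSpace) = ⟨y, F.comb y c⟩ := by
        rintro _ rfl
        rfl
      exact this _ δ.source)
    (by
      have : ∀ z', z' = z → (⟨z', F.comb z' c⟩ : V.EtaleSpace) = ⟨z, F.comb z c⟩ := by
        rintro _ rfl
        rfl
      exact this _ δ.target)

theorem hasTransportFrames : V.toHolBundle.HasTransportFrames (transport hV) := fun a =>
  let ⟨U, n, F, hU⟩ := hV a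
  ⟨U, n, F.transportFrame hV, hU⟩

end FlatConn

end Transport

/-! ### The Riemann–Hilbert correspondence -/

section RiemannHilbertFunctor

variable {E : Type u} [NormedAddCommGroup E] [NormedSpace ℂ E]
  {M : Type v} [TopologicalSpace M] [ChartedSpace E M] [IsManifold 𝓘(ℂ, E) ω M]

namespace FlatConn

/-- The model space is assumed to be finite-dimensional only if `M` has a point: the model space of
the fibres of a submersion from an empty manifold is arbitrary. -/
theorem exists_flatFrame' (hE : M → FiniteDimensional ℂ E) (V : FlatConn.{u, v, w} E M) (a : M) :
    ∃ (U : Set M) (n : ℕ) (_ : V.FlatFrame U n), a ∈ U :=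
  have := hE a
  V.exists_flatFrame a

variable (hE : M → FiniteDimensional ℂ E)

/-- The representation of the fundamental groupoid given by parallel transport. -/
def toRep (V : FlatConn.{u, v, w} E M) : Rep.{u, v, w} E M where
  toHolBundle := V.toHolBundle
  act := transport (V.exists_flatFrame' hE)
  act_refl := (isAction_transport _).refl
  act_trans := (isAction_transport _).trans
  holomorphic_act := HolBundle.isHolFamily_pathManifold
    (hasTransportFrames (V.exists_flatFrame' hE)) (hasTransportFrames (V.exists_flatFrame' hE))
    (fun g : PathManifold E E (ContinuousMap.id M) (ContinuousMap.id M) =>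
      transport (V.exists_flatFrame' hE) (PathClasses.cls g)) (isAction_transport _).act_move

theorem Hom.isParallel {V W : FlatConn.{u, v, w} E M} (T : V.Hom W) {δ : C(unitInterval, M)}
    {e : ∀ t, V.Fib (δ t)} (h : V.IsParallel δ e) :
    W.IsParallel δ fun t => T.toFun (δ t) (e t) := by
  intro t₀
  obtain ⟨U, σ, hU, hx, h₁, h₂, he⟩ := h t₀
  refine ⟨U, fun x => T.toFun x (σ x), hU, hx, fun x hx => T.toHom.holAt (h₁ x hx),
    fun x hx => ?_, he.mono fun t ht => congrArg _ ht⟩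
  ext ξ
  rw [← T.comm σ x (h₁ x hx).diffAt ξ, h₂ x hx]
  simp

theorem etale_map {V W : FlatConn.{u, v, w} E M} (τ : ∀ x, V.Fib x →ₗ[ℂ] W.Fib x) {x x' : M}
    {e : V.Fib x'} {e' : V.Fib x} (h : (⟨x', e⟩ : V.EtaleSpace) = ⟨x, e'⟩) :
    (⟨x', τ x' e⟩ : W.EtaleSpace) = ⟨x, τ x e'⟩ := by
  cases h
  rfl

theorem Hom.equivariant {V W : FlatConn.{u, v, w} E M} (T : V.Hom W) {x y : M}
    (g : Path.Homotopic.Quotient x y) (e : V.Fib x) :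
    T.toFun y ((V.toRep hE).act g e) = (W.toRep hE).act g (T.toFun x e) := by
  induction g using Path.Homotopic.Quotient.ind with | mk δ => ?_
  obtain ⟨e', he, h₀, h₁⟩ := exists_isParallel_to (V.exists_flatFrame' hE) δ e
  exact (transportFun_eq (W.exists_flatFrame' hE) δ (T.isParallel he) (etale_map T.toFun h₀)
    (etale_map T.toFun h₁)).symm

/-- The Riemann–Hilbert functor: parallel transport. -/
def riemannHilbert : FlatConn.{u, v, w} E M ⥤ Rep.{u, v, w} E M where
  obj V := V.toRep hE
  map {V W} T := (⟨(T : V.Hom W).toHom, (T : V.Hom W).equivariant hE⟩ :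
    Rep.Hom (V.toRep hE) (W.toRep hE))

omit [IsManifold 𝓘(ℂ, E) ω M] in
theorem isHolFamily_id (V : HolBundle.{u, v, w} E M) :
    IsHolFamily E (Q := M) V V id id fun _ => LinearMap.id :=
  (HolBundle.Hom.id V).holomorphic

/-- The functor `riemannHilbert` is the one of the Riemann–Hilbert correspondence. -/
def isRiemannHilbert : RiemannHilbert (riemannHilbert.{u, v, w} hE) where
  iso V x := LinearEquiv.refl ℂ (V.Fib x)
  holomorphic V := isHolFamily_id V.toHolBundle
  natural _ _ _ := rfl
  transport V δ _ he := transportFun_eq (V.exists_flatFrame' hE) ⟨δ, rfl, rfl⟩ he rfl rfl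

/-- Equivariant bundle maps commute with the connections: with respect to flat frames their
matrices are locally constant. -/
theorem comm_of_equivariant {V W : FlatConn.{u, v, w} E M}
    (T : Rep.Hom (V.toRep hE) (W.toRep hE)) (σ : ∀ x, V.Fib x) (x : M) (hσ : V.DiffAt σ x)
    (ξ : TangentSpace 𝓘(ℂ, E) x) :
    T.toFun x (V.cov σ x ξ) = W.cov (fun y => T.toFun y (σ y)) x ξ := by
  obtain ⟨U, n, F, hU⟩ := V.exists_flatFrame' hE x
  obtain ⟨U', n', G, hU'⟩ := W.exists_flatFrame' hE x
  let m : (Fin n → ℂ) →L[ℂ] (Fin n' → ℂ) :=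
    LinearMap.toContinuousLinearMap (G.coeff x ∘ₗ T.toFun x ∘ₗ F.comb x)
  have hm : ∀ᶠ y in 𝓝 x, ∀ c, T.toFun y (F.comb y c) = G.comb y (m c) := by
    obtain ⟨O, hO, hxO, tO⟩ := exists_tame (E₁ := E) x
      ((F.isOpen.inter G.isOpen).mem_nhds ⟨hU, hU'⟩)
    filter_upwards [tO.isOpen.mem_nhds hxO] with y hy c
    obtain ⟨δ, hδ⟩ := tO.joined x hxO y hy
    have h₁ := (F.transportFrame (V.exists_flatFrame' hE)).act_comb δ (fun t => (hO (hδ t)).1) c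
    have h₂ := (G.transportFrame (W.exists_flatFrame' hE)).act_comb δ (fun t => (hO (hδ t)).2)
      (m c)
    have h₃ := T.equivariant (Path.Homotopic.Quotient.mk δ) (F.comb x c)
    have h₄ : G.comb x (m c) = T.toFun x (F.comb x c) := G.comb_coeff x hU' _
    refine (congrArg (T.toFun y) h₁).symm.trans (h₃.trans ?_)
    rw [← h₄]
    exact h₂
  have hTσ : W.DiffAt (fun y => T.toFun y (σ y)) x := T.toHom.diffAt hσ
  have hs := (F.diffAt_iff hU).1 hσ
  have e₁ : (fun z => G.coeff z (T.toFun z (σ z))) =ᶠ[𝓝 x] m ∘ fun z => F.coeff z (σ z) := by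
    filter_upwards [hm, F.isOpen.mem_nhds hU, G.isOpen.mem_nhds hU'] with y hy hyU hyU'
    have h := hy (F.coeff y (σ y))
    rw [F.comb_coeff y hyU] at h
    rw [h]
    exact G.coeff_comb y hyU' _
  have e₂ : mvfderiv 𝓘(ℂ, E) (fun z => G.coeff z (T.toFun z (σ z))) x ξ =
      m (mvfderiv 𝓘(ℂ, E) (fun z => F.coeff z (σ z)) x ξ) := by
    have h₁ := mfderiv_comp x (I'' := 𝓘(ℂ, Fin n' → ℂ)) m.mdifferentiableAt hs
    rw [ContinuousLinearMap.mfderiv_eq] at h₁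
    have h₂ := e₁.mfderiv_eq (I := 𝓘(ℂ, E)) (I' := 𝓘(ℂ, Fin n' → ℂ))
    exact congrArg (fun T => T ξ) (h₂.trans h₁)
  rw [F.cov_eq hU hσ]
  refine Eq.trans ?_ (G.cov_eq hU' hTσ ξ).symm
  rw [e₂]
  exact hm.self_of_nhds _

end FlatConn

namespace Rep

variable (hE : M → FiniteDimensional ℂ E) (V : Rep.{u, v, w} E M)

/-- The covariant derivative for which the frames obtained by letting short paths act are flat. At
the point `x` it is computed in the frame centred at `x`. -/
def cov (σ : ∀ x, V.Fib x) (x : M) : TangentSpace 𝓘(ℂ, E) x →ₗ[ℂ] V.Fib x :=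
  (V.transportFrame x).comb x ∘ₗ
    (mvfderiv 𝓘(ℂ, E) (fun z => (V.transportFrame x).coeff z (σ z)) x).toLinearMap

/-- The connection may be computed in any frame preserved by the action. -/
theorem cov_apply {U : Set M} {n : ℕ} (G : V.toHolBundle.TransportFrame V.act U n) {x : M}
    (hx : x ∈ U) {σ : ∀ x, V.Fib x} (hσ : V.DiffAt σ x) (ξ : TangentSpace 𝓘(ℂ, E) x) :
    V.cov σ x ξ = G.comb x (mvfderiv 𝓘(ℂ, E) (fun z => G.coeff z (σ z)) x ξ) := by
  let F := V.transportFrame x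
  have hxF : x ∈ tameNhd E x := mem_tameNhd E x
  let m : (Fin _ → ℂ) →L[ℂ] (Fin n → ℂ) := LinearMap.toContinuousLinearMap (G.coeff x ∘ₗ F.comb x)
  have hm : ∀ᶠ y in 𝓝 x, ∀ c, F.comb y c = G.comb y (m c) := by
    obtain ⟨O, hO, hxO, tO⟩ := exists_tame (E₁ := E) x
      ((F.isOpen.inter G.isOpen).mem_nhds ⟨hxF, hx⟩)
    filter_upwards [tO.isOpen.mem_nhds hxO] with y hy c
    obtain ⟨δ, hδ⟩ := tO.joined x hxO y hy
    have h₁ := F.act_comb δ (fun t => (hO (hδ t)).1) c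
    have h₂ := G.act_comb δ (fun t => (hO (hδ t)).2) (m c)
    have h₄ : G.comb x (m c) = F.comb x c := G.comb_coeff x hx _
    rw [← h₁, ← h₂, h₄]
  have hs := (F.diffAt_iff hxF).1 hσ
  have e₁ : (fun z => G.coeff z (σ z)) =ᶠ[𝓝 x] m ∘ fun z => F.coeff z (σ z) := by
    filter_upwards [hm, F.isOpen.mem_nhds hxF, G.isOpen.mem_nhds hx] with y hy hyU hyU'
    have h := hy (F.coeff y (σ y))
    rw [F.comb_coeff y hyU] at h
    conv_lhs => rw [h]
    exact G.coeff_comb y hyU' _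
  have e₂ : mvfderiv 𝓘(ℂ, E) (fun z => G.coeff z (σ z)) x ξ =
      m (mvfderiv 𝓘(ℂ, E) (fun z => F.coeff z (σ z)) x ξ) := by
    have h₁ := mfderiv_comp x (I'' := 𝓘(ℂ, Fin n → ℂ)) m.mdifferentiableAt hs
    rw [ContinuousLinearMap.mfderiv_eq] at h₁
    have h₂ := e₁.mfderiv_eq (I := 𝓘(ℂ, E)) (I' := 𝓘(ℂ, Fin n → ℂ))
    exact congrArg (fun T => T ξ) (h₂.trans h₁)
  rw [e₂]
  exact hm.self_of_nhds _

theorem coeff_cov {U : Set M} {n : ℕ} (G : V.toHolBundle.TransportFrame V.act U n) {x : M}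
    (hx : x ∈ U) {σ : ∀ x, V.Fib x} (hσ : V.DiffAt σ x) (ξ : TangentSpace 𝓘(ℂ, E) x) :
    G.coeff x (V.cov σ x ξ) = mvfderiv 𝓘(ℂ, E) (fun z => G.coeff z (σ z)) x ξ := by
  rw [V.cov_apply G hx hσ, G.coeff_comb x hx]

theorem holAt_cov {U : Set M} (hU : IsOpen U) {ξ : ∀ x, TangentSpace 𝓘(ℂ, E) x}
    {σ : ∀ x, V.Fib x} (hξ : ContMDiffOn 𝓘(ℂ, E) 𝓘(ℂ, E).tangent ω
      (fun x => (⟨x, ξ x⟩ : TangentBundle 𝓘(ℂ, E) M)) U) (hσ : ∀ x ∈ U, V.HolAt σ x) {x : M}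
    (hx : x ∈ U) : V.HolAt (fun y => V.cov σ y (ξ y)) x := by
  let F := V.transportFrame x
  have hxF : x ∈ tameNhd E x := mem_tameNhd E x
  refine (F.holAt_iff hxF).2 ?_
  refine (contMDiffAt_mvfderiv_apply ((F.holAt_iff hxF).1 (hσ x hx))
    (hξ.contMDiffAt (hU.mem_nhds hx))).congr_of_eventuallyEq ?_
  filter_upwards [hU.mem_nhds hx, F.isOpen.mem_nhds hxF] with y hy hyF
  exact V.coeff_cov F hyF (hσ y hy).diffAt (ξ y)

theorem coeff_cov_cov {U : Set M} (hU : IsOpen U) {η : ∀ x, TangentSpace 𝓘(ℂ, E) x}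
    {σ : ∀ x, V.Fib x} (hη : ContMDiffOn 𝓘(ℂ, E) 𝓘(ℂ, E).tangent ω
      (fun x => (⟨x, η x⟩ : TangentBundle 𝓘(ℂ, E) M)) U) (hσ : ∀ x ∈ U, V.HolAt σ x) {x : M}
    (hx : x ∈ U) (ξ : TangentSpace 𝓘(ℂ, E) x) :
    (V.transportFrame x).coeff x (V.cov (fun y => V.cov σ y (η y)) x ξ) =
      mvfderiv 𝓘(ℂ, E) (fun y => mvfderiv 𝓘(ℂ, E)
        (fun z => (V.transportFrame x).coeff z (σ z)) y (η y)) x ξ := by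
  let F := V.transportFrame x
  have hxF : x ∈ tameNhd E x := mem_tameNhd E x
  rw [V.coeff_cov F hxF (V.holAt_cov hU hη hσ hx).diffAt ξ]
  have e : (fun z => F.coeff z (V.cov σ z (η z))) =ᶠ[𝓝 x]
      fun y => mvfderiv 𝓘(ℂ, E) (fun z => F.coeff z (σ z)) y (η y) := by
    filter_upwards [hU.mem_nhds hx, F.isOpen.mem_nhds hxF] with y hy hyF
    exact V.coeff_cov F hyF (hσ y hy).diffAt (η y)
  exact congrArg (fun T => T ξ) (e.mfderiv_eq (I := 𝓘(ℂ, E)) (I' := 𝓘(ℂ, Fin (V.rk x) → ℂ)))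

/-- The flat connection underlying a representation of the fundamental groupoid. -/
def toFlatConn (hE : M → FiniteDimensional ℂ E) (V : Rep.{u, v, w} E M) :
    FlatConn.{u, v, w} E M where
  toHolBundle := V.toHolBundle
  cov := V.cov
  add σ σ' x hσ hσ' := by
    let F := V.transportFrame x
    have hxF : x ∈ tameNhd E x := mem_tameNhd E x
    ext ξ
    change F.comb x (mvfderiv 𝓘(ℂ, E) (fun z => F.coeff z ((σ + σ') z)) x ξ) =
      F.comb x (mvfderiv 𝓘(ℂ, E) (fun z => F.coeff z (σ z)) x ξ) +
      F.comb x (mvfderiv 𝓘(ℂ, E) (fun z => F.coeff z (σ' z)) x ξ)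
    have h := mvfderiv_add ((F.diffAt_iff hxF).1 hσ) ((F.diffAt_iff hxF).1 hσ')
    have e : (fun z => F.coeff z ((σ + σ') z)) =
        (fun z => F.coeff z (σ z)) + fun z => F.coeff z (σ' z) :=
      funext fun z => map_add (F.coeff z) _ _
    rw [e, h, ← map_add]
    rfl
  leibniz f σ x hf hσ ξ := by
    let F := V.transportFrame x
    have hxF : x ∈ tameNhd E x := mem_tameNhd E x
    change F.comb x (mvfderiv 𝓘(ℂ, E) (fun z => F.coeff z (f z • σ z)) x ξ) =
      f x • F.comb x (mvfderiv 𝓘(ℂ, E) (fun z => F.coeff z (σ z)) x ξ) + _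
    have h := mvfderiv_smul hf ((F.diffAt_iff hxF).1 hσ)
    have e : (fun z => F.coeff z (f z • σ z)) = f • fun z => F.coeff z (σ z) :=
      funext fun z => map_smul (F.coeff z) _ _
    have h' := congrArg (fun T => F.comb x (T ξ)) h
    rw [e]
    refine h'.trans ?_
    change F.comb x (f x • mvfderiv 𝓘(ℂ, E) (fun z => F.coeff z (σ z)) x ξ +
      mvfderiv 𝓘(ℂ, E) f x ξ • F.coeff x (σ x)) = _
    rw [map_add, map_smul, map_smul, F.comb_coeff x hxF]
  holomorphic_cov U ξ σ hU hξ hσ x hx := V.holAt_cov hU hξ hσ hx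
  flat U ξ η σ hU hξ hη hσ x hx := by
    have := hE x
    have : CompleteSpace E := FiniteDimensional.complete ℂ E
    let F := V.transportFrame x
    have hxF : x ∈ tameNhd E x := mem_tameNhd E x
    have h : F.coeff x (V.cov (fun y => V.cov σ y (η y)) x (ξ x) -
        V.cov (fun y => V.cov σ y (ξ y)) x (η x) -
        V.cov σ x (VectorField.mlieBracket 𝓘(ℂ, E) ξ η x)) = 0 := by
      rw [map_sub, map_sub, V.coeff_cov_cov hU hη hσ hx, V.coeff_cov_cov hU hξ hσ hx,
        V.coeff_cov F hxF (hσ x hx).diffAt,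
        mvfderiv_mlieBracket ((F.holAt_iff hxF).1 (hσ x hx)) (hξ.contMDiffAt (hU.mem_nhds hx))
          (hη.contMDiffAt (hU.mem_nhds hx)), sub_self]
    rw [← F.comb_coeff x hxF (V.cov (fun y => V.cov σ y (η y)) x (ξ x) -
        V.cov (fun y => V.cov σ y (ξ y)) x (η x) -
        V.cov σ x (VectorField.mlieBracket 𝓘(ℂ, E) ξ η x)), h, map_zero]

/-- A frame preserved by the action is flat. -/
def flatFrame (a : M) : (V.toFlatConn hE).FlatFrame (tameNhd E a) (V.rk a) where
  toFrame := (V.transportFrame a).toFrame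
  cov_comb y hy c := by
    let F := V.transportFrame a
    ext ξ
    refine (V.cov_apply F hy (F.holAt y hy c).diffAt ξ).trans ?_
    have e : (fun z => F.coeff z (F.comb z c)) =ᶠ[𝓝 y] fun _ => c := by
      filter_upwards [F.isOpen.mem_nhds hy] with z hz using F.coeff_comb z hz c
    have h := e.mfderiv_eq (I := 𝓘(ℂ, E)) (I' := 𝓘(ℂ, Fin (V.rk a) → ℂ))
    rw [mfderiv_const] at h
    exact (congrArg (fun T => F.comb y (T ξ)) h).trans (map_zero _)

variable {V} in
theorem etale_act {x y x' y' : M} (δ : Path x y) (hx : x' = x) (hy : y' = y) {f : V.Fib x'}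
    {e : V.Fib x} (h : (⟨x', f⟩ : (V.toFlatConn hE).EtaleSpace) = ⟨x, e⟩) :
    (⟨y', V.act (Path.Homotopic.Quotient.mk (δ.cast hx hy)) f⟩ : (V.toFlatConn hE).EtaleSpace) =
      ⟨y, V.act (Path.Homotopic.Quotient.mk δ) e⟩ := by
  subst hx hy
  cases h
  rfl

/-- The parallel transport of `V.toFlatConn` is the action of `V`: the vectors obtained from a
given one by the action of the initial segments of a path form a parallel family. -/
theorem transport_toFlatConn {x y : M} (g : Path.Homotopic.Quotient x y) (e : V.Fib x) :
    ((V.toFlatConn hE).toRep hE).act g e = V.act g e := by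
  induction g using Path.Homotopic.Quotient.ind with | mk δ => ?_
  obtain ⟨e₀, he₀⟩ : ∃ e₀ : V.Fib (δ 0),
      (⟨δ 0, e₀⟩ : (V.toFlatConn hE).EtaleSpace) = ⟨x, e⟩ :=
    ⟨δ.source.symm ▸ e, FlatConn.EtaleSpace.ext δ.source (eqRec_heq _ _)⟩
  let f : ∀ t, V.Fib (δ t) := fun t =>
    V.act (Path.Homotopic.Quotient.mk (δ.subpath 0 t)) e₀
  have hf : ∀ s t, f t = V.act (Path.Homotopic.Quotient.mk (δ.subpath s t)) (f s) := by
    intro s t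
    change _ = V.act _ (V.act _ _)
    rw [← V.act_trans, ← Path.Homotopic.Quotient.mk_trans]
    exact congrArg (fun g => V.act g e₀)
      (Path.Homotopic.Quotient.eq.2 ⟨(Path.Homotopy.subpathTransSubpath δ 0 s t).symm⟩)
  have hf₀ : f 0 = e₀ := by
    change V.act (Path.Homotopic.Quotient.mk (δ.subpath 0 0)) e₀ = e₀
    rw [Path.subpath_self]
    exact V.act_refl _ _
  have hpar : (V.toFlatConn hE).IsParallel δ.toContinuousMap f := by
    refine FlatConn.isParallel_of_frames fun t₀ => ?_
    have ht₀ : δ t₀ ∈ tameNhd E (δ t₀) := mem_tameNhd E _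
    let F := V.transportFrame (δ t₀)
    refine ⟨_, _, V.flatFrame hE (δ t₀), F.coeff (δ t₀) (f t₀), ht₀, ?_⟩
    have h₁ : Filter.Tendsto (fun t => Set.uIcc t₀ t) (𝓝 t₀) (𝓝 t₀).smallSets :=
      Filter.Tendsto.uIcc tendsto_const_nhds Filter.tendsto_id
    filter_upwards [Filter.tendsto_smallSets_iff.1 h₁ _
      (δ.continuous.continuousAt.preimage_mem_nhds (F.isOpen.mem_nhds ht₀))] with t ht
    have h₂ := F.act_comb (δ.subpath t₀ t) (fun s => by
      have h := Set.mem_range_self (f := δ.subpath t₀ t) s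
      rw [Path.range_subpath] at h
      obtain ⟨r, hr, e⟩ := h
      rw [← e]
      exact ht hr) (F.coeff (δ t₀) (f t₀))
    rw [F.comb_coeff _ ht₀, ← hf t₀ t] at h₂
    exact h₂
  refine FlatConn.transportFun_eq ((V.toFlatConn hE).exists_flatFrame' hE) δ hpar
    ((congrArg (FlatConn.EtaleSpace.mk (V := V.toFlatConn hE) (δ 0)) hf₀).trans he₀) ?_
  refine Eq.trans (congrArg (FlatConn.EtaleSpace.mk (V := V.toFlatConn hE) (δ 1)) ?_)
    (etale_act hE δ δ.source δ.target he₀)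
  exact congrArg (fun p => V.act (Path.Homotopic.Quotient.mk p) e₀) δ.subpath_zero_one

end Rep

namespace FlatConn

/-- The Riemann–Hilbert correspondence: a representation `V` is isomorphic to the one given by the
parallel transport of `V.toFlatConn`. -/
instance isEquivalence_riemannHilbert (hE : M → FiniteDimensional ℂ E) :
    (riemannHilbert.{u, v, w} (M := M) hE).IsEquivalence where
  faithful := ⟨fun {V W S T} h => by
    have h' := congrArg (fun T : Rep.Hom _ _ => T.toHom) h
    exact Hom.ext (congrArg HolBundle.Hom.toFun h')⟩
  full := ⟨fun {V W} T => ⟨(⟨(T : Rep.Hom _ _).toHom, fun σ x hσ ξ =>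
    comm_of_equivariant hE T σ x hσ ξ⟩ : V.Hom W), rfl⟩⟩
  essSurj := ⟨fun V => ⟨V.toFlatConn hE, ⟨Rep.isoOfEquivariant
    (V := (V.toFlatConn hE).toRep hE) (fun x => LinearEquiv.refl ℂ (V.Fib x))
    (V.transport_toFlatConn hE)⟩⟩⟩

end FlatConn

/-- Any two functors which are given by parallel transport up to isomorphism are isomorphic: the
isomorphisms are equivariant because every vector over the starting point of a path extends to a
parallel family. -/
theorem RiemannHilbert.nonempty_iso (hE : M → FiniteDimensional ℂ E)
    {R R' : FlatConn.{u, v, w} E M ⥤ Rep.{u, v, w} E M} (r : RiemannHilbert R)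
    (r' : RiemannHilbert R') : Nonempty (R ≅ R') := by
  have key : ∀ {R : FlatConn.{u, v, w} E M ⥤ Rep.{u, v, w} E M} (r : RiemannHilbert R) (V)
      {x y : M} (g : Path.Homotopic.Quotient x y) (e : V.Fib x),
      (R.obj V).act g (r.iso V x e) =
        r.iso V y (FlatConn.transport (V.exists_flatFrame' hE) g e) := by
    intro R r V x y g e
    induction g using Path.Homotopic.Quotient.ind with | mk δ => ?_
    obtain ⟨f, hf, h₀, h₁⟩ := FlatConn.exists_isParallel_to (V.exists_flatFrame' hE) δ e
    have h := r.transport V δ.toContinuousMap f hf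
    -- the end points of `δ` are only propositionally equal to `x` and `y`
    have gen : ∀ {x' y' : M} (hx : x' = x) (hy : y' = y) (f₀ : V.Fib x') (f₁ : V.Fib y')
        (e' : V.Fib y), (⟨x', f₀⟩ : V.EtaleSpace) = ⟨x, e⟩ → (⟨y', f₁⟩ : V.EtaleSpace) = ⟨y, e'⟩ →
        (R.obj V).act (Path.Homotopic.Quotient.mk (δ.cast hx hy)) (r.iso V x' f₀) =
          r.iso V y' f₁ →
        (R.obj V).act (Path.Homotopic.Quotient.mk δ) (r.iso V x e) = r.iso V y e' := by
      rintro x' y' rfl rfl f₀ f₁ e' h₀ h₁ h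
      cases h₀
      cases h₁
      exact h
    exact gen δ.source δ.target _ _ _ h₀ h₁ h
  let τ : ∀ V x, (R.obj V).Fib x ≃ₗ[ℂ] (R'.obj V).Fib x := fun V x =>
    (r.iso V x).symm.trans (r'.iso V x)
  have hτ : ∀ V {x y : M} (g : Path.Homotopic.Quotient x y) (e : (R.obj V).Fib x),
      τ V y ((R.obj V).act g e) = (R'.obj V).act g (τ V x e) := by
    intro V x y g e
    obtain ⟨e, rfl⟩ := (r.iso V x).surjective e
    change r'.iso V y ((r.iso V y).symm ((R.obj V).act g (r.iso V x e))) =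
      (R'.obj V).act g (r'.iso V x ((r.iso V x).symm (r.iso V x e)))
    rw [key r, LinearEquiv.symm_apply_apply, LinearEquiv.symm_apply_apply, key r']
  refine ⟨NatIso.ofComponents (fun V => Rep.isoOfEquivariant (τ V) (hτ V)) fun {V W} T => ?_⟩
  refine Rep.Hom.ext (funext fun x => LinearMap.ext fun e => ?_)
  obtain ⟨e, rfl⟩ := (r.iso V x).surjective e
  change r'.iso W x ((r.iso W x).symm ((R.map T).toFun x (r.iso V x e))) =
    (R'.map T).toFun x (r'.iso V x ((r.iso V x).symm (r.iso V x e)))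
  rw [← r.natural, LinearEquiv.symm_apply_apply, LinearEquiv.symm_apply_apply, ← r'.natural]

end RiemannHilbertFunctor

/-! ### Relative lifting in Serre fibrations -/

section CornerLifting

open unitInterval

/-- The map `r ↦ min (max r 0) 1`. -/
def clampI (r : ℝ) : I := Set.projIcc 0 1 zero_le_one r

@[fun_prop] theorem continuous_clampI : Continuous clampI :=
  continuous_projIcc (h := zero_le_one)

theorem clampI_coe (t : I) : clampI t = t := Set.projIcc_val zero_le_one t

variable {Y D : Type*} [TopologicalSpace Y] [TopologicalSpace D] {π : Y → D}

/-- Serre fibrations have the lifting property for cubes relative to the union of the faces where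
some coordinate vanishes. The cube retracts onto this union along the diagonal direction, and the
homotopy lifting property is applied to the family of the segments in this direction. -/
theorem IsSerreFibration.exists_corner_lift (hπ : IsSerreFibration π) {n : ℕ} (hn : 0 < n)
    (G : C(Fin n → I, D)) (f : Fin n → C(Fin n → I, Y))
    (hf : ∀ i z, z i = 0 → π (f i z) = G z)
    (hcomp : ∀ i j z, z i = 0 → z j = 0 → f i z = f j z) :
    ∃ L : C(Fin n → I, Y), (∀ z, π (L z) = G z) ∧ ∀ i z, z i = 0 → L z = f i z := by
  have : Nonempty (Fin n) := ⟨⟨0, hn⟩⟩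
  let m : (Fin n → I) → I := fun z => Finset.univ.inf z
  have hm : Continuous m := Continuous.finset_inf_apply fun i _ => continuous_apply i
  have hm' : ∀ z, ∃ i, z i = m z := fun z => by
    obtain ⟨i, -, hi⟩ := Finset.exists_mem_eq_inf Finset.univ Finset.univ_nonempty z
    exact ⟨i, hi.symm⟩
  have hm0 : ∀ z i, z i = 0 → m z = 0 := fun z i hi =>
    le_antisymm (hi ▸ Finset.inf_le (Finset.mem_univ i)) (unitInterval.nonneg _)
  let h : (Fin n → I) × I → (Fin n → I) := fun q i => clampI (q.1 i - m q.1 + q.2)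
  have hh : Continuous h := by
    refine continuous_pi fun i => continuous_clampI.comp ?_
    have h₁ : Continuous fun q : (Fin n → I) × I => ((m q.1 : I) : ℝ) :=
      continuous_subtype_val.comp (hm.comp continuous_fst)
    fun_prop
  have hdiag : ∀ z, h (z, m z) = z := fun z => funext fun i => by
    simp [h, clampI_coe]
  have hr0 : ∀ z i, z i = m z → h (z, 0) i = 0 := fun z i hi => by
    simp [h, hi, clampI]
  choose ι hι using hm'
  have hcov : Continuous fun z => f (ι z) (h (z, 0)) := by
    refine (locallyFinite_of_finite fun i => {z : Fin n → I | z i = m z}).continuous ?_ ?_ ?_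
    · exact Set.iUnion_eq_univ_iff.2 fun z => ⟨ι z, hι z⟩
    · exact fun i => isClosed_eq (continuous_apply i) hm
    · intro i
      refine ((f i).continuous.comp (hh.comp (Continuous.prodMk_left 0))).continuousOn.congr ?_
      intro z hz
      exact hcomp _ _ _ (hr0 z _ (hι z)) (hr0 z _ hz)
  obtain ⟨K, hK₀, hK⟩ := hπ.2 n (G.comp ⟨h, hh⟩) ⟨_, hcov⟩ fun z =>
    hf _ _ (hr0 z _ (hι z))
  refine ⟨⟨fun z => K (z, m z), K.continuous.comp (continuous_id.prodMk hm)⟩, fun z => ?_,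
    fun i z hz => ?_⟩
  · refine (hK (z, m z)).trans ?_
    change G (h (z, m z)) = G z
    rw [hdiag]
  · have e := hm0 z i hz
    change K (z, m z) = f i z
    rw [e, hK₀]
    change f (ι z) (h (z, 0)) = f i z
    rw [← e, hdiag]
    exact hcomp _ _ _ ((hι z).trans e) hz

end CornerLifting

/-! ### Squares of paths -/

section Squares

open unitInterval

variable {Z : Type*} [TopologicalSpace Z]

/-- The boundary of a square gives a relation between path classes. -/
theorem mk_trans_eq_of_square {a b c d : Z} {K : I × I → Z} (hK : Continuous K) (l : Path a b)
    (t : Path b d) (s : Path a c) (r : Path c d) (hl : ∀ v, K (0, v) = l v)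
    (ht : ∀ u, K (u, 1) = t u) (hs : ∀ u, K (u, 0) = s u) (hr : ∀ v, K (1, v) = r v) :
    (Path.Homotopic.Quotient.mk l).trans (Path.Homotopic.Quotient.mk t) =
      (Path.Homotopic.Quotient.mk s).trans (Path.Homotopic.Quotient.mk r) := by
  obtain rfl : K (0, 0) = a := (hl 0).trans l.source
  obtain rfl : K (0, 1) = b := (hl 1).trans l.target
  obtain rfl : K (1, 0) = c := (hr 0).trans r.source
  obtain rfl : K (1, 1) = d := (hr 1).trans r.target
  let K' : C(I × I, Z) := ⟨K, hK⟩
  let l' : Path ((0, 0) : I × I) (0, 1) := ⟨⟨fun v => (0, v), by fun_prop⟩, rfl, rfl⟩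
  let t' : Path ((0, 1) : I × I) (1, 1) := ⟨⟨fun u => (u, 1), by fun_prop⟩, rfl, rfl⟩
  let s' : Path ((0, 0) : I × I) (1, 0) := ⟨⟨fun u => (u, 0), by fun_prop⟩, rfl, rfl⟩
  let r' : Path ((1, 0) : I × I) (1, 1) := ⟨⟨fun v => (1, v), by fun_prop⟩, rfl, rfl⟩
  have hl' : l = l'.map K'.continuous := Path.ext (funext fun v => (hl v).symm)
  have ht' : t = t'.map K'.continuous := Path.ext (funext fun v => (ht v).symm)
  have hs' : s = s'.map K'.continuous := Path.ext (funext fun v => (hs v).symm)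
  have hr' : r = r'.map K'.continuous := Path.ext (funext fun v => (hr v).symm)
  have : ContractibleSpace I := (convex_Icc (0 : ℝ) 1).contractibleSpace ⟨0, by simp⟩
  have key : (Path.Homotopic.Quotient.mk l').trans (Path.Homotopic.Quotient.mk t') =
      (Path.Homotopic.Quotient.mk s').trans (Path.Homotopic.Quotient.mk r') :=
    Subsingleton.elim (α := Path.Homotopic.Quotient _ _) _ _
  have := congrArg (fun g => g.map K') key
  simp only [PathClasses.map_trans', ← Path.Homotopic.Quotient.mk_map] at this
  rw [hl', ht', hs', hr']
  exact this

/-- The distance from the centre of the square, normalised so that it is `1` on the boundary. -/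
def squareRadius (z : I × I) : ℝ := max |2 * (z.1 : ℝ) - 1| |2 * (z.2 : ℝ) - 1|

/-- The boundary of the square. -/
def squareBoundary : Set (I × I) := {z | z.1 = 0 ∨ z.1 = 1 ∨ z.2 = 0 ∨ z.2 = 1}

/-- In a contractible space, maps from a square which are constant on the boundary are homotopic
to a constant map, relative to the boundary. Contracting the space moves the values on the boundary
along a path `ℓ` from `b`. To keep them fixed, the square is magnified during the contraction, and
the annulus between it and the boundary is filled with `ℓ`. In the end, `ℓ` is retracted to `b`. -/
theorem homotopicRel_const_of_contractible [ContractibleSpace Z] {b : Z} (g : C(I × I, Z))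
    (hg : ∀ z ∈ squareBoundary, g z = b) :
    g.HomotopicRel (ContinuousMap.const _ b) squareBoundary := by
  obtain ⟨d, ⟨H⟩⟩ := id_nullhomotopic Z
  have hrad : Continuous squareRadius := by
    unfold squareRadius
    fun_prop
  have hbd : ∀ z ∈ squareBoundary, squareRadius z = 1 := by
    rintro ⟨⟨x, hx₀, hx₁⟩, ⟨y, hy₀, hy₁⟩⟩ h
    have h₁ : |2 * x - 1| ≤ 1 := abs_le.2 ⟨by linarith, by linarith⟩
    have h₂ : |2 * y - 1| ≤ 1 := abs_le.2 ⟨by linarith, by linarith⟩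
    refine le_antisymm (max_le h₁ h₂) ?_
    rcases h with h | h | h | h
    · have : x = 0 := congrArg Subtype.val h
      exact le_max_of_le_left (by norm_num [this])
    · have : x = 1 := congrArg Subtype.val h
      exact le_max_of_le_left (by norm_num [this])
    · have : y = 0 := congrArg Subtype.val h
      exact le_max_of_le_right (by norm_num [this])
    · have : y = 1 := congrArg Subtype.val h
      exact le_max_of_le_right (by norm_num [this])
  -- magnification from the centre by the factor `1 + u`
  let k : I → I × I → I × I := fun u z =>
    (clampI (1 / 2 + (1 + u) * (z.1 - 1 / 2)), clampI (1 / 2 + (1 + u) * (z.2 - 1 / 2)))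
  have hk : Continuous fun q : I × (I × I) => k q.1 q.2 := by
    dsimp only [k]
    fun_prop
  have hk0 : ∀ z, k 0 z = z := fun z => by
    refine Prod.ext ?_ ?_
    · simp [k, clampI_coe]
    · simp [k, clampI_coe]
  have hclamp0 : ∀ r : ℝ, r ≤ 0 → clampI r = 0 := fun r hr => Set.projIcc_of_le_left _ hr
  have hclamp1 : ∀ r : ℝ, 1 ≤ r → clampI r = 1 := fun r hr => Set.projIcc_of_right_le _ hr
  have hkb : ∀ (u : I) z, 1 ≤ (1 + (u : ℝ)) * squareRadius z → k u z ∈ squareBoundary := by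
    rintro u ⟨⟨x, hx₀, hx₁⟩, ⟨y, hy₀, hy₁⟩⟩ h
    have hu : 0 ≤ 1 + (u : ℝ) := by linarith [u.2.1]
    have : ∀ x : ℝ, 1 ≤ (1 + (u : ℝ)) * |2 * x - 1| →
        clampI (1 / 2 + (1 + u) * (x - 1 / 2)) = 0 ∨
          clampI (1 / 2 + (1 + u) * (x - 1 / 2)) = 1 := by
      intro x hx
      rcases abs_cases (2 * x - 1) with ⟨e, -⟩ | ⟨e, -⟩
      · rw [e] at hx
        exact Or.inr (hclamp1 _ (by nlinarith))
      · rw [e] at hx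
        exact Or.inl (hclamp0 _ (by nlinarith))
    unfold squareRadius at h
    rw [mul_max_of_nonneg _ _ hu] at h
    rcases le_max_iff.1 h with h | h
    · rcases this x h with h | h
      · exact Or.inl h
      · exact Or.inr (Or.inl h)
    · rcases this y h with h | h
      · exact Or.inr (Or.inr (Or.inl h))
      · exact Or.inr (Or.inr (Or.inr h))
  -- the time up to which the point `z` is contracted
  let θ : I → I × I → I := fun u z => clampI (min u (2 * (1 - squareRadius z)))
  have hθ : Continuous fun q : I × (I × I) => θ q.1 q.2 := by
    have : Continuous fun q : I × (I × I) => squareRadius q.2 := hrad.comp continuous_snd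
    dsimp only [θ]
    fun_prop
  have hθb : ∀ u, ∀ z ∈ squareBoundary, θ u z = 0 := fun u z hz => by
    refine hclamp0 _ ?_
    rw [hbd z hz]
    simp
  have hH0 : ∀ z, H (0, z) = z := fun z => H.apply_zero z
  have hH1 : ∀ z, H (1, z) = d := fun z => H.apply_one z
  let g₁ : C(I × I, Z) := ⟨fun z => H (θ 1 z, b), by
    exact H.continuous.comp ((hθ.comp (Continuous.prodMk_right 1)).prodMk continuous_const)⟩
  have h₁ : g.HomotopicRel g₁ squareBoundary := by
    refine ⟨⟨⟨⟨fun q => H (θ q.1 q.2, g (k q.1 q.2)),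
      H.continuous.comp (hθ.prodMk (g.continuous.comp hk))⟩, fun z => ?_, fun z => ?_⟩,
      fun u z hz => ?_⟩⟩
    · have e : θ 0 z = 0 := hclamp0 _ (min_le_left _ _)
      change H (θ 0 z, g (k 0 z)) = g z
      rw [e, hH0, hk0]
    · change H (θ 1 z, g (k 1 z)) = H (θ 1 z, b)
      by_cases hz : 1 ≤ 2 * squareRadius z
      · rw [hg _ (hkb 1 z (by norm_num; exact hz))]
      · have e : θ 1 z = 1 := hclamp1 _ (le_min le_rfl (by linarith))
        rw [e, hH1, hH1]
    · change H (θ u z, g (k u z)) = g z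
      rw [hθb u z hz, hH0, hg z hz, hg]
      refine hkb u z ?_
      rw [hbd z hz]
      linarith [u.2.1]
  refine h₁.trans ⟨⟨⟨⟨fun q => H (σ q.1 * θ 1 q.2, b), ?_⟩, fun z => ?_, fun z => ?_⟩,
      fun u z hz => ?_⟩⟩
  · have : Continuous fun q : I × (I × I) => θ 1 q.2 :=
      (hθ.comp (Continuous.prodMk_right 1)).comp continuous_snd
    exact H.continuous.comp (by fun_prop)
  · change H (σ 0 * θ 1 z, b) = H (θ 1 z, b)
    simp
  · change H (σ 1 * θ 1 z, b) = b
    simp [hH0]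
  · change H (σ u * θ 1 z, b) = H (θ 1 z, b)
    rw [hθb 1 z hz]
    simp

end Squares

/-! ### The fundamental groupoid of a fibre -/

section FibreInclusion

open unitInterval

theorem quotient_eq_trans_symm {Z : Type*} [TopologicalSpace Z] {a b c : Z}
    {f : Path.Homotopic.Quotient a b} {g : Path.Homotopic.Quotient b c}
    {h : Path.Homotopic.Quotient a c} (e : f.trans g = h) : f = h.trans g.symm := by
  rw [← e, Path.Homotopic.Quotient.trans_assoc, Path.Homotopic.Quotient.trans_symm,
    Path.Homotopic.Quotient.trans_refl]

theorem quotient_map_symm {Z Z' : Type*} [TopologicalSpace Z] [TopologicalSpace Z'] {a b : Z}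
    (g : Path.Homotopic.Quotient a b) (f : C(Z, Z')) : g.symm.map f = (g.map f).symm := by
  induction g using Path.Homotopic.Quotient.ind
  rw [← Path.Homotopic.Quotient.mk_symm, ← Path.Homotopic.Quotient.mk_map,
    ← Path.Homotopic.Quotient.mk_map, ← Path.Homotopic.Quotient.mk_symm]
  rfl

variable {Y D F : Type*} [TopologicalSpace Y] [TopologicalSpace D] [TopologicalSpace F]

/-- The map `ι` identifies `F` with the fibre of `π` over `b`. -/
structure IsFibreInclusion (π : C(Y, D)) (b : D) (ι : C(F, Y)) : Prop where
  isEmbedding : Topology.IsEmbedding ι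
  proj : ∀ x, π (ι x) = b
  exists_eq : ∀ y, π y = b → ∃ x, ι x = y

variable {π : C(Y, D)} {b : D} {ι : C(F, Y)}

namespace IsFibreInclusion

/-- Maps to the total space whose values lie in the fibre factor through `ι`. -/
theorem exists_factor (h : IsFibreInclusion π b ι) {T : Type*} [TopologicalSpace T] {L : T → Y}
    (hL : Continuous L) (hb : ∀ t, π (L t) = b) : ∃ L' : C(T, F), ∀ t, ι (L' t) = L t := by
  choose L' hL' using fun t => h.exists_eq (L t) (hb t)
  exact ⟨⟨L', h.isEmbedding.continuous_iff.2 (hL.congr fun t => (hL' t).symm)⟩, hL'⟩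

theorem continuous_cube₂ {T : Type*} [TopologicalSpace T] {a b : T → I} (ha : Continuous a)
    (hb : Continuous b) : Continuous fun t => ![a t, b t] :=
  continuous_pi fun i => by fin_cases i <;> simpa

theorem continuous_cube₃ {T : Type*} [TopologicalSpace T] {a b c : T → I} (ha : Continuous a)
    (hb : Continuous b) (hc : Continuous c) : Continuous fun t => ![a t, b t, c t] :=
  continuous_pi fun i => by fin_cases i <;> simpa

variable [ContractibleSpace D] (hπ : IsSerreFibration π) (h : IsFibreInclusion π b ι)
include hπ h

/-- Paths in the total space of a fibration over a simply connected base are homotopic to paths in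
the fibre: a null-homotopy of the projection is lifted relative to two sides of the square. -/
theorem exists_map_eq {x x' : F} (g : Path.Homotopic.Quotient (ι x) (ι x')) :
    ∃ g' : Path.Homotopic.Quotient x x', g'.map ι = g := by
  induction g using Path.Homotopic.Quotient.ind with | mk η => ?_
  have hN : Path.Homotopic ((η.map π.continuous).cast (h.proj x).symm (h.proj x').symm)
      (Path.refl b) :=
    Path.Homotopic.Quotient.eq.1 (Subsingleton.elim (α := Path.Homotopic.Quotient b b) _ _)
  obtain ⟨N⟩ := hN
  let G : C(Fin 2 → I, D) := ⟨fun z => N (z 0, z 1), N.continuous.comp (by fun_prop)⟩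
  let f : Fin 2 → C(Fin 2 → I, Y) :=
    ![⟨fun z => η (z 1), η.continuous.comp (by fun_prop)⟩, ContinuousMap.const _ (ι x)]
  obtain ⟨L, hL, hLf⟩ := hπ.exists_corner_lift (by norm_num) G f (by
    intro i z hz
    fin_cases i
    · change π (η (z 1)) = N (z 0, z 1)
      rw [show z 0 = 0 from hz]
      exact (N.apply_zero (z 1)).symm
    · change π (ι x) = N (z 0, z 1)
      rw [show z 1 = 0 from hz, N.source]
      exact h.proj x) (by
    have key : ∀ z : Fin 2 → I, z 0 = 0 → z 1 = 0 → η (z 1) = ι x := fun z _ h₁ => by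
      rw [h₁, η.source]
    intro i j z hi hj
    fin_cases i <;> fin_cases j
    · rfl
    · exact key z hi hj
    · exact (key z hj hi).symm
    · rfl)
  have hLη : ∀ t, L ![0, t] = η t := fun t => hLf 0 ![0, t] rfl
  have hLx : ∀ s, L ![s, 0] = ι x := fun s => hLf 1 ![s, 0] rfl
  obtain ⟨κ, hκ⟩ := h.exists_factor (L := fun s : I => L ![s, 1])
    (L.continuous.comp (continuous_cube₂ continuous_id continuous_const)) fun s => by
      rw [hL]
      exact N.target s
  obtain ⟨ρ, hρ⟩ := h.exists_factor (L := fun t : I => L ![1, t])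
    (L.continuous.comp (continuous_cube₂ continuous_const continuous_id)) fun t => by
      rw [hL]
      exact N.apply_one t
  have inj := h.isEmbedding.injective
  let κ' : Path x' (κ 1) := ⟨κ, inj (by
    change ι (κ 0) = _
    rw [hκ, hLη, η.target]), rfl⟩
  let ρ' : Path x (κ 1) := ⟨ρ, inj (by
    change ι (ρ 0) = _
    rw [hρ, hLx]), inj (by
    change ι (ρ 1) = _
    rw [hρ, hκ])⟩
  have sq := mk_trans_eq_of_square (K := fun q => L ![q.1, q.2])
    (L.continuous.comp (continuous_cube₂ continuous_fst continuous_snd)) η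
    (κ'.map ι.continuous) (Path.refl (ι x)) (ρ'.map ι.continuous) hLη (fun u => (hκ u).symm)
    hLx fun v => (hρ v).symm
  refine ⟨(Path.Homotopic.Quotient.mk ρ').trans (Path.Homotopic.Quotient.mk κ').symm, ?_⟩
  rw [quotient_eq_trans_symm sq, PathClasses.map_trans', quotient_map_symm,
    Path.Homotopic.Quotient.mk_refl, Path.Homotopic.Quotient.refl_trans]
  rfl

/-- Paths in the fibre which are homotopic in the total space of a fibration over a contractible
base are homotopic in the fibre: the projection of the homotopy is contracted relative to the
boundary of the square, and the contraction is lifted relative to three faces of the cube. The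
other three faces lie in the fibre. -/
theorem map_injective {x x' : F} :
    Function.Injective fun g : Path.Homotopic.Quotient x x' => g.map ι := by
  intro g₁ g₂ hg
  induction g₁ using Path.Homotopic.Quotient.ind with | mk α => ?_
  induction g₂ using Path.Homotopic.Quotient.ind with | mk β => ?_
  obtain ⟨N⟩ : Path.Homotopic (α.map ι.continuous) (β.map ι.continuous) :=
    Path.Homotopic.Quotient.eq.1 hg
  have hN0 : ∀ t, N (0, t) = ι (α t) := fun t => N.apply_zero t
  have hN1 : ∀ t, N (1, t) = ι (β t) := fun t => N.apply_one t
  obtain ⟨C⟩ := homotopicRel_const_of_contractible (b := b) (π.comp N.toContinuousMap) (by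
    rintro ⟨s, t⟩ (h' | h' | h' | h')
    · obtain rfl : s = 0 := h'
      exact (congrArg π (hN0 t)).trans (h.proj _)
    · obtain rfl : s = 1 := h'
      exact (congrArg π (hN1 t)).trans (h.proj _)
    · obtain rfl : t = 0 := h'
      exact (congrArg π (N.source s)).trans (h.proj _)
    · obtain rfl : t = 1 := h'
      exact (congrArg π (N.target s)).trans (h.proj _))
  have hC0 : ∀ z, C (0, z) = π (N z) := fun z => C.apply_zero z
  have hC1 : ∀ z, C (1, z) = b := fun z => C.apply_one z
  have hCb : ∀ u, ∀ z ∈ squareBoundary, C (u, z) = b := fun u z hz =>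
    (C.eq_snd u hz).trans rfl
  let G : C(Fin 3 → I, D) := ⟨fun z => C (z 0, (z 1, z 2)), C.continuous.comp (by fun_prop)⟩
  let f : Fin 3 → C(Fin 3 → I, Y) :=
    ![⟨fun z => N (z 1, z 2), N.continuous.comp (by fun_prop)⟩,
      ⟨fun z => ι (α (z 2)), ι.continuous.comp (α.continuous.comp (by fun_prop))⟩,
      ContinuousMap.const _ (ι x)]
  obtain ⟨L, hL, hLf⟩ := hπ.exists_corner_lift (by norm_num) G f (by
    intro i z hz
    fin_cases i
    · change π (N (z 1, z 2)) = C (z 0, (z 1, z 2))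
      rw [show z 0 = 0 from hz, hC0]
    · change π (ι (α (z 2))) = C (z 0, (z 1, z 2))
      rw [h.proj, hCb _ _ (Or.inl hz)]
    · change π (ι x) = C (z 0, (z 1, z 2))
      rw [h.proj, hCb _ _ (Or.inr (Or.inr (Or.inl hz)))]) (by
    have k01 : ∀ z : Fin 3 → I, z 1 = 0 → N (z 1, z 2) = ι (α (z 2)) := fun z h₁ => by
      rw [h₁, hN0]
    have k02 : ∀ z : Fin 3 → I, z 2 = 0 → N (z 1, z 2) = ι x := fun z h₁ => by
      rw [h₁]
      exact N.source _
    have k12 : ∀ z : Fin 3 → I, z 2 = 0 → ι (α (z 2)) = ι x := fun z h₁ => by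
      rw [h₁, α.source]
    intro i j z hi hj
    fin_cases i <;> fin_cases j
    · rfl
    · exact k01 z hj
    · exact k02 z hj
    · exact (k01 z hi).symm
    · rfl
    · exact k12 z hj
    · exact (k02 z hi).symm
    · exact (k12 z hi).symm
    · rfl)
  have hL0 : ∀ s t, L ![0, s, t] = N (s, t) := fun s t => hLf 0 ![0, s, t] rfl
  have hLα : ∀ u t, L ![u, 0, t] = ι (α t) := fun u t => hLf 1 ![u, 0, t] rfl
  have hLx : ∀ u s, L ![u, s, 0] = ι x := fun u s => hLf 2 ![u, s, 0] rfl
  have hLC : ∀ u s t, π (L ![u, s, t]) = C (u, (s, t)) := fun u s t => hL ![u, s, t]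
  -- the three faces in the fibre
  obtain ⟨A, hA⟩ := h.exists_factor (L := fun q : I × I => L ![1, q.1, q.2])
    (L.continuous.comp (continuous_cube₃ continuous_const continuous_fst continuous_snd))
    fun q => by rw [hLC, hC1]
  obtain ⟨B, hB⟩ := h.exists_factor (L := fun q : I × I => L ![q.1, 1, q.2])
    (L.continuous.comp (continuous_cube₃ continuous_fst continuous_const continuous_snd))
    fun q => by rw [hLC, hCb _ _ (Or.inr (Or.inl rfl))]
  obtain ⟨T, hT⟩ := h.exists_factor (L := fun q : I × I => L ![q.1, q.2, 1])
    (L.continuous.comp (continuous_cube₃ continuous_fst continuous_snd continuous_const))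
    fun q => by rw [hLC, hCb _ _ (Or.inr (Or.inr (Or.inr rfl)))]
  have inj := h.isEmbedding.injective
  have eA0 : ∀ t, A (0, t) = α t := fun t => inj (by rw [hA, hLα])
  have eAx : ∀ s, A (s, 0) = x := fun s => inj (by rw [hA, hLx])
  have eAB : ∀ t, A (1, t) = B (1, t) := fun t => inj (by rw [hA, hB])
  have eAT : ∀ s, A (s, 1) = T (1, s) := fun s => inj (by rw [hA, hT])
  have eBβ : ∀ t, B (0, t) = β t := fun t => inj (by rw [hB, hL0, hN1])
  have eBx : ∀ u, B (u, 0) = x := fun u => inj (by rw [hB, hLx])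
  have eBT : ∀ u, B (u, 1) = T (u, 1) := fun u => inj (by rw [hB, hT])
  have eT0 : ∀ s, T (0, s) = x' := fun s => inj (by
    rw [hT, hL0]
    exact N.target s)
  have eT1 : ∀ u, T (u, 0) = x' := fun u => inj (by rw [hT, hLα, α.target])
  let ρ : Path x' (T (1, 1)) := ⟨⟨fun s => T (1, s), by fun_prop⟩, eT1 1, rfl⟩
  let κ : Path x' (T (1, 1)) := ⟨⟨fun u => T (u, 1), by fun_prop⟩, eT0 1, rfl⟩
  let β' : Path x (T (1, 1)) := ⟨⟨fun t => A (1, t), by fun_prop⟩, eAx 1, eAT 1⟩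
  have s₁ := mk_trans_eq_of_square A.continuous α ρ (Path.refl x) β' eA0 eAT eAx fun _ => rfl
  have s₂ := mk_trans_eq_of_square B.continuous β κ (Path.refl x) β' eBβ eBT eBx
    fun t => (eAB t).symm
  have s₃ := mk_trans_eq_of_square T.continuous (Path.refl x') κ (Path.refl x') ρ eT0
    (fun _ => rfl) eT1 fun _ => rfl
  simp only [Path.Homotopic.Quotient.mk_refl, Path.Homotopic.Quotient.refl_trans] at s₁ s₂ s₃
  rw [quotient_eq_trans_symm s₁, quotient_eq_trans_symm s₂, s₃]

omit h in
/-- Every point of the total space is joined to a point of the fibre. -/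
theorem exists_path (h : IsFibreInclusion π b ι) (y : Y) :
    ∃ x : F, Nonempty (Path (ι x) y) := by
  obtain ⟨δ⟩ := PathConnectedSpace.joined (π y) b
  obtain ⟨K, hK₀, hK⟩ := hπ.2 0 ⟨fun q => δ q.2, δ.continuous.comp continuous_snd⟩
    (ContinuousMap.const _ y) fun _ => δ.source.symm
  let z : Fin 0 → I := Fin.elim0
  obtain ⟨x, hx⟩ := h.exists_eq (K (z, 1)) ((hK (z, 1)).trans δ.target)
  let p : Path y (ι x) := ⟨⟨fun t => K (z, t), K.continuous.comp (by fun_prop)⟩, hK₀ z, hx.symm⟩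
  exact ⟨x, ⟨p.symm⟩⟩

end IsFibreInclusion

end FibreInclusion

/-! ### Functors induced by path classes -/

section Induced

variable {E : Type u} [NormedAddCommGroup E] [NormedSpace ℂ E]
  {A B Y : Type*} [TopologicalSpace A] [ChartedSpace E A]
  [TopologicalSpace B] [ChartedSpace E B]
  [TopologicalSpace Y]

/-- The map `a` induces an equivalence of fundamental groupoids. -/
structure IsGroupoidEquiv (a : C(A, Y)) : Prop where
  injective : ∀ x x' : A, Function.Injective fun g : Path.Homotopic.Quotient x x' => g.map a
  surjective : ∀ {x x' : A} (g : Path.Homotopic.Quotient (a x) (a x')),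
    ∃ g' : Path.Homotopic.Quotient x x', g'.map a = g
  exists_class : ∀ y, ∃ x, Nonempty (Path.Homotopic.Quotient (a x) y)

/-- The functor `Φ` is induced by the path classes in `Y` from points of `A` to points of `B`: each
of them acts as an isomorphism from the fibre of `V` at its starting point to the fibre of `Φ(V)`
at its end point. -/
structure PathInduced (a : C(A, Y)) (b : C(B, Y)) (Φ : Rep.{_, _, w} E A ⥤ Rep.{_, _, w} E B) where
  /-- The action of the path classes. -/
  τ : ∀ (V : Rep.{_, _, w} E A) {x : A} {y : B}, Path.Homotopic.Quotient (a x) (b y) →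
    (V.Fib x ≃ₗ[ℂ] (Φ.obj V).Fib y)
  left : ∀ (V : Rep.{_, _, w} E A) {x x' : A} {y : B} (g : Path.Homotopic.Quotient x' x)
    (c : Path.Homotopic.Quotient (a x) (b y)) (e : V.Fib x'),
    τ V ((g.map a).trans c) e = τ V c (V.act g e)
  right : ∀ (V : Rep.{_, _, w} E A) {x : A} {y y' : B} (c : Path.Homotopic.Quotient (a x) (b y))
    (h : Path.Homotopic.Quotient y y') (e : V.Fib x),
    τ V (c.trans (h.map b)) e = (Φ.obj V).act h (τ V c e)
  natural : ∀ {V W : Rep.{_, _, w} E A} (T : V ⟶ W) {x : A} {y : B}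
    (c : Path.Homotopic.Quotient (a x) (b y)) (e : V.Fib x),
    τ W c (T.toFun x e) = (Φ.map T).toFun y (τ V c e)

section Construction

namespace IsGroupoidEquiv

variable {a : C(A, Y)} (ha : IsGroupoidEquiv a) (b : C(B, Y))

include ha in
theorem exists_lift {x x' : A} {z : Y} (c : Path.Homotopic.Quotient (a x) z)
    (d : Path.Homotopic.Quotient (a x') z) :
    ∃ g : Path.Homotopic.Quotient x x', (g.map a).trans d = c := by
  obtain ⟨g, hg⟩ := ha.surjective (c.trans d.symm)
  refine ⟨g, ?_⟩
  rw [hg, Path.Homotopic.Quotient.trans_assoc, Path.Homotopic.Quotient.symm_trans,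
    Path.Homotopic.Quotient.trans_refl]

/-- The path class in `A` which turns the path class `d` into the path class `c`. -/
def lift {x x' : A} {z : Y} (c : Path.Homotopic.Quotient (a x) z)
    (d : Path.Homotopic.Quotient (a x') z) : Path.Homotopic.Quotient x x' :=
  Classical.choose (ha.exists_lift c d)

theorem lift_trans {x x' : A} {z : Y} (c : Path.Homotopic.Quotient (a x) z)
    (d : Path.Homotopic.Quotient (a x') z) : ((ha.lift c d).map a).trans d = c :=
  Classical.choose_spec (ha.exists_lift c d)

theorem eq_lift {x x' : A} {z : Y} {c : Path.Homotopic.Quotient (a x) z}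
    {d : Path.Homotopic.Quotient (a x') z} {g : Path.Homotopic.Quotient x x'}
    (h : (g.map a).trans d = c) : g = ha.lift c d := by
  refine ha.injective x x' ?_
  change g.map a = (ha.lift c d).map a
  rw [quotient_eq_trans_symm h, quotient_eq_trans_symm (ha.lift_trans c d)]

/-- A point of `A` which is joined to `y` by a path in `Y`. -/
def source (y : B) : A := Classical.choose (ha.exists_class (b y))

/-- The class of a path to `y` from a point of `A`. -/
def arrow (y : B) : Path.Homotopic.Quotient (a (ha.source b y)) (b y) :=
  Classical.choice (Classical.choose_spec (ha.exists_class (b y)))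

/-- The path class in `A` corresponding to a path class in `B`. -/
def conj {y y' : B} (h : Path.Homotopic.Quotient y y') :
    Path.Homotopic.Quotient (ha.source b y) (ha.source b y') :=
  ha.lift ((ha.arrow b y).trans (h.map b)) (ha.arrow b y')

omit [ChartedSpace E B] in
theorem isAction_conj (V : Rep.{_, _, w} E A) :
    IsAction (M := B) (Fib := fun y => V.Fib (ha.source b y)) fun {_ _} h =>
      V.act (ha.conj b h) where
  refl y e := by
    have : ha.conj b (Path.Homotopic.Quotient.refl y) = Path.Homotopic.Quotient.refl _ := by
      refine (ha.eq_lift ?_).symm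
      rw [show (Path.Homotopic.Quotient.refl (ha.source b y)).map a =
        Path.Homotopic.Quotient.refl _ from rfl, show (Path.Homotopic.Quotient.refl y).map b =
        Path.Homotopic.Quotient.refl _ from rfl, Path.Homotopic.Quotient.refl_trans,
        Path.Homotopic.Quotient.trans_refl]
    rw [this, V.act_refl]
  trans {x y z} g h e := by
    have : ha.conj b (g.trans h) = (ha.conj b g).trans (ha.conj b h) := by
      refine (ha.eq_lift ?_).symm
      rw [PathClasses.map_trans', PathClasses.map_trans', Path.Homotopic.Quotient.trans_assoc,
        conj, conj, ha.lift_trans, ← Path.Homotopic.Quotient.trans_assoc, ha.lift_trans,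
        Path.Homotopic.Quotient.trans_assoc]
    rw [this, V.act_trans]

variable [IsManifold 𝓘(ℂ, E) ω A] [IsManifold 𝓘(ℂ, E) ω B]

/-- The functor induced by the path classes from `A` to `B`: the fibre of `Φ(V)` at `y` is the
fibre of `V` at the starting point of some path to `y`. -/
def functor : Rep.{_, _, w} E A ⥤ Rep.{_, _, w} E B where
  obj V := haveI := fun y => V.finiteDimensional_fib (ha.source b y)
    repOfAction _ (ha.isAction_conj b V)
  map {V W} T := haveI := fun y => V.finiteDimensional_fib (ha.source b y)
    haveI := fun y => W.finiteDimensional_fib (ha.source b y)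
    Rep.homOfEquivariant (V := repOfAction _ (ha.isAction_conj b V))
      (W := repOfAction _ (ha.isAction_conj b W)) (fun y => (T : Rep.Hom V W).toFun (ha.source b y))
      fun _ _ => (T : Rep.Hom V W).equivariant _ _

/-- The functor `functor` is induced by the path classes. -/
def pathInduced : PathInduced a b (ha.functor (E := E) b) where
  τ V x y c := V.isAction.equiv (ha.lift c (ha.arrow b y))
  left V x x' y g c e := by
    change V.act _ e = V.act _ (V.act g e)
    rw [← V.act_trans]
    congr 2
    refine (ha.eq_lift ?_).symm
    rw [PathClasses.map_trans', Path.Homotopic.Quotient.trans_assoc, ha.lift_trans]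
  right V x y y' c h e := by
    change V.act _ e = V.act (ha.conj b h) (V.act _ e)
    rw [← V.act_trans]
    congr 2
    refine (ha.eq_lift ?_).symm
    rw [PathClasses.map_trans', Path.Homotopic.Quotient.trans_assoc, conj, ha.lift_trans,
      ← Path.Homotopic.Quotient.trans_assoc, ha.lift_trans]
  natural {V W} T x y c e := ((T : Rep.Hom V W).equivariant _ _).symm

end IsGroupoidEquiv

end Construction

namespace PathInduced

variable {a : C(A, Y)} {b : C(B, Y)} {Φ Φ' : Rep.{_, _, w} E A ⥤ Rep.{_, _, w} E B}

theorem move (P : PathInduced a b Φ) (V : Rep.{_, _, w} E A) (q : PathClasses a b) {x : A} {y : B}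
    (δ : Path q.src x) (ε : Path q.tgt y) (e : V.Fib q.src) :
    P.τ V (q.move δ ε).cls (V.act (Path.Homotopic.Quotient.mk δ) e) =
      (Φ.obj V).act (Path.Homotopic.Quotient.mk ε) (P.τ V q.cls e) := by
  have e₁ : (q.move δ ε).cls = ((Path.Homotopic.Quotient.mk δ).symm.map a).trans
      (q.cls.trans ((Path.Homotopic.Quotient.mk ε).map b)) := by
    rw [quotient_map_symm]
    rfl
  exact (congrArg (fun c => P.τ V c _) e₁).trans ((P.left V _ _ _).trans
    ((congrArg (P.τ V _) (V.isAction.symm_act _ _)).trans (P.right V _ _ _)))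

theorem isHolFamily [IsManifold 𝓘(ℂ, E) ω A] [IsManifold 𝓘(ℂ, E) ω B] (P : PathInduced a b Φ)
    (V : Rep.{_, _, w} E A) :
    IsHolFamily (E × E) (Q := PathManifold E E a b) V.toHolBundle (Φ.obj V).toHolBundle
      PathClasses.src PathClasses.tgt fun q => (P.τ V (PathClasses.cls q)).toLinearMap :=
  HolBundle.isHolFamily_pathManifold V.hasTransportFrames (Φ.obj V).hasTransportFrames
    (fun q : PathManifold E E a b => (P.τ V (PathClasses.cls q)).toLinearMap)
    fun q _ _ δ ε e => P.move V q δ ε e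

/-- Two functors induced by the same path classes are isomorphic. -/
theorem nonempty_iso [IsManifold 𝓘(ℂ, E) ω A] [IsManifold 𝓘(ℂ, E) ω B] (ha : IsGroupoidEquiv a)
    (P : PathInduced a b Φ) (P' : PathInduced a b Φ') : Nonempty (Φ ≅ Φ') := by
  let c := fun y => ha.arrow b y
  let σ : ∀ V y, (Φ.obj V).Fib y ≃ₗ[ℂ] (Φ'.obj V).Fib y := fun V y =>
    (P.τ V (c y)).symm.trans (P'.τ V (c y))
  have hσ : ∀ V y v, σ V y (P.τ V (c y) v) = P'.τ V (c y) v := fun V y v =>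
    congrArg (P'.τ V (c y)) ((P.τ V (c y)).symm_apply_apply v)
  refine ⟨NatIso.ofComponents (fun V => Rep.isoOfEquivariant (σ V) ?_) ?_⟩
  · intro y y' h e
    obtain ⟨v, rfl⟩ := (P.τ V (c y)).surjective e
    have e₁ := P.right V (c y) h v
    have e₂ := P'.right V (c y) h v
    rw [← ha.lift_trans ((c y).trans (h.map b)) (c y')] at e₁ e₂
    rw [P.left] at e₁
    rw [P'.left] at e₂
    rw [← e₁, hσ, hσ, e₂]
  · intro V W T
    refine Rep.Hom.ext (funext fun y => LinearMap.ext fun e => ?_)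
    obtain ⟨v, rfl⟩ := (P.τ V (c y)).surjective e
    change σ W y ((Φ.map T).toFun y (P.τ V (c y) v)) = (Φ'.map T).toFun y (σ V y (P.τ V (c y) v))
    rw [← P.natural, hσ, hσ, P'.natural]

section Equivalence

theorem exists_class_to (hb : IsGroupoidEquiv b) (x : A) :
    ∃ y, Nonempty (Path.Homotopic.Quotient (a x) (b y)) := by
  obtain ⟨y, ⟨c⟩⟩ := hb.exists_class (a x)
  exact ⟨y, ⟨c.symm⟩⟩

theorem exists_lift_right (hb : IsGroupoidEquiv b) {y y' : B} {z : Y}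
    (c : Path.Homotopic.Quotient z (b y)) (d : Path.Homotopic.Quotient z (b y')) :
    ∃ h : Path.Homotopic.Quotient y y', c.trans (h.map b) = d := by
  obtain ⟨h, hh⟩ := hb.surjective (c.symm.trans d)
  refine ⟨h, ?_⟩
  rw [hh, ← Path.Homotopic.Quotient.trans_assoc, Path.Homotopic.Quotient.trans_symm,
    Path.Homotopic.Quotient.refl_trans]

theorem faithful (P : PathInduced a b Φ) (hb : IsGroupoidEquiv b) : Φ.Faithful := by
  refine ⟨fun {V W S T} h => Rep.Hom.ext (funext fun x => LinearMap.ext fun e => ?_)⟩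
  obtain ⟨y, ⟨c⟩⟩ := exists_class_to (a := a) hb x
  refine (P.τ W c).injective ?_
  rw [P.natural, P.natural, h]

variable [IsManifold 𝓘(ℂ, E) ω A] [IsManifold 𝓘(ℂ, E) ω B]

omit [IsManifold 𝓘(ℂ, E) ω B] in
/-- Morphisms `Φ(V) ⟶ Φ(W)` are moved to `A` by the path classes. -/
theorem full (P : PathInduced a b Φ) (ha : IsGroupoidEquiv a) (hb : IsGroupoidEquiv b) :
    Φ.Full := by
  refine ⟨fun {V W} S => ?_⟩
  choose y c using fun x => exists_class_to (a := a) hb x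
  let d := fun x => Classical.choice (c x)
  let t : ∀ x, V.Fib x →ₗ[ℂ] W.Fib x := fun x => (P.τ W (d x)).symm.toLinearMap ∘ₗ
    (S : Rep.Hom _ _).toFun (y x) ∘ₗ (P.τ V (d x)).toLinearMap
  have ht : ∀ {x z} (q : Path.Homotopic.Quotient (a x) (b z)) (e : V.Fib x),
      P.τ W q (t x e) = (S : Rep.Hom _ _).toFun z (P.τ V q e) := by
    intro x z q e
    obtain ⟨h, rfl⟩ := exists_lift_right hb (d x) q
    rw [P.right, P.right, (S : Rep.Hom _ _).equivariant]
    refine congrArg _ ?_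
    exact (P.τ W (d x)).apply_symm_apply _
  let T : V ⟶ W := Rep.homOfEquivariant t fun {x x'} g e => by
    refine (P.τ W (d x')).injective ?_
    rw [ht, ← P.left, ← P.left, ht]
  refine ⟨T, Rep.Hom.ext (funext fun z => LinearMap.ext fun e => ?_)⟩
  obtain ⟨v, rfl⟩ := (P.τ V (ha.arrow b z)).surjective e
  exact (P.natural T _ v).symm.trans (ht _ v)

/-- A preimage of `W` is obtained from the reversed path classes. -/
theorem essSurj (P : PathInduced a b Φ) (ha : IsGroupoidEquiv a) (hb : IsGroupoidEquiv b) :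
    Φ.EssSurj := by
  refine ⟨fun W => ?_⟩
  let P' := hb.pathInduced (E := E) a
  let V := (hb.functor a).obj W
  let q := fun z => ha.arrow b z
  let σ : ∀ z, W.Fib z ≃ₗ[ℂ] (Φ.obj V).Fib z := fun z =>
    (P'.τ W (q z).symm).trans (P.τ V (q z))
  refine ⟨V, ⟨(Rep.isoOfEquivariant σ fun {z z'} h w => ?_).symm⟩⟩
  let g := ha.conj b h
  have hg : (g.map a).trans (q z') = (q z).trans (h.map b) := ha.lift_trans _ _
  have hg' : (h.map b).trans (q z').symm = (q z).symm.trans (g.map a) := by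
    rw [quotient_eq_trans_symm hg, Path.Homotopic.Quotient.trans_assoc,
      ← Path.Homotopic.Quotient.trans_assoc, Path.Homotopic.Quotient.symm_trans,
      Path.Homotopic.Quotient.refl_trans]
  change P.τ V (q z') (P'.τ W (q z').symm (W.act h w)) =
    (Φ.obj V).act h (P.τ V (q z) (P'.τ W (q z).symm w))
  rw [← P'.left, hg', P'.right, ← P.right, ← hg, P.left]

theorem isEquivalence (P : PathInduced a b Φ) (ha : IsGroupoidEquiv a) (hb : IsGroupoidEquiv b) :
    Φ.IsEquivalence where
  faithful := P.faithful hb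
  full := P.full ha hb
  essSurj := P.essSurj ha hb

end Equivalence

end PathInduced

end Induced

/-! ### Contractible neighbourhoods of graphs -/

section Tubes

open unitInterval

theorem homotopic_of_continuousOn {X Z : Type*} [TopologicalSpace X] [TopologicalSpace Z]
    {A : Set X} {B : Set Z} {f g : C(A, B)} (F : I × X → Z) (hF : ContinuousOn F (Set.univ ×ˢ A))
    (hB : ∀ u, ∀ x ∈ A, F (u, x) ∈ B) (h₀ : ∀ x : A, F (0, x) = f x)
    (h₁ : ∀ x : A, F (1, x) = g x) : f.Homotopic g :=
  ⟨⟨⟨fun q => ⟨F (q.1, q.2), hB _ _ q.2.2⟩, Continuous.subtype_mk (hF.comp_continuous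
      (continuous_fst.prodMk (continuous_subtype_val.comp continuous_snd))
      fun q => ⟨trivial, q.2.2⟩) _⟩, fun x => Subtype.ext (h₀ x), fun x => Subtype.ext (h₁ x)⟩⟩

/-- A space whose identity factors through a contractible space up to homotopy is contractible. -/
theorem contractibleSpace_of_homotopic {X Z : Type*} [TopologicalSpace X] [TopologicalSpace Z]
    [ContractibleSpace Z] (f : C(X, Z)) (g : C(Z, X))
    (h : (ContinuousMap.id X).Homotopic (g.comp f)) : ContractibleSpace X := by
  rw [contractible_iff_id_nullhomotopic]
  obtain ⟨y, hy⟩ := ((id_nullhomotopic Z).comp_right g).comp_left f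
  exact ⟨y, h.trans hy⟩

variable {T : Type*} [TopologicalSpace T]

/-- The homotopy `h` contracts the open set `U` to its point `c`, and there are arbitrarily small
open neighbourhoods of `c` which are preserved by `h`. -/
structure IsContraction (U : Set T) (c : T) (h : I × T → T) : Prop where
  continuousOn : ContinuousOn h (Set.univ ×ˢ U)
  map_zero : ∀ s ∈ U, h (0, s) = s
  map_one : ∀ s ∈ U, h (1, s) = c
  mem : ∀ u, ∀ s ∈ U, h (u, s) ∈ U
  exists_invariant : ∀ N ∈ 𝓝 c, ∃ W ⊆ N ∩ U, IsOpen W ∧ c ∈ W ∧ ∀ u, ∀ s ∈ W, h (u, s) ∈ W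

/-- The open set `U` can be contracted to each of its points. -/
structure IsStarlike (U : Set T) : Prop where
  isOpen : IsOpen U
  exists_contraction : ∀ c ∈ U, ∃ h, IsContraction U c h

/-- A tube around the graph of `γ` over `[0, t]`: a contractible open subset of `T × ℝ` which
contains this graph, is contained in `O` below `t + η`, and is cylindrical above some `b < t`. -/
structure IsTube (γ : C(I, T)) (O : Set (T × ℝ)) (t : I) (D : Set (T × ℝ)) (U : Set T) (b η : ℝ) :
    Prop where
  isOpen : IsOpen D
  isOpen_end : IsOpen U
  lt : b < t
  pos : 0 < η
  mem_iff : ∀ s x, b < x → ((s, x) ∈ D ↔ s ∈ U)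
  end_mem : γ t ∈ U
  subset : ∀ s (x : ℝ), x < t + η → (s, x) ∈ D → (s, x) ∈ O
  graph_mem : ∀ r : I, r ≤ t → (γ r, (r : ℝ)) ∈ D
  contractible : ContractibleSpace D

variable {γ : C(I, T)} {O : Set (T × ℝ)}

theorem IsStarlike.exists_isTube {U : Set T} (hU : IsStarlike U) {r : ℝ} (hr : 0 < r)
    (h0 : γ 0 ∈ U) (hO : ∀ s ∈ U, ∀ x : ℝ, |x| < r → (s, x) ∈ O) :
    ∃ D U b η, IsTube γ O 0 D U b η := by
  obtain ⟨h, hh⟩ := hU.exists_contraction _ h0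
  refine ⟨{q | q.1 ∈ U ∧ -r < q.2}, U, -(r / 2), r,
    ⟨(hU.isOpen.preimage continuous_fst).inter (isOpen_lt continuous_const continuous_snd),
      hU.isOpen, ?_, hr, ?_, h0, ?_, ?_, ?_⟩⟩
  · change -(r / 2) < (0 : ℝ)
    linarith
  · intro s x hx
    exact ⟨fun h => h.1, fun h => ⟨h, by linarith⟩⟩
  · intro s x hx hs
    refine hO s hs.1 x (abs_lt.2 ⟨hs.2, ?_⟩)
    have : x < (0 : ℝ) + r := hx
    linarith
  · intro s hs
    obtain rfl : s = 0 := le_antisymm hs (unitInterval.nonneg s)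
    exact ⟨h0, by change -r < (0 : ℝ); linarith⟩
  · have m0 : ((γ 0, 0) : T × ℝ) ∈ {q : T × ℝ | q.1 ∈ U ∧ -r < q.2} :=
      ⟨h0, by change -r < (0 : ℝ); linarith⟩
    rw [contractible_iff_id_nullhomotopic]
    refine ⟨⟨_, m0⟩, homotopic_of_continuousOn
      (fun q => (h (q.1, q.2.1), (1 - (q.1 : ℝ)) * q.2.2)) ?_ ?_ ?_ ?_⟩
    · refine ContinuousOn.prodMk (hh.continuousOn.comp (by fun_prop) fun q hq => ⟨trivial, hq.2.1⟩)
        (by fun_prop)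
    · rintro u ⟨s, x⟩ ⟨hs, hx⟩
      refine ⟨hh.mem u s hs, ?_⟩
      change -r < (1 - (u : ℝ)) * x
      have h1 := u.2.1
      have h2 := u.2.2
      have hx' : -r < x := hx
      rcases le_or_gt 0 x with h | h
      · have : 0 ≤ (1 - (u : ℝ)) * x := mul_nonneg (by linarith) h
        linarith
      · nlinarith
    · rintro ⟨⟨s, x⟩, hs, hx⟩
      exact Prod.ext (hh.map_zero s hs) (by simp)
    · rintro ⟨⟨s, x⟩, hs, hx⟩
      exact Prod.ext (hh.map_one s hs) (by simp)

/-- Extension of a tube: the old tube is cut off shortly before `t`, and the new cylinder is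
attached to it by a thin neck. The new tube is contracted to the old one by contracting the new
cylinder to the point `γ t` of the neck and then pushing back the second coordinate. -/
theorem IsTube.exists_extension {t t' : I} {D : Set (T × ℝ)} {U : Set T} {b η : ℝ}
    (hD : IsTube γ O t D U b η) (htt' : t < t') {U' : Set T} (hU' : IsStarlike U') {r : ℝ}
    (hr : 0 < r) (hO : ∀ s ∈ U', ∀ x : ℝ, (t : ℝ) ≤ x → x < t' + r → (s, x) ∈ O)
    (hγ : ∀ s : I, t ≤ s → s ≤ t' → γ s ∈ U') : ∃ D U b η, IsTube γ O t' D U b η := by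
  obtain ⟨h, hh⟩ := hU'.exists_contraction (γ t) (hγ t le_rfl htt'.le)
  obtain ⟨W, hW, hWo, hcW, hWh⟩ := hh.exists_invariant U (hD.isOpen_end.mem_nhds hD.end_mem)
  -- The neck `W` begins at `a`; it contains the graph over `[a, t]`, lies in the old cylinder `U`
  -- and is preserved by the contraction of the new one.
  obtain ⟨a, hba, hat, haW⟩ : ∃ a : ℝ, b < a ∧ a < t ∧ ∀ s : I, a ≤ s → s ≤ t → γ s ∈ W := by
    have h₁ : γ ⁻¹' W ∈ 𝓝 t := γ.continuous.continuousAt.preimage_mem_nhds (hWo.mem_nhds hcW)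
    obtain ⟨δ, hδ, hball⟩ := Metric.mem_nhds_iff.1 h₁
    refine ⟨max ((b + t) / 2) (t - δ / 2), lt_max_of_lt_left (by linarith [hD.lt]),
      max_lt (by linarith [hD.lt]) (by linarith), fun s hs hst => hball ?_⟩
    have h₂ : (t : ℝ) - δ / 2 ≤ s := (le_max_right _ _).trans hs
    have h₃ : (s : ℝ) ≤ t := hst
    rw [Metric.mem_ball, Subtype.dist_eq, Real.dist_eq]
    exact abs_lt.2 ⟨by linarith, by linarith⟩
  let m : ℝ := (b + a) / 2
  have hbm : b < m := by simp only [m]; linarith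
  have hma : m < a := by simp only [m]; linarith
  let D' : Set (T × ℝ) := {q | (q ∈ D ∧ q.2 < a) ∨ (q.1 ∈ W ∧ b < q.2) ∨ (q.1 ∈ U' ∧ t < q.2)}
  -- the parts of the new tube
  have hD'low : ∀ s x, x ≤ a → (s, x) ∈ D' → (s, x) ∈ D := by
    rintro s x hx (⟨h, -⟩ | ⟨hs, hb⟩ | ⟨-, ht⟩)
    · exact h
    · exact (hD.mem_iff s x hb).2 (hW hs).1
    · exact absurd (show (t : ℝ) < x from ht) (by linarith)
  have hD'mid : ∀ s x, a ≤ x → x ≤ t → (s, x) ∈ D' → s ∈ W := by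
    rintro s x hx hx' (⟨-, h⟩ | ⟨hs, -⟩ | ⟨-, ht⟩)
    · exact absurd (show x < a from h) (by linarith)
    · exact hs
    · exact absurd (show (t : ℝ) < x from ht) (by linarith)
  have hD'high : ∀ s x, a ≤ x → (s, x) ∈ D' → s ∈ U' := by
    rintro s x hx (⟨-, h⟩ | ⟨hs, -⟩ | ⟨hs, -⟩)
    · exact absurd (show x < a from h) (by linarith)
    · exact (hW hs).2
    · exact hs
  have hpush : ∀ s x, (s, x) ∈ D → (s, min x m) ∈ D := by
    intro s x hs
    rcases le_total x m with hx | hx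
    · rwa [min_eq_left hx]
    · rw [min_eq_right hx]
      exact (hD.mem_iff s m hbm).2 ((hD.mem_iff s x (hbm.trans_le hx)).1 hs)
  refine ⟨D', U', t, min r η, ⟨?_, hU'.isOpen, htt', lt_min hr hD.pos, ?_, hγ t' htt'.le le_rfl,
    ?_, ?_, ?_⟩⟩
  · exact (hD.isOpen.inter (isOpen_lt continuous_snd continuous_const)).union
      (((hWo.preimage continuous_fst).inter (isOpen_lt continuous_const continuous_snd)).union
      ((hU'.isOpen.preimage continuous_fst).inter (isOpen_lt continuous_const continuous_snd)))
  · exact fun s x hx => ⟨hD'high s x (hat.trans hx).le, fun h => Or.inr (Or.inr ⟨h, hx⟩)⟩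
  · intro s x hx hs
    have hr' := min_le_left r η
    rcases le_or_gt x t with h | h
    · refine hD.subset s x (by linarith [hD.pos]) ?_
      rcases le_total x a with h' | h'
      · exact hD'low s x h' hs
      · exact (hD.mem_iff s x (by linarith)).2 (hW (hD'mid s x h' h hs)).1
    · exact hO s (hD'high s x (by linarith) hs) x h.le (by linarith)
  · intro s hs
    rcases lt_or_ge (s : ℝ) a with h | h
    · exact Or.inl ⟨hD.graph_mem s (Subtype.coe_le_coe.1 (by linarith)), h⟩
    · rcases le_or_gt s t with h' | h'
      · exact Or.inr (Or.inl ⟨haW s h h', hba.trans_le h⟩)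
      · exact Or.inr (Or.inr ⟨hγ s h'.le hs, h'⟩)
  · have := hD.contractible
    let χ : ℝ → I := fun x => clampI ((x - a) / (t - a))
    have hχ : Continuous χ := continuous_clampI.comp (by fun_prop)
    have hχa : ∀ x, x ≤ a → χ x = 0 := fun x hx =>
      Set.projIcc_of_le_left _ (div_nonpos_of_nonpos_of_nonneg (by linarith) (by linarith))
    have hχt : ∀ x : ℝ, t ≤ x → χ x = 1 := fun x hx =>
      Set.projIcc_of_right_le _ ((one_le_div (by linarith)).2 (by linarith))
    -- contraction of the new cylinder
    let k : I × (T × ℝ) → T := fun q => if q.2.2 ≤ a then q.2.1 else h (q.1 * χ q.2.2, q.2.1)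
    have hk : ∀ u s x, (s, x) ∈ D' → a ≤ x → k (u, (s, x)) = h (u * χ x, s) := by
      intro u s x hs hx
      rcases eq_or_lt_of_le hx with rfl | hx
      · simp only [k, if_pos le_rfl, hχa a le_rfl, mul_zero]
        exact (hh.map_zero s (hD'high s a le_rfl hs)).symm
      · simp only [k, if_neg (not_le.2 hx)]
    have hk' : ∀ u s x, x ≤ a → k (u, (s, x)) = s := fun u s x hx => if_pos hx
    have hkc : ContinuousOn k (Set.univ ×ˢ D') := by
      have e : (Set.univ ×ˢ D' : Set (I × (T × ℝ))) =
          (Set.univ ×ˢ D') ∩ {q | q.2.2 ≤ a} ∪ (Set.univ ×ˢ D') ∩ {q | a ≤ q.2.2} := by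
        rw [← Set.inter_union_distrib_left]
        refine (Set.inter_eq_left.2 fun q _ => ?_).symm
        exact le_total q.2.2 a
      have c₁ : ContinuousOn k ((Set.univ ×ˢ D') ∩ {q | q.2.2 ≤ a}) :=
        (show Continuous fun q : I × (T × ℝ) => q.2.1 by fun_prop).continuousOn.congr
          fun q hq => hk' _ _ _ hq.2
      have c₂ : ContinuousOn k ((Set.univ ×ˢ D') ∩ {q | a ≤ q.2.2}) := by
        refine ContinuousOn.congr (f := fun q => h (q.1 * χ q.2.2, q.2.1))
          (hh.continuousOn.comp (by fun_prop) fun q hq =>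
            ⟨trivial, hD'high _ _ hq.2 hq.1.2⟩) fun q hq => hk _ _ _ hq.1.2 hq.2
      rw [e]
      intro q hq
      rw [← e] at hq
      refine ContinuousWithinAt.union ?_ ?_
      · by_cases hqa : q.2.2 ≤ a
        · exact c₁ q ⟨hq, hqa⟩
        · have : (Set.univ ×ˢ D' ∩ {q : I × (T × ℝ) | q.2.2 ≤ a}) ⊆ {q | q.2.2 ≤ a} :=
            Set.inter_subset_right
          refine continuousWithinAt_of_notMem_closure fun hcl => hqa ?_
          exact (isClosed_le (by fun_prop) continuous_const).closure_subset_iff.2 this hcl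
      · by_cases hqa : a ≤ q.2.2
        · exact c₂ q ⟨hq, hqa⟩
        · have : (Set.univ ×ˢ D' ∩ {q : I × (T × ℝ) | a ≤ q.2.2}) ⊆ {q | a ≤ q.2.2} :=
            Set.inter_subset_right
          refine continuousWithinAt_of_notMem_closure fun hcl => hqa ?_
          exact (isClosed_le continuous_const (by fun_prop)).closure_subset_iff.2 this hcl
    have hkD' : ∀ u s x, (s, x) ∈ D' → (k (u, (s, x)), x) ∈ D' := by
      intro u s x hs
      rcases le_total x a with hx | hx
      · rwa [hk' u s x hx]
      · rw [hk u s x hs hx]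
        rcases le_or_gt x t with hx' | hx'
        · exact Or.inr (Or.inl ⟨hWh _ s (hD'mid s x hx hx' hs), by change b < x; linarith⟩)
        · exact Or.inr (Or.inr ⟨hh.mem _ s (hD'high s x hx hs), hx'⟩)
    -- after the contraction, the second coordinate may be pushed back
    have hk1 : ∀ s x, (s, x) ∈ D' → ∀ y, min x m ≤ y → y ≤ x → (k (1, (s, x)), y) ∈ D' := by
      intro s x hs y hy hyx
      rcases le_total x a with hx | hx
      · rw [hk' 1 s x hx]
        have hsD := hD'low s x hx hs
        rcases eq_or_lt_of_le hyx with rfl | hyx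
        · exact hs
        · refine Or.inl ⟨?_, hyx.trans_le hx⟩
          have hmy : m ≤ y := by
            rcases min_le_iff.1 hy with h | h
            · exact absurd hyx (not_lt.2 h)
            · exact h
          exact (hD.mem_iff s y (by linarith)).2 ((hD.mem_iff s x (by linarith)).1 hsD)
      · rw [hk 1 s x hs hx, one_mul]
        have hby : b < y := by
          rcases min_le_iff.1 hy with h | h <;> linarith
        refine Or.inr (Or.inl ⟨?_, hby⟩)
        rcases le_or_gt x t with hx' | hx'
        · exact hWh _ s (hD'mid s x hx hx' hs)
        · change h (χ x, s) ∈ W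
          rw [hχt x hx'.le, hh.map_one s (hD'high s x hx hs)]
          exact hcW
    have hk1c : ContinuousOn (fun q : T × ℝ => k (1, q)) D' :=
      hkc.comp (by fun_prop) fun q hq => ⟨trivial, hq⟩
    have hmem1 : ∀ q ∈ D', (k (1, q), min q.2 m) ∈ D := by
      rintro ⟨s, x⟩ hs
      have h₁ := hk1 s x hs (min x m) le_rfl (min_le_left _ _)
      exact hD'low _ _ ((min_le_right _ _).trans hma.le) h₁
    let f : C(D', D) := ⟨fun q => ⟨(k (1, q), min q.1.2 m), hmem1 q q.2⟩, by
      refine Continuous.subtype_mk (Continuous.prodMk ?_ (by fun_prop)) _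
      exact hk1c.comp_continuous continuous_subtype_val fun q => q.2⟩
    let g : C(D, D') := ⟨fun q => ⟨(q.1.1, min q.1.2 m),
      Or.inl ⟨hpush _ _ q.2, (min_le_right _ _).trans_lt hma⟩⟩, by fun_prop⟩
    let f₁ : C(D', D') := ⟨fun q => ⟨(k (1, q), q.1.2), hkD' 1 _ _ q.2⟩, by
      refine Continuous.subtype_mk (Continuous.prodMk ?_ (by fun_prop)) _
      exact hk1c.comp_continuous continuous_subtype_val fun q => q.2⟩
    have H₁ : (ContinuousMap.id D').Homotopic f₁ := by
      refine homotopic_of_continuousOn (fun q => (k q, q.2.2)) (hkc.prodMk (by fun_prop))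
        (fun u q hq => hkD' u _ _ hq) (fun q => ?_) fun q => rfl
      obtain ⟨⟨s, x⟩, hs⟩ := q
      refine Prod.ext ?_ rfl
      change k (0, (s, x)) = s
      rcases le_total x a with hx | hx
      · exact hk' 0 s x hx
      · rw [hk 0 s x hs hx, zero_mul]
        exact hh.map_zero s (hD'high s x hx hs)
    have H₂ : f₁.Homotopic (g.comp f) := by
      refine homotopic_of_continuousOn
        (fun q => (k (1, q.2), (1 - (q.1 : ℝ)) * q.2.2 + q.1 * min q.2.2 m)) ?_ ?_ ?_ ?_
      · exact (hk1c.comp continuousOn_snd fun q hq => hq.2).prodMk (by fun_prop)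
      · rintro u ⟨s, x⟩ hs
        have h1 := u.2.1
        have h2 := u.2.2
        have h3 := min_le_left x m
        refine hk1 s x hs _ ?_ ?_
        · change min x m ≤ (1 - (u : ℝ)) * x + u * min x m
          nlinarith
        · change (1 - (u : ℝ)) * x + u * min x m ≤ x
          nlinarith
      · rintro ⟨⟨s, x⟩, hs⟩
        exact Prod.ext rfl (by simp [f₁])
      · rintro ⟨⟨s, x⟩, hs⟩
        refine Prod.ext rfl ?_
        simp [f, g]
    exact contractibleSpace_of_homotopic f g (H₁.trans H₂)

/-- A tube around the whole graph, contained in `O`. -/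
theorem IsTube.exists_truncation {D : Set (T × ℝ)} {U : Set T} {b η : ℝ}
    (hD : IsTube γ O 1 D U b η) : ∃ D' ⊆ O, IsOpen D' ∧ (∀ r : I, (γ r, (r : ℝ)) ∈ D') ∧
      ContractibleSpace D' := by
  have := hD.contractible
  have hb : b < 1 := hD.lt
  let D' : Set (T × ℝ) := {q | q ∈ D ∧ q.2 < 1 + η}
  have hpush : ∀ s x y, (s, x) ∈ D → min x 1 ≤ y → y ≤ x → (s, y) ∈ D := by
    intro s x y hs hy hyx
    rcases eq_or_lt_of_le hyx with rfl | hyx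
    · exact hs
    · have h1y : 1 ≤ y := by
        rcases min_le_iff.1 hy with h | h
        · exact absurd hyx (not_lt.2 h)
        · exact h
      exact (hD.mem_iff s y (by linarith)).2 ((hD.mem_iff s x (by linarith)).1 hs)
  refine ⟨D', fun q hq => hD.subset q.1 q.2 hq.2 hq.1,
    hD.isOpen.inter (isOpen_lt continuous_snd continuous_const), fun r => ⟨hD.graph_mem r
      (unitInterval.le_one r), ?_⟩, ?_⟩
  · have := r.2.2
    have := hD.pos
    change (r : ℝ) < 1 + η
    linarith
  · let f : C(D', D) := ⟨fun q => ⟨q.1, q.2.1⟩, by fun_prop⟩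
    let g : C(D, D') := ⟨fun q => ⟨(q.1.1, min q.1.2 1), hpush _ _ _ q.2 le_rfl (min_le_left _ _),
      (min_le_right _ _).trans_lt (by linarith [hD.pos])⟩, by fun_prop⟩
    refine contractibleSpace_of_homotopic f g (homotopic_of_continuousOn
      (fun q => (q.2.1, (1 - (q.1 : ℝ)) * q.2.2 + q.1 * min q.2.2 1)) (by fun_prop) ?_ ?_ ?_)
    · rintro u ⟨s, x⟩ ⟨hs, hx⟩
      have h1 := u.2.1
      have h2 := u.2.2
      have h3 := min_le_left x 1
      have h4 : (1 - (u : ℝ)) * x + u * min x 1 ≤ x := by nlinarith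
      refine ⟨hpush s x _ hs ?_ h4, h4.trans_lt hx⟩
      change min x 1 ≤ (1 - (u : ℝ)) * x + u * min x 1
      nlinarith
    · rintro ⟨⟨s, x⟩, hs⟩
      exact Prod.ext rfl (by simp)
    · rintro ⟨⟨s, x⟩, hs⟩
      exact Prod.ext rfl (by simp [f, g])

/-- In a space with arbitrarily small starlike open sets, the graph of a path has arbitrarily small
contractible open neighbourhoods. -/
theorem exists_contractible_nhd (hT : ∀ c : T, ∀ N ∈ 𝓝 c, ∃ U ⊆ N, c ∈ U ∧ IsStarlike U)
    (γ : C(I, T)) {O : Set (T × ℝ)} (hO : IsOpen O) (hγ : ∀ r : I, (γ r, (r : ℝ)) ∈ O) :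
    ∃ D' ⊆ O, IsOpen D' ∧ (∀ r : I, (γ r, (r : ℝ)) ∈ D') ∧ ContractibleSpace D' := by
  have key : ∀ r : I, ∃ (U : Set T) (ε : ℝ), IsStarlike U ∧ 0 < ε ∧
      (∀ s ∈ U, ∀ x : ℝ, |x - r| < 2 * ε → (s, x) ∈ O) ∧
      ∀ r' : I, |(r' : ℝ) - r| < ε → γ r' ∈ U := by
    intro r
    obtain ⟨N, hN, N', hN', hNN⟩ := mem_nhds_prod_iff.1 (hO.mem_nhds (hγ r))
    obtain ⟨U, hUN, hrU, hU⟩ := hT _ N hN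
    obtain ⟨ε₁, hε₁, hb₁⟩ := Metric.mem_nhds_iff.1 hN'
    obtain ⟨ε₂, hε₂, hb₂⟩ := Metric.mem_nhds_iff.1
      (γ.continuous.continuousAt.preimage_mem_nhds (hU.isOpen.mem_nhds hrU))
    refine ⟨U, min (ε₁ / 2) ε₂, hU, lt_min (by linarith) hε₂, fun s hs x hx => hNN ⟨hUN hs, hb₁ ?_⟩,
      fun r' hr' => hb₂ ?_⟩
    · rw [Metric.mem_ball, Real.dist_eq]
      linarith [min_le_left (ε₁ / 2) ε₂]
    · rw [Metric.mem_ball, Subtype.dist_eq, Real.dist_eq]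
      exact hr'.trans_le (min_le_right _ _)
  choose U ε hU hε hUO hγU using key
  obtain ⟨t, ht0, htm, ⟨n, hn⟩, ht⟩ := exists_monotone_Icc_subset_open_cover_unitInterval
    (c := fun r : I => {r' : I | |(r' : ℝ) - r| < ε r})
    (fun r => isOpen_lt (by fun_prop) continuous_const)
    fun r _ => Set.mem_iUnion.2 ⟨r, by simpa using hε r⟩
  have step : ∀ k, ∃ D U b η, IsTube γ O (t k) D U b η := by
    intro k
    induction k with
    | zero =>
      rw [ht0]
      refine (hU 0).exists_isTube (r := ε 0) (hε 0) (hγU 0 0 (by simpa using hε 0))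
        fun s hs x hx => hUO 0 s hs x ?_
      have := hε 0
      simp only [Set.Icc.coe_zero, sub_zero]
      linarith
    | succ k ih =>
      obtain ⟨D, V, b, η, hD⟩ := ih
      rcases eq_or_lt_of_le (htm k.le_succ) with e | hlt
      · rw [← e]
        exact ⟨D, V, b, η, hD⟩
      · obtain ⟨r, hr⟩ := ht k
        have h₁ : |(t k : ℝ) - r| < ε r := hr (Set.left_mem_Icc.2 hlt.le)
        have h₂ : |(t (k + 1) : ℝ) - r| < ε r := hr (Set.right_mem_Icc.2 hlt.le)
        rw [abs_lt] at h₁ h₂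
        refine hD.exists_extension hlt (hU r) (hε r) (fun s hs x hx hx' => hUO r s hs x ?_)
          fun s hs hs' => hγU r s (hr ⟨hs, hs'⟩)
        rw [abs_lt]
        constructor <;> linarith
  obtain ⟨D, V, b, η, hD⟩ := step n
  rw [hn n le_rfl] at hD
  exact hD.exists_truncation

end Tubes

/-! ### Thickenings of paths -/

section SmallThickenings

open unitInterval

section Charts

variable {T F : Type*} [TopologicalSpace T] [NormedAddCommGroup F] [NormedSpace ℝ F]

/-- The preimage of a convex open set under a chart can be contracted along the segments of the
chart to each of its points. -/
theorem isStarlike_of_convex (φ : OpenPartialHomeomorph T F) {K : Set F} (hK : Convex ℝ K)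
    (hKo : IsOpen K) (hKφ : K ⊆ φ.target) : IsStarlike (φ.source ∩ φ ⁻¹' K) := by
  refine ⟨φ.isOpen_inter_preimage hKo, ?_⟩
  rintro c ⟨hc, hcK⟩
  have hcomb : ∀ {L : Set F}, Convex ℝ L → ∀ a ∈ L, ∀ b ∈ L, ∀ u : unitInterval,
      (1 - (u : ℝ)) • a + (u : ℝ) • b ∈ L := fun hL a ha b hb u =>
    hL ha hb (by linarith [u.2.2]) u.2.1 (by ring)
  have hmem : ∀ {L : Set F}, L ⊆ K → Convex ℝ L → φ c ∈ L → ∀ (u : unitInterval),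
      ∀ s ∈ φ.source ∩ φ ⁻¹' L,
        φ.symm ((1 - (u : ℝ)) • φ s + (u : ℝ) • φ c) ∈ φ.source ∩ φ ⁻¹' L := by
    intro L hLK hL hcL u s hs
    have h := hcomb hL _ hs.2 _ hcL u
    refine ⟨φ.map_target (hKφ (hLK h)), ?_⟩
    change φ (φ.symm _) ∈ L
    rwa [φ.right_inv (hKφ (hLK h))]
  refine ⟨fun q => φ.symm ((1 - (q.1 : ℝ)) • φ q.2 + (q.1 : ℝ) • φ c), ⟨?_, ?_, ?_, ?_, ?_⟩⟩
  · refine φ.symm.continuousOn.comp (t := φ.target) ?_ fun q hq =>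
      hKφ (hcomb hK _ hq.2.2 _ hcK q.1)
    have h₁ : ContinuousOn (fun q : I × T => φ q.2) (Set.univ ×ˢ (φ.source ∩ φ ⁻¹' K)) :=
      φ.continuousOn.comp continuousOn_snd fun q hq => hq.2.1
    have h₂ : Continuous fun q : I × T => (q.1 : ℝ) := by fun_prop
    exact ((continuousOn_const.sub h₂.continuousOn).smul h₁).add
      (h₂.continuousOn.smul continuousOn_const)
  · intro s hs
    simp [φ.left_inv hs.1]
  · intro s hs
    simp [φ.left_inv hc]
  · exact hmem le_rfl hK hcK
  · intro N hN
    have h₁ : φ.symm ⁻¹' N ∈ 𝓝 (φ c) := by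
      refine (φ.symm.continuousAt (φ.map_source hc)) ?_
      rwa [φ.left_inv hc]
    obtain ⟨r, hr, hb⟩ := Metric.mem_nhds_iff.1 h₁
    refine ⟨φ.source ∩ φ ⁻¹' (K ∩ Metric.ball (φ c) r), fun s hs => ⟨?_, hs.1, hs.2.1⟩,
      φ.isOpen_inter_preimage (hKo.inter Metric.isOpen_ball),
      ⟨hc, hcK, Metric.mem_ball_self hr⟩,
      hmem Set.inter_subset_left (hK.inter (convex_ball _ _)) ⟨hcK, Metric.mem_ball_self hr⟩⟩
    have := hb hs.2.2
    rwa [Set.mem_preimage, φ.left_inv hs.1] at this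

/-- Points in the domain of a chart have arbitrarily small starlike neighbourhoods. -/
theorem exists_isStarlike_of_chart (φ : OpenPartialHomeomorph T F) {c : T} (hc : c ∈ φ.source)
    {N : Set T} (hN : N ∈ 𝓝 c) : ∃ U ⊆ N, c ∈ U ∧ IsStarlike U := by
  have h₁ : φ.target ∩ φ.symm ⁻¹' N ∈ 𝓝 (φ c) := by
    refine Filter.inter_mem (φ.open_target.mem_nhds (φ.map_source hc))
      ((φ.symm.continuousAt (φ.map_source hc)) ?_)
    rwa [φ.left_inv hc]
  obtain ⟨r, hr, hb⟩ := Metric.mem_nhds_iff.1 h₁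
  refine ⟨φ.source ∩ φ ⁻¹' Metric.ball (φ c) r, ?_, ⟨hc, Metric.mem_ball_self hr⟩,
    isStarlike_of_convex φ (convex_ball _ _) Metric.isOpen_ball fun z hz => (hb hz).1⟩
  rintro s ⟨hs, hs'⟩
  have := (hb hs').2
  rwa [Set.mem_preimage, φ.left_inv hs] at this

end Charts

/-- The graph of a path has arbitrarily small contractible open neighbourhoods. The imaginary part
is added to the manifold, so that the graph runs in the direction of the real part. -/
theorem Thickening.exists_subset (B : Type*) {S : Type*} [NormedAddCommGroup B] [NormedSpace ℂ B]
    [TopologicalSpace S] [ChartedSpace B S] {s₀ s₁ : S} {γ : Path s₀ s₁} {O : Set (S × ℂ)}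
    (hO : IsOpen O) (hγ : ∀ t : I, (γ t, ((t : ℝ) : ℂ)) ∈ O) :
    ∃ D : Thickening γ, (D.carrier : Set (S × ℂ)) ⊆ O := by
  let j : (S × ℂ) ≃ₜ ((S × ℝ) × ℝ) :=
    { toFun z := ((z.1, z.2.im), z.2.re)
      invFun z := (z.1.1, ⟨z.2, z.1.2⟩)
      left_inv z := rfl
      right_inv z := rfl
      continuous_toFun := by fun_prop
      continuous_invFun := by
        refine (by fun_prop : Continuous fun z : (S × ℝ) × ℝ => z.1.1).prodMk ?_
        exact Complex.equivRealProdCLM.symm.continuous.comp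
          (by fun_prop : Continuous fun z : (S × ℝ) × ℝ => (z.2, z.1.2)) }
  obtain ⟨D', hD'O, hD', hgraph, hc⟩ := exists_contractible_nhd (T := S × ℝ)
    (fun c N hN => exists_isStarlike_of_chart
      ((chartAt B c.1).prod (OpenPartialHomeomorph.refl ℝ)) ⟨mem_chart_source B c.1, trivial⟩ hN)
    ⟨fun t => (γ t, 0), by fun_prop⟩ (O := j.symm ⁻¹' O) (hO.preimage j.symm.continuous) hγ
  refine ⟨⟨⟨j ⁻¹' D', hD'.preimage j.continuous⟩, fun t => ?_, ?_⟩, fun z hz => hD'O hz⟩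
  · exact hgraph t
  · exact (j.sets (s := j ⁻¹' D') (t := D') rfl).contractibleSpace

end SmallThickenings

/-! ### The functors induced by `Q_γ` -/

section Restriction

variable {E : Type u} [NormedAddCommGroup E] [NormedSpace ℂ E]
  {A B Y Y' : Type*} [TopologicalSpace A] [ChartedSpace E A]
  [TopologicalSpace B] [ChartedSpace E B] [TopologicalSpace Y] [TopologicalSpace Y']

/-- A functor induced by the path classes in `Y` is also induced by the path classes in a space
which is mapped to `Y`. -/
def PathInduced.restrict {a : C(A, Y')} {b : C(B, Y')} {Φ : Rep.{_, _, w} E A ⥤ Rep.{_, _, w} E B}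
    (j : C(Y', Y)) (P : PathInduced (j.comp a) (j.comp b) Φ) : PathInduced a b Φ where
  τ V x y c := P.τ V (c.map j)
  left V x x' y g c e := by
    have e₁ : (g.map a).map j = g.map (j.comp a) := by
      induction g using Path.Homotopic.Quotient.ind
      rfl
    rw [PathClasses.map_trans', e₁]
    exact P.left V g _ e
  right V x y y' c h e := by
    have e₁ : (h.map b).map j = h.map (j.comp b) := by
      induction h using Path.Homotopic.Quotient.ind
      rfl
    rw [PathClasses.map_trans', e₁]
    exact P.right V _ h e
  natural T x y c e := P.natural T _ e

end Restriction

/-- The inclusion of a fibre of a fibration over a contractible base is an equivalence of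
fundamental groupoids. -/
theorem IsFibreInclusion.isGroupoidEquiv {Y D F : Type*} [TopologicalSpace Y]
    [TopologicalSpace D] [TopologicalSpace F] {π : C(Y, D)} {b : D} {ι : C(F, Y)}
    [ContractibleSpace D] (hπ : IsSerreFibration π) (h : IsFibreInclusion π b ι) :
    IsGroupoidEquiv ι where
  injective _ _ := h.map_injective hπ
  surjective g := h.exists_map_eq hπ g
  exists_class y := by
    obtain ⟨x, ⟨δ⟩⟩ := h.exists_path hπ y
    exact ⟨x, ⟨Path.Homotopic.Quotient.mk δ⟩⟩

namespace Thickening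

section

variable {E : Type u} {B : Type v} [NormedAddCommGroup E] [NormedSpace ℂ E]
  [NormedAddCommGroup B] [NormedSpace ℂ B]
  {X S : Type*} [TopologicalSpace X] [ChartedSpace E X]
  [TopologicalSpace S] [ChartedSpace B S] {p : X → S}
  {s₀ s₁ : S} {γ : Path s₀ s₁} (D : Thickening γ)
  (hp : IsSubmersion 𝓘(ℂ, E) 𝓘(ℂ, B) ω p)

/-- The pulled back family is a Serre fibration. -/
theorem isSerreFibration_proj (hfib : IsSerreFibration p) : IsSerreFibration (D.proj hp) := by
  refine ⟨(D.proj hp).continuous, fun n H f hf => ?_⟩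
  obtain ⟨K, hK₀, hK⟩ := hfib.2 n ⟨fun z => (H z).1.1, by fun_prop⟩
    ⟨fun z => (f z).1.1, continuous_fst.comp (continuous_subtype_val.comp f.continuous)⟩
    fun x => (f x).2.trans (congrArg (fun d : D.carrier => d.1.1) (hf x))
  refine ⟨⟨fun z => ⟨(K z, H z), hK z⟩, (K.continuous.prodMk H.continuous).subtype_mk _⟩,
    fun x => Subtype.ext (Prod.ext (hK₀ x) (hf x).symm), fun z => rfl⟩

theorem isFibreInclusion_incl₀ : IsFibreInclusion (D.proj hp) ⟨_, D.graph_mem 0⟩ (D.incl₀ hp) where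
  isEmbedding := by
    refine ⟨.of_comp (D.incl₀ hp).continuous (continuous_fst.comp continuous_subtype_val)
      (Fibre.isInducing_val hp s₀), fun x y h => Fibre.ext ?_⟩
    exact congrArg (fun z : D.Total hp => z.1.1) h
  proj _ := rfl
  exists_eq y hy := by
    obtain ⟨⟨x, d⟩, hx⟩ := y
    obtain rfl : d = _ := hy
    exact ⟨⟨x, hx.trans γ.source⟩, rfl⟩

theorem isFibreInclusion_incl₁ : IsFibreInclusion (D.proj hp) ⟨_, D.graph_mem 1⟩ (D.incl₁ hp) where
  isEmbedding := by
    refine ⟨.of_comp (D.incl₁ hp).continuous (continuous_fst.comp continuous_subtype_val)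
      (Fibre.isInducing_val hp s₁), fun x y h => Fibre.ext ?_⟩
    exact congrArg (fun z : D.Total hp => z.1.1) h
  proj _ := rfl
  exists_eq y hy := by
    obtain ⟨⟨x, d⟩, hx⟩ := y
    obtain rfl : d = _ := hy
    exact ⟨⟨x, hx.trans γ.target⟩, rfl⟩

theorem isGroupoidEquiv_incl₀ (hfib : IsSerreFibration p) : IsGroupoidEquiv (D.incl₀ hp) :=
  haveI := D.contractible
  (D.isFibreInclusion_incl₀ hp).isGroupoidEquiv (D.isSerreFibration_proj hp hfib)

theorem isGroupoidEquiv_incl₁ (hfib : IsSerreFibration p) : IsGroupoidEquiv (D.incl₁ hp) :=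
  haveI := D.contractible
  (D.isFibreInclusion_incl₁ hp).isGroupoidEquiv (D.isSerreFibration_proj hp hfib)

end

variable {E : Type u} {B : Type v} [NormedAddCommGroup E] [NormedSpace ℂ E]
  [NormedAddCommGroup B] [NormedSpace ℂ B]
  {X S : Type*} [TopologicalSpace X] [ChartedSpace E X] [IsManifold 𝓘(ℂ, E) ω X]
  [TopologicalSpace S] [ChartedSpace B S] {p : X → S}
  {s₀ s₁ : S} {γ : Path s₀ s₁} (D : Thickening γ)
  {hp : IsSubmersion 𝓘(ℂ, E) 𝓘(ℂ, B) ω p}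
  {Φ Φ' : Rep.{_, _, w} hp.complement (Fibre hp s₀) ⥤ Rep.{_, _, w} hp.complement (Fibre hp s₁)}

/-- A functor induced by all path classes between the two fibres is induced by `Q_γ`. -/
def inducedFunctor (P : PathInduced (D.incl₀ hp) (D.incl₁ hp) Φ) : D.InducedFunctor hp Φ where
  τ V q := P.τ V (PathClasses.cls q.1)
  holomorphic V q c := ContMDiffAt.comp q (P.isHolFamily V q.1 c) contMDiff_subtype_val.contMDiffAt
  left_invariant V _ _ g e := P.left V g _ e
  right_equivariant V _ _ h e := P.right V _ h e
  natural T _ e := P.natural T _ e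

/-- As `𝔻` is simply connected, `Q_γ` consists of all path classes between the two fibres. -/
def pathInduced (J : D.InducedFunctor hp Φ) : PathInduced (D.incl₀ hp) (D.incl₁ hp) Φ :=
  let q {x y} (c : Path.Homotopic.Quotient (D.incl₀ hp x) (D.incl₁ hp y)) : D.Q hp :=
    ⟨PathClasses.mk x y c, by
      change _ ∈ D.QSet hp
      rw [QSet_eq_univ]
      trivial⟩
  { τ V _ _ c := J.τ V (q c)
    left V _ _ _ g c e := J.left_invariant V (q c) g e
    right V _ _ _ c h e := J.right_equivariant V (q c) h e
    natural T _ _ c e := J.natural T (q c) e }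

variable {D} in
/-- The functors induced by path classes do not depend on the neighbourhood: two neighbourhoods are
compared with a smaller one. -/
theorem nonempty_iso_of_pathInduced (hfib : IsSerreFibration p) {D' : Thickening γ}
    (P : PathInduced (D.incl₀ hp) (D.incl₁ hp) Φ)
    (P' : PathInduced (D'.incl₀ hp) (D'.incl₁ hp) Φ') : Nonempty (Φ ≅ Φ') := by
  obtain ⟨D₀, hD₀⟩ := Thickening.exists_subset B (γ := γ) (D.carrier ⊓ D'.carrier).isOpen
    fun t => ⟨D.graph_mem t, D'.graph_mem t⟩
  have h : ∀ D₁ : Thickening γ, (D₀.carrier : Set (S × ℂ)) ⊆ D₁.carrier →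
      ∀ {Φ : Rep.{_, _, w} hp.complement (Fibre hp s₀) ⥤
      Rep.{_, _, w} hp.complement (Fibre hp s₁)},
      PathInduced (D₁.incl₀ hp) (D₁.incl₁ hp) Φ →
      Nonempty (PathInduced (D₀.incl₀ hp) (D₀.incl₁ hp) Φ) := by
    intro D₁ hD₁ Φ P
    let j : C(D₀.Total hp, D₁.Total hp) := ⟨fun z => ⟨(z.1.1, ⟨z.1.2.1, hD₁ z.1.2.2⟩), z.2⟩, by
      refine Continuous.subtype_mk (Continuous.prodMk ?_ (Continuous.subtype_mk ?_ _)) _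
      · exact continuous_fst.comp continuous_subtype_val
      · exact continuous_subtype_val.comp (continuous_snd.comp continuous_subtype_val)⟩
    exact ⟨PathInduced.restrict j P⟩
  obtain ⟨P₁⟩ := h D (fun z hz => (hD₀ hz).1) P
  obtain ⟨P₁'⟩ := h D' (fun z hz => (hD₀ hz).2) P'
  exact P₁.nonempty_iso (D₀.isGroupoidEquiv_incl₀ hp hfib) P₁'

end Thickening

/-- The fibres of a holomorphic submersion are finite-dimensional manifolds. If the total space is
empty, the model space of the fibres need not be finite-dimensional. -/
theorem finiteDimensional_complement {E : Type u} {B : Type v} [NormedAddCommGroup E]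
    [NormedSpace ℂ E] [FiniteDimensional ℂ E] [NormedAddCommGroup B] [NormedSpace ℂ B]
    {X S : Type*} [TopologicalSpace X] [ChartedSpace E X] [TopologicalSpace S] [ChartedSpace B S]
    {p : X → S} (hp : IsSubmersion 𝓘(ℂ, E) 𝓘(ℂ, B) ω p) (x : X) :
    FiniteDimensional ℂ hp.complement := by
  let e := (hp.isSubmersionOfComplement_complement x).equiv
  have := LinearEquiv.finiteDimensional e.toLinearEquiv
  exact FiniteDimensional.of_surjective (LinearMap.snd ℂ B hp.complement) LinearMap.snd_surjective

end Isomonodromy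

end

theorem mainTheorem8
    {E B : Type*} [NormedAddCommGroup E] [NormedSpace ℂ E] [FiniteDimensional ℂ E]
    [NormedAddCommGroup B] [NormedSpace ℂ B] [FiniteDimensional ℂ B]
    {X S : Type*} [TopologicalSpace X] [T2Space X] [ChartedSpace E X] [IsManifold 𝓘(ℂ, E) ω X]
    [TopologicalSpace S] [T2Space S] [ChartedSpace B S] [IsManifold 𝓘(ℂ, B) ω S]
    (p : X → S) (hp : IsSubmersion 𝓘(ℂ, E) 𝓘(ℂ, B) ω p)
    (hfib : Isomonodromy.IsSerreFibration p)
    {s₀ s₁ : S} (γ : Path s₀ s₁) :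
    Nonempty (Isomonodromy.Thickening γ) ∧
    ∃ P : Isomonodromy.FlatConn.{_, _, w} hp.complement (Isomonodromy.Fibre hp s₀) ≌
        Isomonodromy.FlatConn.{_, _, w} hp.complement (Isomonodromy.Fibre hp s₁),
      (∀ D : Isomonodromy.Thickening γ, D.Induces hp P.functor) ∧
      ∀ (D : Isomonodromy.Thickening γ)
        (P' : Isomonodromy.FlatConn.{_, _, w} hp.complement (Isomonodromy.Fibre hp s₀) ⥤
          Isomonodromy.FlatConn.{_, _, w} hp.complement (Isomonodromy.Fibre hp s₁)),
        D.Induces hp P' → Nonempty (P' ≅ P.functor) := by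
  -- The model space `hp.complement` need not be finite-dimensional if `X` is empty.
  have hE {s : S} (x : Isomonodromy.Fibre hp s) : FiniteDimensional ℂ hp.complement :=
    Isomonodromy.finiteDimensional_complement hp x.val
  obtain ⟨D₀, -⟩ := Isomonodromy.Thickening.exists_subset B (γ := γ) isOpen_univ fun _ => trivial
  let R₀ := (Isomonodromy.FlatConn.riemannHilbert.{_, _, w}
    (M := Isomonodromy.Fibre hp s₀) hE).asEquivalence
  let R₁ := (Isomonodromy.FlatConn.riemannHilbert.{_, _, w}
    (M := Isomonodromy.Fibre hp s₁) hE).asEquivalence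
  have ha := fun D : Isomonodromy.Thickening γ => D.isGroupoidEquiv_incl₀ hp hfib
  have hb := fun D : Isomonodromy.Thickening γ => D.isGroupoidEquiv_incl₁ hp hfib
  let F (D : Isomonodromy.Thickening γ) :
      Isomonodromy.Rep.{_, _, w} hp.complement (Isomonodromy.Fibre hp s₀) ⥤
        Isomonodromy.Rep.{_, _, w} hp.complement (Isomonodromy.Fibre hp s₁) :=
    (ha D).functor (D.incl₁ hp)
  let J (D : Isomonodromy.Thickening γ) :
      Isomonodromy.PathInduced (D.incl₀ hp) (D.incl₁ hp) (F D) := (ha D).pathInduced (D.incl₁ hp)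
  have := fun D => (J D).isEquivalence (ha D) (hb D)
  let Φ := fun D => (F D).asEquivalence
  -- The equivalence is defined by `D₀`. For the other neighbourhoods, `F D` is isomorphic to `F D₀`.
  refine ⟨⟨D₀⟩, R₀.trans ((Φ D₀).trans R₁.symm), fun D => ?_, ?_⟩
  · obtain ⟨i⟩ := Isomonodromy.Thickening.nonempty_iso_of_pathInduced hfib (J D₀) (J D)
    exact ⟨R₀, R₁, Φ D, ⟨Isomonodromy.FlatConn.isRiemannHilbert hE⟩,
      ⟨Isomonodromy.FlatConn.isRiemannHilbert hE⟩, ⟨D.inducedFunctor (J D)⟩,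
      ⟨Functor.isoWhiskerLeft R₀.functor (Functor.isoWhiskerRight i R₁.inverse)⟩⟩
  · rintro D P' ⟨R₀', R₁', Φ', ⟨r₀⟩, ⟨r₁⟩, ⟨K⟩, ⟨k⟩⟩
    obtain ⟨i₀⟩ := r₀.nonempty_iso hE (Isomonodromy.FlatConn.isRiemannHilbert hE)
    obtain ⟨i₁⟩ := r₁.nonempty_iso hE (Isomonodromy.FlatConn.isRiemannHilbert hE)
    obtain ⟨i⟩ := Isomonodromy.Thickening.nonempty_iso_of_pathInduced hfib (D.pathInduced K) (J D₀)
    exact ⟨k ≪≫ NatIso.hcomp i₀ (NatIso.hcomp i (Iso.isoInverseOfIsoFunctor i₁))⟩
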